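/- **Theorem (All-Pairs Directed-RSP).** Let $G=(V,E,\ell,d)$ be a directed graph (parallel edges and loops are allowed) with $n=|V|\ge 2$ vertices, $m=|E|$ edges, edge lengths $\ell:E\to\mathbb{R}_{\ge 0}$ and edge delays $d:E\to\mathbb{R}_{\ge 0}$. For a path $P$ put $\ell(P)=\sum_{e\in P}\ell(e)$ and $d(P)=\sum_{e\in P}d(e)$ (a path is a sequence of consecutive edges, and an edge counts as often as it is used), and let $\mathrm{dist}_G(s,t,D)$ be the smallest length of an $(s,t)$-path $P$ with $d(P)\le D$ ($\infty$ if there is none). Let $0<\varepsilon\le 1$ with $\varepsilon^{-1}=\mathrm{poly}(n)$ and let $0<D_{\min}\le D_{\max}$ with $D_{\max}/D_{\min}=\mathrm{poly}(n)$. There is a randomized (Monte Carlo) algorithm that preprocesses $G$ in $$O\!\left(\frac{mn\log^3 n}{\varepsilon}+\frac{n^2\log^5 n}{\varepsilon^2}\right)$$ time, in the worst case over its random choices, so that afterwards every query $(s,t,D)$ with $s,t\in V$ and $D\in[D_{\min},D_{\max}]$ is answered deterministically in constant time. With high probability all the answers are correct, where a correct answer to $(s,t,D)$ is the length $\ell(P)$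 of some $(s,t)$-path $P$ in $G$ such that $$\ell(P)\le \mathrm{dist}_G(s,t,D)\qquad\text{and}\qquad d(P)\le (1+\varepsilon)D;$$ if no $(s,t)$-path has delay at most $D$, then $\infty$ is also a correct answer. Here "with high probability" means with probability at least $1-n^{-\gamma}$ for an arbitrary constant $\gamma$ fixed in advance; the algorithm and the constants in the bounds may depend on $\gamma$ and on the degree of the polynomials bounding $\varepsilon^{-1}$ and $D_{\max}/D_{\min}$, and on nothing else. The computational model is a randomized RAM with words of $O(\log(n+m))$ bits and exact real arithmetic, in which each arithmetical operation, comparison, memory access, uniform random choice from $\{0,\dots,k-1\}$ ($k$ a word), and rounded logarithm $\lfloor\log_b x\rfloor$ ($b>1$, $x\ge 1$ real, result fitting in a word) costs one step. -/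

import Mathlib

open scoped NNReal ENNReal

namespace RSP

/-! ### Directed graphs with lengths and delays -/

/-- A directed graph on the vertices `0, …, n-1` with the edges `0, …, m-1`; every edge has a
non-negative length and a non-negative delay. Parallel edges and loops are allowed. -/
structure Net (n m : ℕ) where
  src : Fin m → Fin n
  tgt : Fin m → Fin n
  len : Fin m → ℝ≥0
  delay : Fin m → ℝ≥0

namespace Net

variable {n m : ℕ}

/-- `G.IsPath s p t`: the list of edges `p` is a path from `s` to `t` (the empty list is the path
from `s` to `s`). -/
def IsPath (G : Net n m) : Fin n → List (Fin m) → Fin n → Prop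
  | s, [], t => s = t
  | s, e :: p, t => G.src e = s ∧ G.IsPath (G.tgt e) p t

/-- The length of a path. -/
def pathLen (G : Net n m) (p : List (Fin m)) : ℝ≥0 := (p.map G.len).sum

/-- The delay of a path. -/
def pathDelay (G : Net n m) (p : List (Fin m)) : ℝ≥0 := (p.map G.delay).sum

/-- `dist(s,t,D)`: the smallest length of an `(s,t)`-path of delay at most `D`; it is `∞` if there
is no such path. -/
noncomputable def dist (G : Net n m) (s t : Fin n) (D : ℝ) : ℝ≥0∞ :=
  ⨅ (p : List (Fin m)) (_ : G.IsPath s p t ∧ (G.pathDelay p : ℝ) ≤ D), (G.pathLen p : ℝ≥0∞)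

/-- Correct answers to the query `(s,t,D)`. A finite answer has to be the length of an
`(s,t)`-path of length at most `dist(s,t,D)` and delay at most `(1+ε)D`. The answer `none`, which
stands for `∞`, is correct only if no `(s,t)`-path has delay at most `D`. -/
def IsAnswer (G : Net n m) (ε : ℝ) (s t : Fin n) (D : ℝ) : Option ℝ → Prop
  | none => G.dist s t D = ⊤
  | some x => ∃ p, G.IsPath s p t ∧ x = (G.pathLen p : ℝ) ∧
      (G.pathLen p : ℝ≥0∞) ≤ G.dist s t D ∧ (G.pathDelay p : ℝ) ≤ (1 + ε) * D

end Net

/-! ### A randomized real RAM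

The memory consists of words (natural numbers that are bounded by the parameter `B` of the machine)
and of real numbers. Both kinds are kept in numbered registers and in numbered arrays, which are
indexed by words; a program mentions only finitely many of them. Every operation costs one step. -/

/-- The memory of the machine, with the number of random draws made so far. -/
structure Store where
  wvar : ℕ → ℕ
  rvar : ℕ → ℝ
  warr : ℕ → ℕ → ℕ
  rarr : ℕ → ℕ → ℝ
  draws : ℕ

/-- Word-valued expressions. -/
inductive WExp where
  | lit (k : ℕ)
  | var (x : ℕ)
  | arr (a : ℕ) (i : WExp)
  | add (e f : WExp)
  | sub (e f : WExp)
  | mul (e f : WExp)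
  | div (e f : WExp)
  | mod (e f : WExp)

/-- Real-valued expressions. -/
inductive RExp where
  | ofWord (e : WExp)
  | var (x : ℕ)
  | arr (a : ℕ) (i : WExp)
  | add (e f : RExp)
  | sub (e f : RExp)
  | mul (e f : RExp)
  | div (e f : RExp)

/-- Tests. -/
inductive Test where
  | wle (e f : WExp)
  | rle (e f : RExp)
  | not (b : Test)
  | and (b c : Test)

/-- Programs. `rand x e` draws a uniformly random word below the value of `e`, and `log x b y` is
the rounded logarithm `x := ⌊log_b y⌋`, the only passage from reals to words. -/
inductive Cmd where
  | setW (x : ℕ) (e : WExp)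
  | setR (x : ℕ) (e : RExp)
  | storeW (a : ℕ) (i : WExp) (e : WExp)
  | storeR (a : ℕ) (i : WExp) (e : RExp)
  | rand (x : ℕ) (e : WExp)
  | log (x : ℕ) (b y : RExp)
  | seq (c d : Cmd)
  | ite (b : Test) (c d : Cmd)
  | while (b : Test) (c : Cmd)

/-- The result of an arithmetical operation on words; there is none if it does not fit in a word. -/
def fit (B v : ℕ) : Option ℕ := if v ≤ B then some v else none

/-- The value of a word expression; `none` is an overflow. Subtraction is truncated at `0`. -/
def WExp.eval (B : ℕ) (σ : Store) : WExp → Option ℕ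
  | .lit k => fit B k
  | .var x => some (σ.wvar x)
  | .arr a i => (i.eval B σ).map (σ.warr a)
  | .add e f => (e.eval B σ).bind fun v => (f.eval B σ).bind fun w => fit B (v + w)
  | .sub e f => (e.eval B σ).bind fun v => (f.eval B σ).bind fun w => fit B (v - w)
  | .mul e f => (e.eval B σ).bind fun v => (f.eval B σ).bind fun w => fit B (v * w)
  | .div e f => (e.eval B σ).bind fun v => (f.eval B σ).bind fun w => fit B (v / w)
  | .mod e f => (e.eval B σ).bind fun v => (f.eval B σ).bind fun w => fit B (v % w)

/-- The value of a real expression. -/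
noncomputable def RExp.eval (B : ℕ) (σ : Store) : RExp → Option ℝ
  | .ofWord e => (e.eval B σ).map fun v => (v : ℝ)
  | .var x => some (σ.rvar x)
  | .arr a i => (i.eval B σ).map (σ.rarr a)
  | .add e f => (e.eval B σ).bind fun x => (f.eval B σ).map fun y => x + y
  | .sub e f => (e.eval B σ).bind fun x => (f.eval B σ).map fun y => x - y
  | .mul e f => (e.eval B σ).bind fun x => (f.eval B σ).map fun y => x * y
  | .div e f => (e.eval B σ).bind fun x => (f.eval B σ).map fun y => x / y

open Classical in
/-- The value of a test. -/
noncomputable def Test.eval (B : ℕ) (σ : Store) : Test → Option Bool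
  | .wle e f => (e.eval B σ).bind fun v => (f.eval B σ).map fun w => decide (v ≤ w)
  | .rle e f => (e.eval B σ).bind fun x => (f.eval B σ).map fun y => decide (x ≤ y)
  | .not b => (b.eval B σ).map fun v => !v
  | .and b c => (b.eval B σ).bind fun v => (c.eval B σ).map fun w => v && w

/-- The number of steps for the evaluation of a word expression. -/
def WExp.cost : WExp → ℕ
  | .lit _ => 1
  | .var _ => 1
  | .arr _ i => i.cost + 1
  | .add e f => e.cost + f.cost + 1
  | .sub e f => e.cost + f.cost + 1
  | .mul e f => e.cost + f.cost + 1
  | .div e f => e.cost + f.cost + 1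
  | .mod e f => e.cost + f.cost + 1

/-- The number of steps for the evaluation of a real expression. -/
def RExp.cost : RExp → ℕ
  | .ofWord e => e.cost + 1
  | .var _ => 1
  | .arr _ i => i.cost + 1
  | .add e f => e.cost + f.cost + 1
  | .sub e f => e.cost + f.cost + 1
  | .mul e f => e.cost + f.cost + 1
  | .div e f => e.cost + f.cost + 1

/-- The number of steps for the evaluation of a test. -/
def Test.cost : Test → ℕ
  | .wle e f => e.cost + f.cost + 1
  | .rle e f => e.cost + f.cost + 1
  | .not b => b.cost + 1
  | .and b c => b.cost + c.cost + 1

/-- Random tapes: `ω (i, k)` is the outcome of the draw number `i` if this is a draw from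
`{0, …, k}`. -/
abbrev Tape : Type := (q : ℕ × ℕ) → Fin (q.2 + 1)

/-- The law of the random tape: all entries are independent and uniformly distributed. -/
noncomputable def tapeLaw : MeasureTheory.Measure Tape :=
  MeasureTheory.Measure.infinitePi fun q : ℕ × ℕ =>
    (PMF.uniformOfFintype (Fin (q.2 + 1))).toMeasure

/-- `Exec B ω c σ τ T`: on the machine with words bounded by `B` and with the random tape `ω`, the
program `c`, started in the memory `σ`, halts after `T` steps in the memory `τ`. There is no such
`τ` if the run does not end or meets a word overflow, a draw from an empty range, or an undefined
or too large rounded logarithm. -/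
inductive Exec (B : ℕ) (ω : Tape) : Cmd → Store → Store → ℕ → Prop where
  | setW {x : ℕ} {e : WExp} {σ : Store} {v : ℕ} (he : e.eval B σ = some v) :
      Exec B ω (.setW x e) σ { σ with wvar := Function.update σ.wvar x v } (e.cost + 1)
  | setR {x : ℕ} {e : RExp} {σ : Store} {v : ℝ} (he : e.eval B σ = some v) :
      Exec B ω (.setR x e) σ { σ with rvar := Function.update σ.rvar x v } (e.cost + 1)
  | storeW {a : ℕ} {i e : WExp} {σ : Store} {j v : ℕ}
      (hi : i.eval B σ = some j) (he : e.eval B σ = some v) :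
      Exec B ω (.storeW a i e) σ
        { σ with warr := Function.update σ.warr a (Function.update (σ.warr a) j v) }
        (i.cost + e.cost + 1)
  | storeR {a : ℕ} {i : WExp} {e : RExp} {σ : Store} {j : ℕ} {v : ℝ}
      (hi : i.eval B σ = some j) (he : e.eval B σ = some v) :
      Exec B ω (.storeR a i e) σ
        { σ with rarr := Function.update σ.rarr a (Function.update (σ.rarr a) j v) }
        (i.cost + e.cost + 1)
  | rand {x : ℕ} {e : WExp} {σ : Store} {k : ℕ} (he : e.eval B σ = some (k + 1)) :
      Exec B ω (.rand x e) σ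
        { σ with
          wvar := Function.update σ.wvar x (ω (σ.draws, k))
          draws := σ.draws + 1 }
        (e.cost + 1)
  | log {x : ℕ} {b y : RExp} {σ : Store} {β z : ℝ}
      (hb : b.eval B σ = some β) (hy : y.eval B σ = some z) (hβ : 1 < β) (hz : 1 ≤ z)
      (hB : ⌊Real.logb β z⌋₊ ≤ B) :
      Exec B ω (.log x b y) σ
        { σ with wvar := Function.update σ.wvar x ⌊Real.logb β z⌋₊ } (b.cost + y.cost + 1)
  | seq {c d : Cmd} {σ σ' σ'' : Store} {T T' : ℕ}
      (hc : Exec B ω c σ σ' T) (hd : Exec B ω d σ' σ'' T') :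
      Exec B ω (.seq c d) σ σ'' (T + T')
  | ite_true {b : Test} {c d : Cmd} {σ σ' : Store} {T : ℕ}
      (hb : b.eval B σ = some true) (hc : Exec B ω c σ σ' T) :
      Exec B ω (.ite b c d) σ σ' (b.cost + 1 + T)
  | ite_false {b : Test} {c d : Cmd} {σ σ' : Store} {T : ℕ}
      (hb : b.eval B σ = some false) (hd : Exec B ω d σ σ' T) :
      Exec B ω (.ite b c d) σ σ' (b.cost + 1 + T)
  | while_true {b : Test} {c : Cmd} {σ σ' σ'' : Store} {T T' : ℕ}
      (hb : b.eval B σ = some true) (hc : Exec B ω c σ σ' T)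
      (hw : Exec B ω (.while b c) σ' σ'' T') :
      Exec B ω (.while b c) σ σ'' (b.cost + 1 + T + T')
  | while_false {b : Test} {c : Cmd} {σ : Store} (hb : b.eval B σ = some false) :
      Exec B ω (.while b c) σ σ (b.cost + 1)

/-- A run is determined by the program, the tape and the memory at its start. -/
theorem Exec.unique {B : ℕ} {ω : Tape} {c : Cmd} {σ τ τ' : Store} {T T' : ℕ}
    (h : Exec B ω c σ τ T) (h' : Exec B ω c σ τ' T') : τ = τ' ∧ T = T' := by
  induction h generalizing τ' T' with
  | seq hc hd ihc ihd =>
    cases h' with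
    | seq hc' hd' =>
      obtain ⟨rfl, rfl⟩ := ihc hc'
      obtain ⟨rfl, rfl⟩ := ihd hd'
      exact ⟨rfl, rfl⟩
  | while_true hb hc hw ihc ihw =>
    cases h' with
    | while_true hb' hc' hw' =>
      obtain ⟨rfl, rfl⟩ := ihc hc'
      obtain ⟨rfl, rfl⟩ := ihw hw'
      exact ⟨rfl, rfl⟩
    | while_false hb' => simp_all
  | ite_true hb hc ih =>
    cases h' with
    | ite_true hb' hc' =>
      obtain ⟨rfl, rfl⟩ := ih hc'
      exact ⟨rfl, rfl⟩
    | ite_false hb' hc' => simp_all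
  | ite_false hb hc ih =>
    cases h' with
    | ite_true hb' hc' => simp_all
    | ite_false hb' hc' =>
      obtain ⟨rfl, rfl⟩ := ih hc'
      exact ⟨rfl, rfl⟩
  | rand he =>
    cases h' with
    | rand he' =>
      rw [he] at he'
      cases he'
      exact ⟨rfl, rfl⟩
  | _ => cases h' <;> simp_all

/-! ### Input and output -/

/-- A finite sequence, written to an array and padded with zeros. -/
def pad {α : Type} [Zero α] {m : ℕ} (f : Fin m → α) (i : ℕ) : α :=
  if h : i < m then f ⟨i, h⟩ else 0

/-- The memory at the start of the preprocessing: `n` and `m` are in the word registers `0`, `1`;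
`ε`, `D_min`, `D_max` are in the real registers `0`, `1`, `2`; sources and targets of the edges are
in the word arrays `0`, `1`; lengths and delays are in the real arrays `0`, `1`. All the rest
is `0`. -/
def startStore {n m : ℕ} (G : Net n m) (ε Dmin Dmax : ℝ) : Store where
  wvar x := if x = 0 then n else if x = 1 then m else 0
  rvar x := if x = 0 then ε else if x = 1 then Dmin else if x = 2 then Dmax else 0
  warr a := if a = 0 then pad fun e => (G.src e : ℕ) else
    if a = 1 then pad fun e => (G.tgt e : ℕ) else fun _ => 0
  rarr a := if a = 0 then pad fun e => (G.len e : ℝ) else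
    if a = 1 then pad fun e => (G.delay e : ℝ) else fun _ => 0
  draws := 0

/-- The memory at the start of a query: the arrays are those of the data structure `σ`, the query
`(s,t,D)` is in the word registers `0`, `1` and in the real register `0`, and all the other
registers are `0`. -/
def queryStore {n : ℕ} (σ : Store) (s t : Fin n) (D : ℝ) : Store where
  wvar x := if x = 0 then s else if x = 1 then t else 0
  rvar x := if x = 0 then D else 0
  warr := σ.warr
  rarr := σ.rarr
  draws := 0

/-- The answer of a query: `∞` (that is, `none`) if the word register `0` holds `0`, and otherwise
the content of the real register `0`. -/
def Store.answer (σ : Store) : Option ℝ := if σ.wvar 0 = 0 then none else some (σ.rvar 0)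

end RSP

/-! The data structure is a hierarchy of dynamic programs over rounded delays, one hierarchy for
each delay scale `D₀ = Dmin * 2 ^ j`. With `n ≤ 2 ^ L ≤ 2n`, level `k ≤ L` has `lam * 2 ^ (k+1)`
sources and measures delay in units `g k` proportional to `2 ^ k`. The number of sources doubles
while the number of delay values halves, so all levels have equally many (source, delay) pairs. Edge
delays are rounded up to positive multiples of the unit. This makes the recursion over the delay
well-founded and costs at most one unit per edge.

To keep the rounding error small, a table of level `k+1` may start with a shortcut from its source
`x` to a source `y` of level `k`. Consecutive levels traverse the edges in opposite directions, so
the level `k` table of `y`, read at `x`, is such a shortcut. On a given path, only the edges behind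
the last source of level `k` are then rounded with the unit `g (k+1)`; the rest is handed down,
reversed, to level `k`. All vertices are sources of level `L`, whose tables answer the queries.
Entries always come from genuine paths (`tbl_sound`); that they are short enough is `tbl_complete`.

If level `k` has sources within `X k` steps of both ends of a path with `h` edges, the total error
is `h * g 0 + ∑ X k * g (k+1)`. Bounding each `X k` separately would cost a logarithm. Instead the
weighted sum `∑ X k * 2 ^ k` is bounded at once: disjoint blocks of draws serve the different
levels, so missing the normalized amounts `a k` on all levels has probability at most `exp (-∑ a
k)`, and the sum over all vectors with `∑ a k ≥ T` is at most `8 ^ L / 2 ^ T`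
(`tapeLaw_not_dense_le`). Hence `lam = O(log n)` gives error at most `3 * D₀ / (8 * E)` (`err_le`),
where `E` is between `1/ε` and `2/ε`.

A query delay is compared with a finite grid of delays. For each pair of vertices and each grid
delay one optimal simple path is fixed by the graph alone, and a union bound makes the sources dense
on all of them (`tapeLaw_exists_not_covered_le`). Then every answer is correct (`isAnswer`).

Running the tables for `O(log n)` scales and `L + 1` levels, at `O(lam * E * 2 ^ L * (n + m + lam *
2 ^ L))` each, gives the time bound. The programs are verified in a calculus of total correctness
with time bounds (`Runs`), in which stored words are at most `A` and machine words go up to `A ^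
slack`. -/

namespace RSP

/-! ### A program calculus for the RAM, with time bounds and without overflows. -/

/-! ### Total evaluation of expressions -/

/-- The value of a word expression on a machine with unbounded words. -/
def WExp.val (σ : Store) : WExp → ℕ
  | .lit k => k
  | .var x => σ.wvar x
  | .arr a i => σ.warr a (i.val σ)
  | .add e f => e.val σ + f.val σ
  | .sub e f => e.val σ - f.val σ
  | .mul e f => e.val σ * f.val σ
  | .div e f => e.val σ / f.val σ
  | .mod e f => e.val σ % f.val σ

/-- The number of leaves of a word expression. -/
def WExp.leaves : WExp → ℕ
  | .lit _ => 1
  | .var _ => 1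
  | .arr _ i => i.leaves
  | .add e f => e.leaves + f.leaves
  | .sub e f => e.leaves + f.leaves
  | .mul e f => e.leaves + f.leaves
  | .div e f => e.leaves + f.leaves
  | .mod e f => e.leaves + f.leaves

/-- The largest literal of a word expression. -/
def WExp.maxLit : WExp → ℕ
  | .lit k => k
  | .var _ => 0
  | .arr _ i => i.maxLit
  | .add e f => max e.maxLit f.maxLit
  | .sub e f => max e.maxLit f.maxLit
  | .mul e f => max e.maxLit f.maxLit
  | .div e f => max e.maxLit f.maxLit
  | .mod e f => max e.maxLit f.maxLit

/-- The value of a real expression on a machine with unbounded words. -/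
noncomputable def RExp.val (σ : Store) : RExp → ℝ
  | .ofWord e => (e.val σ : ℝ)
  | .var x => σ.rvar x
  | .arr a i => σ.rarr a (i.val σ)
  | .add e f => e.val σ + f.val σ
  | .sub e f => e.val σ - f.val σ
  | .mul e f => e.val σ * f.val σ
  | .div e f => e.val σ / f.val σ

/-- A bound on the leaves of the word expressions in a real expression. -/
def RExp.leaves : RExp → ℕ
  | .ofWord e => e.leaves
  | .var _ => 1
  | .arr _ i => i.leaves
  | .add e f => e.leaves + f.leaves
  | .sub e f => e.leaves + f.leaves
  | .mul e f => e.leaves + f.leaves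
  | .div e f => e.leaves + f.leaves

/-- The largest word literal of a real expression. -/
def RExp.maxLit : RExp → ℕ
  | .ofWord e => e.maxLit
  | .var _ => 0
  | .arr _ i => i.maxLit
  | .add e f => max e.maxLit f.maxLit
  | .sub e f => max e.maxLit f.maxLit
  | .mul e f => max e.maxLit f.maxLit
  | .div e f => max e.maxLit f.maxLit

/-- The truth of a test on a machine with unbounded words. -/
def Test.holds (σ : Store) : Test → Prop
  | .wle e f => e.val σ ≤ f.val σ
  | .rle e f => e.val σ ≤ f.val σ
  | .not b => ¬ b.holds σ
  | .and b c => b.holds σ ∧ c.holds σ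

/-- A bound on the leaves of the word expressions in a test. -/
def Test.leaves : Test → ℕ
  | .wle e f => e.leaves + f.leaves
  | .rle e f => e.leaves + f.leaves
  | .not b => b.leaves
  | .and b c => b.leaves + c.leaves

/-- The largest word literal of a test. -/
def Test.maxLit : Test → ℕ
  | .wle e f => max e.maxLit f.maxLit
  | .rle e f => max e.maxLit f.maxLit
  | .not b => b.maxLit
  | .and b c => max b.maxLit c.maxLit

/-- All words in the memory are at most `A`. -/
def Bounded (A : ℕ) (σ : Store) : Prop := (∀ x, σ.wvar x ≤ A) ∧ ∀ a i, σ.warr a i ≤ A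

theorem WExp.leaves_pos (e : WExp) : 1 ≤ e.leaves := by
  induction e <;> simp only [WExp.leaves] <;> omega

/-- Every leaf accounts for one factor `A`: sums and products of numbers up to `A ^ p` and `A ^ q`
are at most `A ^ (p + q)` because `A ≥ 2`. A fixed exponent therefore excludes overflow in all
intermediate values, such as table addresses, which may exceed `A`. -/
theorem WExp.eval_eq {A s : ℕ} (hA : 2 ≤ A) {σ : Store} (hσ : Bounded A σ) (e : WExp)
    (hl : e.maxLit ≤ A) (hs : e.leaves ≤ s) :
    e.eval (A ^ s) σ = some (e.val σ) ∧ e.val σ ≤ A ^ e.leaves := by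
  have hpow : ∀ k, 1 ≤ k → A ≤ A ^ k := fun k hk => Nat.le_self_pow (by omega) A
  have hfit : ∀ v k, v ≤ A ^ k → k ≤ s → fit (A ^ s) v = some v := fun v k hv hk => by
    rw [fit, if_pos (hv.trans (Nat.pow_le_pow_right (by omega) hk))]
  have key : ∀ e f : WExp, ∀ v, v ≤ e.val σ * f.val σ ∨ v ≤ e.val σ + f.val σ →
      e.val σ ≤ A ^ e.leaves → f.val σ ≤ A ^ f.leaves → v ≤ A ^ (e.leaves + f.leaves) := by
    intro e f v hv he hf
    have h1 := (hA.trans (hpow _ e.leaves_pos))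
    have h2 := (hA.trans (hpow _ f.leaves_pos))
    rw [pow_add]
    rcases hv with hv | hv
    · exact hv.trans (Nat.mul_le_mul he hf)
    · nlinarith
  have aux : ∀ {P R : Prop}, R → (R → P) → P ∧ R := fun r p => ⟨p r, r⟩
  induction e with
  | lit k =>
    have : k ≤ A ^ 1 := by simpa [WExp.maxLit] using hl
    exact ⟨hfit _ 1 this hs, this⟩
  | var x => exact ⟨rfl, by simpa [WExp.leaves, WExp.val] using hσ.1 x⟩
  | arr a i ih =>
    obtain ⟨h1, h2⟩ := ih hl hs
    refine ⟨by simp [WExp.eval, h1, WExp.val], ?_⟩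
    exact (hσ.2 _ _).trans (hpow _ i.leaves_pos)
  | add e f ihe ihf | sub e f ihe ihf | mul e f ihe ihf | div e f ihe ihf | mod e f ihe ihf =>
    simp only [WExp.maxLit, max_le_iff, WExp.leaves] at hl hs
    obtain ⟨h1, h2⟩ := ihe hl.1 (by omega)
    obtain ⟨h3, h4⟩ := ihf hl.2 (by omega)
    refine aux (key e f _ ?_ h2 h4) fun h5 => ?_
    · first
      | exact Or.inr le_rfl
      | exact Or.inl le_rfl
      | exact Or.inr ((Nat.sub_le _ _).trans (Nat.le_add_right _ _))
      | exact Or.inr ((Nat.div_le_self _ _).trans (Nat.le_add_right _ _))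
      | exact Or.inr ((Nat.mod_le _ _).trans (Nat.le_add_right _ _))
    · simp only [WExp.eval, h1, h3, Option.bind_some]
      exact hfit _ _ h5 hs

theorem RExp.eval_eq {A s : ℕ} (hA : 2 ≤ A) {σ : Store} (hσ : Bounded A σ) (e : RExp)
    (hl : e.maxLit ≤ A) (hs : e.leaves ≤ s) : e.eval (A ^ s) σ = some (e.val σ) := by
  induction e with
  | ofWord e => simp [RExp.eval, RExp.val, (WExp.eval_eq hA hσ e hl hs).1]
  | var x => rfl
  | arr a i => simp [RExp.eval, RExp.val, (WExp.eval_eq hA hσ i hl hs).1]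
  | add e f ihe ihf | sub e f ihe ihf | mul e f ihe ihf | div e f ihe ihf =>
    simp only [RExp.maxLit, max_le_iff, RExp.leaves] at hl hs
    simp [RExp.eval, RExp.val, ihe hl.1 (by omega), ihf hl.2 (by omega)]

open Classical in
theorem Test.eval_eq {A s : ℕ} (hA : 2 ≤ A) {σ : Store} (hσ : Bounded A σ) (b : Test)
    (hl : b.maxLit ≤ A) (hs : b.leaves ≤ s) : b.eval (A ^ s) σ = some (decide (b.holds σ)) := by
  induction b with
  | wle e f =>
    simp only [Test.maxLit, max_le_iff, Test.leaves] at hl hs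
    have h1 := (WExp.eval_eq (s := s) hA hσ e hl.1 (by omega)).1
    have h2 := (WExp.eval_eq (s := s) hA hσ f hl.2 (by omega)).1
    simp only [Test.eval, h1, h2, Option.bind_some, Option.map_some, Option.some.injEq]
    rw [Bool.eq_iff_iff, decide_eq_true_iff, decide_eq_true_iff]
    rfl
  | rle e f =>
    simp only [Test.maxLit, max_le_iff, Test.leaves] at hl hs
    have h1 := RExp.eval_eq (s := s) hA hσ e hl.1 (by omega)
    have h2 := RExp.eval_eq (s := s) hA hσ f hl.2 (by omega)
    simp only [Test.eval, h1, h2, Option.bind_some, Option.map_some, Option.some.injEq]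
    rw [Bool.eq_iff_iff, decide_eq_true_iff, decide_eq_true_iff]
    rfl
  | not b ih =>
    rw [Test.eval, ih hl hs]
    by_cases h : b.holds σ <;> simp [Test.holds, h]
  | and b c ihb ihc =>
    simp only [Test.maxLit, max_le_iff, Test.leaves] at hl hs
    rw [Test.eval, ihb hl.1 (by omega), ihc hl.2 (by omega)]
    by_cases h : b.holds σ <;> by_cases h' : c.holds σ <;> simp [Test.holds, h, h']

/-! ### Updates of the memory -/

namespace Store

/-- Assignment to a word register. -/
def setW (σ : Store) (x v : ℕ) : Store := { σ with wvar := Function.update σ.wvar x v }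

/-- Assignment to a real register. -/
def setR (σ : Store) (x : ℕ) (v : ℝ) : Store := { σ with rvar := Function.update σ.rvar x v }

/-- Assignment to an entry of a word array. -/
def putW (σ : Store) (a j v : ℕ) : Store :=
  { σ with warr := Function.update σ.warr a (Function.update (σ.warr a) j v) }

/-- Assignment to an entry of a real array. -/
def putR (σ : Store) (a j : ℕ) (v : ℝ) : Store :=
  { σ with rarr := Function.update σ.rarr a (Function.update (σ.rarr a) j v) }

/-- A draw of a word. -/
def draw (σ : Store) (x v : ℕ) : Store :=
  { σ with wvar := Function.update σ.wvar x v, draws := σ.draws + 1 }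

variable (σ : Store) (x y a b i j w : ℕ) (v : ℝ)

@[simp] theorem setW_wvar : (σ.setW x w).wvar y = if y = x then w else σ.wvar y := by
  simp [setW, Function.update_apply]
@[simp] theorem setW_rvar : (σ.setW x w).rvar = σ.rvar := rfl
@[simp] theorem setW_warr : (σ.setW x w).warr = σ.warr := rfl
@[simp] theorem setW_rarr : (σ.setW x w).rarr = σ.rarr := rfl
@[simp] theorem setW_draws : (σ.setW x w).draws = σ.draws := rfl

@[simp] theorem draw_wvar : (σ.draw x w).wvar y = if y = x then w else σ.wvar y := by
  simp [draw, Function.update_apply]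
@[simp] theorem draw_rvar : (σ.draw x w).rvar = σ.rvar := rfl
@[simp] theorem draw_warr : (σ.draw x w).warr = σ.warr := rfl
@[simp] theorem draw_rarr : (σ.draw x w).rarr = σ.rarr := rfl
@[simp] theorem draw_draws : (σ.draw x w).draws = σ.draws + 1 := rfl

@[simp] theorem setR_rvar : (σ.setR x v).rvar y = if y = x then v else σ.rvar y := by
  simp [setR, Function.update_apply]
@[simp] theorem setR_wvar : (σ.setR x v).wvar = σ.wvar := rfl
@[simp] theorem setR_warr : (σ.setR x v).warr = σ.warr := rfl
@[simp] theorem setR_rarr : (σ.setR x v).rarr = σ.rarr := rfl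
@[simp] theorem setR_draws : (σ.setR x v).draws = σ.draws := rfl

@[simp] theorem putW_warr :
    (σ.putW a j w).warr b i = if b = a ∧ i = j then w else σ.warr b i := by
  by_cases h : b = a
  · subst h; simp [putW, Function.update_apply]
  · simp [putW, h]
@[simp] theorem putW_wvar : (σ.putW a j w).wvar = σ.wvar := rfl
@[simp] theorem putW_rvar : (σ.putW a j w).rvar = σ.rvar := rfl
@[simp] theorem putW_rarr : (σ.putW a j w).rarr = σ.rarr := rfl
@[simp] theorem putW_draws : (σ.putW a j w).draws = σ.draws := rfl

@[simp] theorem putR_rarr :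
    (σ.putR a j v).rarr b i = if b = a ∧ i = j then v else σ.rarr b i := by
  by_cases h : b = a
  · subst h; simp [putR, Function.update_apply]
  · simp [putR, h]
@[simp] theorem putR_wvar : (σ.putR a j v).wvar = σ.wvar := rfl
@[simp] theorem putR_rvar : (σ.putR a j v).rvar = σ.rvar := rfl
@[simp] theorem putR_warr : (σ.putR a j v).warr = σ.warr := rfl
@[simp] theorem putR_draws : (σ.putR a j v).draws = σ.draws := rfl

end Store

variable {A : ℕ} {σ τ : Store} {ω : Tape}

theorem Bounded.setW (h : Bounded A σ) {x v : ℕ} (hv : v ≤ A) : Bounded A (σ.setW x v) :=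
  ⟨fun y => by rw [Store.setW_wvar]; split_ifs <;> simp [hv, h.1 y], h.2⟩

theorem Bounded.draw (h : Bounded A σ) {x v : ℕ} (hv : v ≤ A) : Bounded A (σ.draw x v) :=
  ⟨fun y => by rw [Store.draw_wvar]; split_ifs <;> simp [hv, h.1 y], h.2⟩

theorem Bounded.putW (h : Bounded A σ) {a j v : ℕ} (hv : v ≤ A) : Bounded A (σ.putW a j v) :=
  ⟨h.1, fun b i => by rw [Store.putW_warr]; split_ifs <;> simp [hv, h.2 b i]⟩

/-! ### The part of the memory that a program may change -/

/-- The word registers that a program may change. -/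
def Cmd.wmod : Cmd → List ℕ
  | .setW x _ | .rand x _ | .log x _ _ => [x]
  | .seq c d | .ite _ c d => c.wmod ++ d.wmod
  | .while _ c => c.wmod
  | _ => []

/-- The real registers that a program may change. -/
def Cmd.rmod : Cmd → List ℕ
  | .setR x _ => [x]
  | .seq c d | .ite _ c d => c.rmod ++ d.rmod
  | .while _ c => c.rmod
  | _ => []

/-- The word arrays that a program may change. -/
def Cmd.wamod : Cmd → List ℕ
  | .storeW a _ _ => [a]
  | .seq c d | .ite _ c d => c.wamod ++ d.wamod
  | .while _ c => c.wamod
  | _ => []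

/-- The real arrays that a program may change. -/
def Cmd.ramod : Cmd → List ℕ
  | .storeR a _ _ => [a]
  | .seq c d | .ite _ c d => c.ramod ++ d.ramod
  | .while _ c => c.ramod
  | _ => []

/-- Whether a program may draw random words. -/
def Cmd.draws : Cmd → Bool
  | .rand _ _ => true
  | .seq c d | .ite _ c d => c.draws || d.draws
  | .while _ c => c.draws
  | _ => false

/-- The memory `τ` differs from `σ` only where the program `c` may change it. -/
structure Frame (c : Cmd) (σ τ : Store) : Prop where
  w : ∀ x, x ∉ c.wmod → τ.wvar x = σ.wvar x
  r : ∀ x, x ∉ c.rmod → τ.rvar x = σ.rvar x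
  wa : ∀ a, a ∉ c.wamod → τ.warr a = σ.warr a
  ra : ∀ a, a ∉ c.ramod → τ.rarr a = σ.rarr a
  d : c.draws = false → τ.draws = σ.draws

theorem Frame.refl (c : Cmd) (σ : Store) : Frame c σ σ :=
  ⟨fun _ _ => rfl, fun _ _ => rfl, fun _ _ => rfl, fun _ _ => rfl, fun _ => rfl⟩

theorem Frame.trans {c : Cmd} {ρ : Store} (h : Frame c σ τ) (h' : Frame c τ ρ) : Frame c σ ρ :=
  ⟨fun x hx => (h'.w x hx).trans (h.w x hx), fun x hx => (h'.r x hx).trans (h.r x hx),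
    fun x hx => (h'.wa x hx).trans (h.wa x hx), fun x hx => (h'.ra x hx).trans (h.ra x hx),
    fun hx => (h'.d hx).trans (h.d hx)⟩

theorem Frame.mono {c d : Cmd} (h : Frame c σ τ) (hw : c.wmod ⊆ d.wmod) (hr : c.rmod ⊆ d.rmod)
    (hwa : c.wamod ⊆ d.wamod) (hra : c.ramod ⊆ d.ramod)
    (hd : d.draws = false → c.draws = false) : Frame d σ τ :=
  ⟨fun x hx => h.w x fun hc => hx (hw hc), fun x hx => h.r x fun hc => hx (hr hc),
    fun x hx => h.wa x fun hc => hx (hwa hc), fun x hx => h.ra x fun hc => hx (hra hc),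
    fun hx => h.d (hd hx)⟩

theorem Frame.seq_left {c d : Cmd} (h : Frame c σ τ) : Frame (.seq c d) σ τ :=
  h.mono (by simp [Cmd.wmod]) (by simp [Cmd.rmod]) (by simp [Cmd.wamod]) (by simp [Cmd.ramod])
    (by simp +contextual [Cmd.draws])

theorem Frame.seq_right {c d : Cmd} (h : Frame d σ τ) : Frame (.seq c d) σ τ :=
  h.mono (by simp [Cmd.wmod]) (by simp [Cmd.rmod]) (by simp [Cmd.wamod]) (by simp [Cmd.ramod])
    (by simp +contextual [Cmd.draws])

/-- For a concrete program the sets of changed registers are computable, so that unchanged memory is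
recognized by `decide`. -/
theorem Exec.frame {B T : ℕ} {c : Cmd} (h : Exec B ω c σ τ T) : Frame c σ τ := by
  induction h with
  | setW he | rand he | log hb hy hβ hz hB =>
    refine ⟨fun y hy => ?_, fun _ _ => rfl, fun _ _ => rfl, fun _ _ => rfl, by simp [Cmd.draws]⟩
    simp only [Cmd.wmod, List.mem_singleton] at hy
    simp [hy]
  | setR he =>
    refine ⟨fun _ _ => rfl, fun y hy => ?_, fun _ _ => rfl, fun _ _ => rfl, fun _ => rfl⟩
    simp only [Cmd.rmod, List.mem_singleton] at hy
    simp [hy]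
  | storeW hi he =>
    refine ⟨fun _ _ => rfl, fun _ _ => rfl, fun y hy => ?_, fun _ _ => rfl, fun _ => rfl⟩
    simp only [Cmd.wamod, List.mem_singleton] at hy
    simp [hy]
  | storeR hi he =>
    refine ⟨fun _ _ => rfl, fun _ _ => rfl, fun _ _ => rfl, fun y hy => ?_, fun _ => rfl⟩
    simp only [Cmd.ramod, List.mem_singleton] at hy
    simp [hy]
  | seq hc hd ihc ihd => exact ihc.seq_left.trans ihd.seq_right
  | ite_true hb hc ih =>
    exact ih.mono (by simp [Cmd.wmod]) (by simp [Cmd.rmod]) (by simp [Cmd.wamod])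
      (by simp [Cmd.ramod]) (by simp +contextual [Cmd.draws])
  | ite_false hb hc ih =>
    exact ih.mono (by simp [Cmd.wmod]) (by simp [Cmd.rmod]) (by simp [Cmd.wamod])
      (by simp [Cmd.ramod]) (by simp +contextual [Cmd.draws])
  | while_true hb hc hw ihc ihw =>
    exact Frame.trans (ihc.mono (fun _ h => h) (fun _ h => h) (fun _ h => h) (fun _ h => h)
      fun h => h) ihw
  | while_false hb => exact Frame.refl _ _

/-! ### Total correctness with a time bound -/

/-- The exponent by which the word bound of the machine exceeds the bound on stored words. -/
def slack : ℕ := 60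

/-- The program `c`, started in `σ`, halts within `T` steps in a memory with words at most `A` that
satisfies `Q`. -/
def Runs (A : ℕ) (ω : Tape) (c : Cmd) (σ : Store) (T : ℕ) (Q : Store → Prop) : Prop :=
  ∃ τ T', Exec (A ^ slack) ω c σ τ T' ∧ T' ≤ T ∧ Bounded A τ ∧ Q τ

theorem Runs.mono {c : Cmd} {T T' : ℕ} {Q Q' : Store → Prop} (h : Runs A ω c σ T Q) (hT : T ≤ T')
    (hQ : ∀ τ, Bounded A τ → Frame c σ τ → Q τ → Q' τ) : Runs A ω c σ T' Q' := by
  obtain ⟨τ, S, he, hS, hB, hq⟩ := h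
  exact ⟨τ, S, he, hS.trans hT, hB, hQ τ hB he.frame hq⟩

theorem Runs.post {c : Cmd} {T : ℕ} {Q Q' : Store → Prop} (h : Runs A ω c σ T Q)
    (hQ : ∀ τ, Bounded A τ → Frame c σ τ → Q τ → Q' τ) : Runs A ω c σ T Q' :=
  h.mono le_rfl hQ

theorem Runs.time {c : Cmd} {T T' : ℕ} {Q : Store → Prop} (h : Runs A ω c σ T Q) (hT : T ≤ T') :
    Runs A ω c σ T' Q :=
  h.mono hT fun _ _ _ hq => hq

theorem Runs.seq {c d : Cmd} {T T' : ℕ} {R Q : Store → Prop} (hc : Runs A ω c σ T R)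
    (hd : ∀ τ, Bounded A τ → Frame c σ τ → R τ → Runs A ω d τ T' Q) :
    Runs A ω (.seq c d) σ (T + T') Q := by
  obtain ⟨τ, S, he, hS, hB, hr⟩ := hc
  obtain ⟨τ', S', he', hS', hB', hq⟩ := hd τ hB he.frame hr
  exact ⟨τ', _, .seq he he', by omega, hB', hq⟩

theorem Runs.setW' {x : ℕ} {e : WExp} {Q : Store → Prop} (hA : 2 ≤ A) (hσ : Bounded A σ)
    (hl : e.leaves ≤ slack) (hm : e.maxLit ≤ A) (hv : e.val σ ≤ A) (hQ : Q (σ.setW x (e.val σ))) :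
    Runs A ω (.setW x e) σ (e.cost + 1) Q :=
  ⟨_, _, .setW (WExp.eval_eq hA hσ e hm hl).1, le_rfl, hσ.setW hv, hQ⟩

theorem Runs.setW {x : ℕ} {e : WExp} {Q : Store → Prop} (hA : 32 ≤ A) (hσ : Bounded A σ)
    (hv : e.val σ ≤ A) (hQ : Q (σ.setW x (e.val σ)))
    (hl : e.leaves ≤ slack ∧ e.maxLit ≤ 32 := by decide) :
    Runs A ω (.setW x e) σ (e.cost + 1) Q :=
  Runs.setW' (by omega) hσ hl.1 (hl.2.trans hA) hv hQ

theorem Runs.setR {x : ℕ} {e : RExp} {Q : Store → Prop} (hA : 32 ≤ A) (hσ : Bounded A σ)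
    (hQ : Q (σ.setR x (e.val σ)))
    (hl : e.leaves ≤ slack ∧ e.maxLit ≤ 32 := by decide) :
    Runs A ω (.setR x e) σ (e.cost + 1) Q :=
  ⟨_, _, .setR (RExp.eval_eq (by omega) hσ e (hl.2.trans hA) hl.1), le_rfl, hσ, hQ⟩

theorem Runs.storeW {a : ℕ} {i e : WExp} {Q : Store → Prop} (hA : 32 ≤ A) (hσ : Bounded A σ)
    (hv : e.val σ ≤ A) (hQ : Q (σ.putW a (i.val σ) (e.val σ)))
    (hi : i.leaves ≤ slack ∧ i.maxLit ≤ 32 := by decide)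
    (hl : e.leaves ≤ slack ∧ e.maxLit ≤ 32 := by decide) :
    Runs A ω (.storeW a i e) σ (i.cost + e.cost + 1) Q :=
  ⟨_, _, .storeW (WExp.eval_eq (by omega) hσ i (hi.2.trans hA) hi.1).1
    (WExp.eval_eq (by omega) hσ e (hl.2.trans hA) hl.1).1, le_rfl, hσ.putW hv, hQ⟩

theorem Runs.storeR {a : ℕ} {i : WExp} {e : RExp} {Q : Store → Prop} (hA : 32 ≤ A)
    (hσ : Bounded A σ) (hQ : Q (σ.putR a (i.val σ) (e.val σ)))
    (hi : i.leaves ≤ slack ∧ i.maxLit ≤ 32 := by decide)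
    (hl : e.leaves ≤ slack ∧ e.maxLit ≤ 32 := by decide) :
    Runs A ω (.storeR a i e) σ (i.cost + e.cost + 1) Q :=
  ⟨_, _, .storeR (WExp.eval_eq (by omega) hσ i (hi.2.trans hA) hi.1).1
    (RExp.eval_eq (by omega) hσ e (hl.2.trans hA) hl.1), le_rfl, hσ, hQ⟩

theorem Runs.rand {x : ℕ} {e : WExp} {k : ℕ} {Q : Store → Prop} (hA : 32 ≤ A) (hσ : Bounded A σ)
    (hk : e.val σ = k + 1) (hkA : k ≤ A) (hQ : Q (σ.draw x (ω (σ.draws, k))))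
    (hl : e.leaves ≤ slack ∧ e.maxLit ≤ 32 := by decide) :
    Runs A ω (.rand x e) σ (e.cost + 1) Q :=
  ⟨_, _, .rand (hk ▸ (WExp.eval_eq (by omega) hσ e (hl.2.trans hA) hl.1).1), le_rfl,
    hσ.draw ((Nat.lt_succ_iff.1 (ω (σ.draws, k)).2).trans hkA), hQ⟩

theorem Runs.log {x : ℕ} {b y : RExp} {Q : Store → Prop} (hA : 32 ≤ A) (hσ : Bounded A σ)
    (hβ : 1 < b.val σ) (hz : 1 ≤ y.val σ) (hv : ⌊Real.logb (b.val σ) (y.val σ)⌋₊ ≤ A)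
    (hQ : Q (σ.setW x ⌊Real.logb (b.val σ) (y.val σ)⌋₊))
    (hb : b.leaves ≤ slack ∧ b.maxLit ≤ 32 := by decide)
    (hy : y.leaves ≤ slack ∧ y.maxLit ≤ 32 := by decide) :
    Runs A ω (.log x b y) σ (b.cost + y.cost + 1) Q :=
  ⟨_, _, .log (RExp.eval_eq (by omega) hσ b (hb.2.trans hA) hb.1)
    (RExp.eval_eq (by omega) hσ y (hy.2.trans hA) hy.1) hβ hz
    (hv.trans (Nat.le_self_pow (by decide) A)), le_rfl, hσ.setW hv, hQ⟩

theorem Runs.ite {b : Test} {c d : Cmd} {T : ℕ} {Q : Store → Prop} (hA : 32 ≤ A)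
    (hσ : Bounded A σ) (hc : b.holds σ → Runs A ω c σ T Q) (hd : ¬ b.holds σ → Runs A ω d σ T Q)
    (hl : b.leaves ≤ slack ∧ b.maxLit ≤ 32 := by decide) :
    Runs A ω (.ite b c d) σ (b.cost + 1 + T) Q := by
  have hb := Test.eval_eq (by omega) hσ b (hl.2.trans hA) hl.1
  by_cases h : b.holds σ
  · obtain ⟨τ, S, he, hS, hq⟩ := hc h
    exact ⟨τ, _, .ite_true (by simpa [h] using hb) he, by omega, hq⟩
  · obtain ⟨τ, S, he, hS, hq⟩ := hd h
    exact ⟨τ, _, .ite_false (by simpa [h] using hb) he, by omega, hq⟩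

/-- The program that leaves the memory as it is. -/
def Cmd.skip : Cmd := .setR 30 (.var 30)

theorem Runs.skip {Q : Store → Prop} (hσ : Bounded A σ) (hQ : Q σ) :
    Runs A ω Cmd.skip σ 2 Q := by
  refine ⟨_, _, .setR rfl, le_rfl, hσ, ?_⟩
  simpa using hQ

/-- The loop in which the word register `x` runs from `0` to the value of the register `b`. -/
def Cmd.for (x b : ℕ) (c : Cmd) : Cmd :=
  .seq (.setW x (.lit 0)) (.while (.not (.wle (.var b) (.var x)))
    (.seq c (.setW x (.add (.var x) (.lit 1)))))

/-- The invariant is required after the increment of the counter. Besides the body, a round costs 5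
steps for the test and 4 for the increment; the initialization and the last test cost 7. -/
theorem Runs.for {x b : ℕ} {c : Cmd} {T : ℕ} (N : ℕ) (Inv : ℕ → Store → Prop) (hA : 32 ≤ A)
    (hσ : Bounded A σ) (hN : σ.wvar b = N)
    (h0 : Inv 0 (σ.setW x 0))
    (hc : ∀ i τ, i < N → Bounded A τ → Frame (Cmd.for x b c) σ τ → τ.wvar x = i → Inv i τ →
      Runs A ω c τ T fun τ' => Inv (i + 1) (τ'.setW x (i + 1)))
    (hmod : x ≠ b ∧ x ∉ c.wmod ∧ b ∉ c.wmod := by decide) :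
    Runs A ω (Cmd.for x b c) σ (N * (T + 9) + 7) fun τ => τ.wvar x = N ∧ Inv N τ := by
  obtain ⟨hxb, hx, hb⟩ := hmod
  have hNA : N ≤ A := hN ▸ hσ.1 b
  have hbmod : b ∉ (Cmd.for x b c).wmod := by
    simp only [Cmd.for, Cmd.wmod, List.mem_append, List.mem_singleton]
    tauto
  -- Induction on the number `k` of rounds that remain.
  have main : ∀ k i τ, i + k = N → Bounded A τ → Frame (Cmd.for x b c) σ τ → τ.wvar x = i →
      Inv i τ → Runs A ω (.while (.not (.wle (.var b) (.var x)))
        (.seq c (.setW x (.add (.var x) (.lit 1))))) τ (k * (T + 9) + 5)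
        fun τ => τ.wvar x = N ∧ Inv N τ := by
    intro k
    induction k with
    | zero =>
      intro i τ hi hB hF hxi hI
      have hi' : i = N := by omega
      subst hi'
      refine ⟨τ, _, .while_false ?_, by simp [Test.cost, WExp.cost], hB, hxi, hI⟩
      simp [Test.eval, WExp.eval, hF.w b hbmod, hN, hxi]
    | succ k ih =>
      intro i τ hi hB hF hxi hI
      obtain ⟨τ', S, he, hS, hB', hI'⟩ := hc i τ (by omega) hB hF hxi hI
      have hx' : τ'.wvar x = i := (he.frame.w x hx).trans hxi
      have hset : Exec (A ^ slack) ω (.setW x (.add (.var x) (.lit 1))) τ' (τ'.setW x (i + 1)) 4 := by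
        have := WExp.eval_eq (s := slack) (by omega : 2 ≤ A) hB' (.add (.var x) (.lit 1))
          (by simp [WExp.maxLit]; omega) (by simp [WExp.leaves, slack])
        simp only [WExp.val, hx'] at this
        exact .setW this.1
      have hseq := Exec.seq he hset
      have hFseq : Frame (Cmd.for x b c) τ (τ'.setW x (i + 1)) := by
        refine (hseq.frame).mono ?_ ?_ ?_ ?_ ?_ <;>
          simp [Cmd.for, Cmd.wmod, Cmd.rmod, Cmd.wamod, Cmd.ramod, Cmd.draws]
      obtain ⟨τ'', S', he', hS', hB'', hq⟩ := ih (i + 1) (τ'.setW x (i + 1)) (by omega)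
        (hB'.setW (by omega)) (hF.trans hFseq) (by simp) hI'
      refine ⟨τ'', _, .while_true ?_ hseq he', ?_, hB'', hq⟩
      · simp [Test.eval, WExp.eval, hF.w b hbmod, hN, hxi]
        omega
      · simp only [Test.cost, WExp.cost]
        have : (k + 1) * (T + 9) = k * (T + 9) + (T + 9) := by ring
        omega
  have hfst : Runs A ω (.setW x (.lit 0)) σ 2 fun τ => τ = σ.setW x 0 :=
    Runs.setW (e := .lit 0) hA hσ (by simp [WExp.val]) rfl
  refine (Runs.seq hfst ?_).time (by omega : 2 + (N * (T + 9) + 5) ≤ _)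
  rintro τ hB hF rfl
  exact main N 0 _ (by omega) hB hF.seq_left (by simp) h0

end RSP

/-! ### The tables: definition, soundness and completeness. -/

namespace RSP

/-! ### Encoded lengths -/

/-- A table entry `c` stands for `∞` if `c < 1` and for the length `c - 1` otherwise. `UB c b` says
that the entry is finite and at most `b`. -/
def UB (c b : ℝ) : Prop := 1 ≤ c ∧ c ≤ b

open Classical in
/-- The relaxation of the entry `y` by an edge of length `l` from an entry `c`. -/
noncomputable def relax (f : ℕ → ℝ) (y : ℕ) (c l : ℝ) : ℕ → ℝ :=
  if 1 ≤ c ∧ ¬ (1 ≤ f y ∧ f y ≤ c + l) then Function.update f y (c + l) else f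

/-- A finite entry is overwritten only by a smaller one, so upper bounds survive all later
relaxations. -/
theorem UB.relax_old {f : ℕ → ℝ} {y v : ℕ} {c l b : ℝ} (hl : 0 ≤ l) (h : UB (f v) b) :
    UB (relax f y c l v) b := by
  unfold relax
  split_ifs with hc
  · rw [Function.update_apply]
    split_ifs with hv
    · subst hv
      obtain ⟨h1, h2⟩ := hc
      rw [not_and, not_le] at h2
      exact ⟨by linarith, (h2 h.1).le.trans h.2⟩
    · exact h
  · exact h

theorem UB.relax_new {f : ℕ → ℝ} {y : ℕ} {c l b : ℝ} (hl : 0 ≤ l) (h : UB c b) :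
    UB (relax f y c l y) (b + l) := by
  unfold relax
  split_ifs with hc
  · rw [Function.update_self]
    exact ⟨by linarith [h.1], by linarith [h.2]⟩
  · rw [not_and, not_not] at hc
    exact ⟨(hc h.1).1, (hc h.1).2.trans (by linarith [h.2])⟩

/-- `R` will say that an entry is realized by a path to the vertex. -/
theorem relax_sound {f : ℕ → ℝ} {y : ℕ} {c l : ℝ} {R : ℕ → ℝ → Prop}
    (hf : ∀ v, 1 ≤ f v → R v (f v)) (hc : 1 ≤ c → R y (c + l)) :
    ∀ v, 1 ≤ relax f y c l v → R v (relax f y c l v) := by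
  intro v hv
  unfold relax at hv ⊢
  split_ifs at hv ⊢ with h
  · rw [Function.update_apply] at hv ⊢
    split_ifs at hv ⊢ with hvy
    · subst hvy; exact hc h.1
    · exact hf v hv
  · exact hf v hv

/-! ### The rounding of delays -/

open Classical in
/-- The least `ρ ≥ 1` with `δ ≤ ρ * g`, or `N + 1` if that is larger than `N`. -/
noncomputable def scan (δ g : ℝ) : ℕ → ℕ
  | 0 => 1
  | i + 1 => if δ ≤ scan δ g i * g then scan δ g i else scan δ g i + 1

theorem scan_pos (δ g : ℝ) (N : ℕ) : 1 ≤ scan δ g N := by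
  induction N with
  | zero => exact le_rfl
  | succ i ih => rw [scan]; split_ifs <;> omega

theorem scan_le (δ g : ℝ) (N : ℕ) : scan δ g N ≤ N + 1 := by
  induction N with
  | zero => exact le_rfl
  | succ i ih => rw [scan]; split_ifs <;> omega

/-- The value `N + 1` means saturation and gives no bound. Rows with index at most `N` never use
such an edge. -/
theorem le_scan_mul (δ g : ℝ) (N : ℕ) : scan δ g N ≤ N → δ ≤ scan δ g N * g := by
  induction N with
  | zero => simp [scan]
  | succ i ih =>
    rw [scan]
    split_ifs with h
    · exact fun _ => h
    · intro h'
      exact absurd (ih (by omega)) h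

/-- The counter advances only while `scan * g < δ`, so rounding loses at most one unit. This
includes zero delays, rounded to one unit, and saturation. -/
theorem scan_mul_le {δ : ℝ} (hδ : 0 ≤ δ) (g : ℝ) (N : ℕ) : scan δ g N * g ≤ δ + g := by
  induction N with
  | zero => simp [scan, hδ]
  | succ i ih =>
    rw [scan]
    split_ifs with h
    · exact ih
    · push_cast
      linarith

/-! ### The tables -/

/-- A table row before the relaxations. -/
noncomputable def initRow (x : ℕ) : ℕ → ℝ := fun v => if v = x then 1 else 0

/-- A table row after the relaxation of the shortcuts to `Y 0, …, Y (c-1)`. -/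
noncomputable def shortRow (Y : ℕ → ℕ) (x : ℕ) (sh : ℕ → ℝ) : ℕ → ℕ → ℝ
  | 0 => initRow x
  | c + 1 => relax (shortRow Y x sh c) (Y c) (sh c) 0

/-- A table row, started from `f`, after the relaxation of the edges `0, …, c-1`. -/
noncomputable def edgeRow (tail head rd : ℕ → ℕ) (len : ℕ → ℝ) (prev : ℕ → ℕ → ℝ) (I : ℕ)
    (f : ℕ → ℝ) : ℕ → ℕ → ℝ
  | 0 => f
  | c + 1 => if rd c ≤ I then
      relax (edgeRow tail head rd len prev I f c) (head c) (prev (I - rd c) (tail c)) (len c)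
    else edgeRow tail head rd len prev I f c

theorem shortRow_sound {Y : ℕ → ℕ} {x : ℕ} {sh : ℕ → ℝ} {R : ℕ → ℝ → Prop} (hx : R x 1) {c : ℕ}
    (hc : ∀ r < c, 1 ≤ sh r → R (Y r) (sh r + 0)) :
    ∀ v, 1 ≤ shortRow Y x sh c v → R v (shortRow Y x sh c v) := by
  induction c with
  | zero =>
    intro v hv
    simp only [shortRow, initRow] at hv ⊢
    split_ifs at hv ⊢ with h
    · exact h ▸ hx
    · norm_num at hv
  | succ c ih => exact relax_sound (ih fun r hr => hc r (by omega)) (hc c (by omega))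

theorem edgeRow_sound {tail head rd : ℕ → ℕ} {len : ℕ → ℝ} {prev : ℕ → ℕ → ℝ} {I : ℕ}
    {f : ℕ → ℝ} {R : ℕ → ℝ → Prop} (hf : ∀ v, 1 ≤ f v → R v (f v)) {c : ℕ}
    (hc : ∀ e < c, rd e ≤ I → 1 ≤ prev (I - rd e) (tail e) →
      R (head e) (prev (I - rd e) (tail e) + len e)) :
    ∀ v, 1 ≤ edgeRow tail head rd len prev I f c v →
      R v (edgeRow tail head rd len prev I f c v) := by
  induction c with
  | zero => exact hf
  | succ c ih =>
    have ih' := ih fun e he => hc e (by omega)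
    rw [edgeRow]
    split_ifs with h
    · exact relax_sound ih' (hc c (by omega) h)
    · exact ih'

theorem UB.shortRow_mono {Y : ℕ → ℕ} {x : ℕ} {sh : ℕ → ℝ} {c c' v : ℕ} {b : ℝ} (hc : c ≤ c')
    (h : UB (shortRow Y x sh c v) b) : UB (shortRow Y x sh c' v) b := by
  induction c', hc using Nat.le_induction with
  | base => exact h
  | succ c' _ ih => exact ih.relax_old le_rfl

theorem UB.edgeRow_mono {tail head rd : ℕ → ℕ} {len : ℕ → ℝ} {prev : ℕ → ℕ → ℝ} {I : ℕ}
    {f : ℕ → ℝ} {c c' v : ℕ} {b : ℝ} (hlen : ∀ e, 0 ≤ len e) (hc : c ≤ c')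
    (h : UB (edgeRow tail head rd len prev I f c v) b) :
    UB (edgeRow tail head rd len prev I f c' v) b := by
  induction c', hc using Nat.le_induction with
  | base => exact h
  | succ c' _ ih =>
    rw [edgeRow]
    split_ifs
    · exact ih.relax_old (hlen _)
    · exact ih

/-- The input of the algorithm apart from the delay scale: the graph, the accuracy `1/E`, the number
of levels, the sampling rate and the sampled vertices. -/
structure Data (n m : ℕ) where
  net : Net n m
  E : ℕ
  L : ℕ
  lam : ℕ
  Y : ℕ → ℕ

namespace Data

variable {n m : ℕ} (d : Data n m)

/-- The number of sources of a level. -/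
def M (k : ℕ) : ℕ := d.lam * 2 ^ (k + 1)

/-- The number of shortcuts that a level takes from the preceding one. -/
def Mp (k : ℕ) : ℕ := if k = 0 then 0 else d.lam * 2 ^ k

/-- The largest delay of a level, in units of the granularity. -/
def N (k : ℕ) : ℕ := 32 * d.E * 2 ^ (d.L - k)

/-- The granularity of a level. -/
noncomputable def g (sc : ℝ) (k : ℕ) : ℝ := sc / (8 * d.E * 2 ^ d.L) * 2 ^ k

def src (e : ℕ) : ℕ := pad (fun e => (d.net.src e : ℕ)) e
def tgt (e : ℕ) : ℕ := pad (fun e => (d.net.tgt e : ℕ)) e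
noncomputable def len (e : ℕ) : ℝ := pad (fun e => (d.net.len e : ℝ)) e
noncomputable def delay (e : ℕ) : ℝ := pad (fun e => (d.net.delay e : ℝ)) e

/-- The tail of an edge in the direction of a level. -/
def tail (k e : ℕ) : ℕ := if (d.L - k) % 2 = 0 then d.src e else d.tgt e

/-- The head of an edge in the direction of a level. -/
def head (k e : ℕ) : ℕ := if (d.L - k) % 2 = 0 then d.tgt e else d.src e

/-- The rounded delay of an edge. -/
noncomputable def rd (sc : ℝ) (k e : ℕ) : ℕ := scan (d.delay e) (d.g sc k) (d.N k)

/-- The rows `0, …, I-1` of the table for one source. -/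
noncomputable def rows (sc : ℝ) (k x : ℕ) (sh : ℕ → ℕ → ℝ) : ℕ → ℕ → ℕ → ℝ
  | 0 => fun _ _ => 0
  | I + 1 => fun I' => if I' = I then
      edgeRow (d.tail k) (d.head k) (d.rd sc k) d.len (rows sc k x sh I) I
        (shortRow d.Y x (fun r => sh r I) (d.Mp k)) m
    else rows sc k x sh I I'

/-- The table for one source. -/
noncomputable def dp (sc : ℝ) (k x : ℕ) (sh : ℕ → ℕ → ℝ) (I : ℕ) : ℕ → ℝ :=
  d.rows sc k x sh (I + 1) I

/-- All tables: `tbl sc k r I v` is the entry of the level `k` for the source number `r`, the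
rounded delay `I` and the vertex `v`. -/
noncomputable def tbl (sc : ℝ) : ℕ → ℕ → ℕ → ℕ → ℝ
  | 0, r => d.dp sc 0 (d.Y r) fun _ _ => 0
  | k + 1, r => d.dp sc (k + 1) (d.Y r) fun r' I => tbl sc k r' (2 * I) (d.Y r)

/-- The entries of the shortcuts from a source. -/
noncomputable def sht (sc : ℝ) (k x r I : ℕ) : ℝ :=
  if k = 0 then 0 else d.tbl sc (k - 1) r (2 * I) x

theorem rd_pos (sc : ℝ) (k e : ℕ) : 1 ≤ d.rd sc k e := scan_pos _ _ _

theorem rows_of_lt {sc : ℝ} {k x : ℕ} {sh : ℕ → ℕ → ℝ} {I J : ℕ} (h : I < J) :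
    d.rows sc k x sh J I = d.dp sc k x sh I := by
  induction J with
  | zero => omega
  | succ J ih =>
    rcases Nat.lt_succ_iff_lt_or_eq.1 h with h | h
    · rw [rows]
      exact (if_neg h.ne).trans (ih h)
    · subst h; rfl

/-- Rounded delays are at least 1, so row `I` reads earlier rows only. This is why zero delays are
rounded up as well. -/
theorem edgeRow_congr {tail head rd : ℕ → ℕ} {len : ℕ → ℝ} {prev prev' : ℕ → ℕ → ℝ} {I : ℕ}
    {f : ℕ → ℝ} (hrd : ∀ e, 1 ≤ rd e) (h : ∀ I' < I, prev I' = prev' I') (c : ℕ) :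
    edgeRow tail head rd len prev I f c = edgeRow tail head rd len prev' I f c := by
  induction c with
  | zero => rfl
  | succ c ih =>
    rw [edgeRow, edgeRow, ih]
    split_ifs with hc
    · rw [h _ (by have := hrd c; omega)]
    · rfl

theorem dp_eq (sc : ℝ) (k x : ℕ) (sh : ℕ → ℕ → ℝ) (I : ℕ) :
    d.dp sc k x sh I = edgeRow (d.tail k) (d.head k) (d.rd sc k) d.len (d.dp sc k x sh) I
        (shortRow d.Y x (fun r => sh r I) (d.Mp k)) m := by
  rw [dp, rows]
  refine (if_pos rfl).trans ?_
  exact edgeRow_congr (d.rd_pos sc k) (fun I' h => d.rows_of_lt h) m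

/-- The common recursion of all levels. A shortcut reads row `2 * I` of the level below, whose unit
is half as large, with source and target exchanged because that level runs in the opposite
direction. -/
theorem tbl_eq (sc : ℝ) (k r I : ℕ) :
    d.tbl sc k r I = edgeRow (d.tail k) (d.head k) (d.rd sc k) d.len (d.tbl sc k r) I
        (shortRow d.Y (d.Y r) (fun r' => d.sht sc k (d.Y r) r' I) (d.Mp k)) m := by
  cases k with
  | zero =>
    simp only [tbl]
    rw [dp_eq]
    rfl
  | succ k =>
    simp only [tbl]
    rw [dp_eq]
    rfl

theorem len_nonneg (e : ℕ) : 0 ≤ d.len e := by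
  unfold len pad
  split_ifs <;> simp

theorem delay_nonneg (e : ℕ) : 0 ≤ d.delay e := by
  unfold delay pad
  split_ifs <;> simp

theorem g_succ (sc : ℝ) (k : ℕ) : d.g sc (k + 1) = 2 * d.g sc k := by
  unfold g
  ring

theorem g_pos {sc : ℝ} (hE : 0 < d.E) (hsc : 0 < sc) (k : ℕ) : 0 < d.g sc k := by
  unfold g
  have : (0 : ℝ) < d.E := by exact_mod_cast hE
  positivity

/-- Together with `g_succ` this keeps `N k * g k = 4 * sc` for all `k ≤ L`; row `2 * I` of the level
below exists whenever row `I` is in range. -/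
theorem N_eq {k : ℕ} (h : k + 1 ≤ d.L) : d.N k = 2 * d.N (k + 1) := by
  unfold N
  rw [show d.L - k = d.L - (k + 1) + 1 by omega, pow_succ]
  ring

/-! ### Soundness of the tables -/

/-- There is a path of length `l` and delay at most `δ` from `x` to `v`, in the direction of the
level `k`. -/
def Joins (k x v : ℕ) (l δ : ℝ) : Prop :=
  ∃ a b : Fin n, (a : ℕ) = x ∧ (b : ℕ) = v ∧ ∃ p,
    (if (d.L - k) % 2 = 0 then d.net.IsPath a p b else d.net.IsPath b p a) ∧
    l = (d.net.pathLen p : ℝ) ∧ (d.net.pathDelay p : ℝ) ≤ δ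

theorem _root_.RSP.Net.IsPath.append {G : Net n m} {a b c : Fin n} {p q : List (Fin m)}
    (hp : G.IsPath a p b) (hq : G.IsPath b q c) : G.IsPath a (p ++ q) c := by
  induction p generalizing a with
  | nil => cases hp; exact hq
  | cons e p ih => exact ⟨hp.1, ih hp.2⟩

theorem _root_.RSP.Net.pathLen_append (G : Net n m) (p q : List (Fin m)) :
    G.pathLen (p ++ q) = G.pathLen p + G.pathLen q := by simp [Net.pathLen]

theorem _root_.RSP.Net.pathDelay_append (G : Net n m) (p q : List (Fin m)) :
    G.pathDelay (p ++ q) = G.pathDelay p + G.pathDelay q := by simp [Net.pathDelay]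

theorem joins_refl {k x : ℕ} (hx : x < n) {δ : ℝ} (hδ : 0 ≤ δ) : d.Joins k x x 0 δ :=
  ⟨⟨x, hx⟩, ⟨x, hx⟩, rfl, rfl, [], by simp [Net.IsPath], by simp [Net.pathLen],
    by simpa [Net.pathDelay] using hδ⟩

theorem Joins.edge {d : Data n m} {k x e : ℕ} {l δ δ' : ℝ} (he : e < m)
    (h : d.Joins k x (d.tail k e) l δ) (hδ : δ + d.delay e ≤ δ') :
    d.Joins k x (d.head k e) (l + d.len e) δ' := by
  obtain ⟨a, b, rfl, hb, p, hp, rfl, hpd⟩ := h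
  have hsrc : d.src e = d.net.src ⟨e, he⟩ := by simp [src, pad, he]
  have htgt : d.tgt e = d.net.tgt ⟨e, he⟩ := by simp [tgt, pad, he]
  have hlen : d.len e = d.net.len ⟨e, he⟩ := by simp [len, pad, he]
  have hdel : d.delay e = d.net.delay ⟨e, he⟩ := by simp [delay, pad, he]
  unfold tail at hb
  unfold head
  by_cases hk : (d.L - k) % 2 = 0
  · simp only [hk, if_true] at hb hp ⊢
    rw [hsrc] at hb
    refine ⟨a, d.net.tgt ⟨e, he⟩, rfl, htgt.symm, p ++ [⟨e, he⟩], ?_, ?_, ?_⟩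
    · simp only [hk, if_true]
      exact hp.append ⟨(Fin.ext hb).symm, rfl⟩
    · rw [Net.pathLen_append, hlen]; simp [Net.pathLen]
    · rw [Net.pathDelay_append]
      rw [hdel] at hδ
      simp only [Net.pathDelay, List.map_cons, List.map_nil, List.sum_cons, List.sum_nil,
        add_zero, NNReal.coe_add] at hpd ⊢
      linarith
  · simp only [hk, if_false] at hb hp ⊢
    rw [htgt] at hb
    refine ⟨a, d.net.src ⟨e, he⟩, rfl, hsrc.symm, ⟨e, he⟩ :: p, ?_, ?_, ?_⟩
    · simp only [hk, if_false]
      refine ⟨rfl, ?_⟩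
      rw [← Fin.ext hb]
      exact hp
    · rw [hlen]; simp [Net.pathLen, add_comm]
    · rw [hdel] at hδ
      simp only [Net.pathDelay, List.map_cons, List.sum_cons, NNReal.coe_add] at hpd ⊢
      linarith

/-- The direction is given by the parity of `L - k`, which changes from `k` to `k + 1`. -/
theorem Joins.swap {d : Data n m} {k x v : ℕ} {l δ : ℝ} (hk : k + 1 ≤ d.L)
    (h : d.Joins k x v l δ) : d.Joins (k + 1) v x l δ := by
  obtain ⟨a, b, ha, hb, p, hp, hl⟩ := h
  refine ⟨b, a, hb, ha, p, ?_, hl⟩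
  by_cases h0 : (d.L - k) % 2 = 0
  · rw [if_neg (by omega)]; simpa [h0] using hp
  · rw [if_pos (by omega)]; simpa [h0] using hp

/-- This needs no luck in the choice of the sources: a shortcut is a path of the level below read
backwards, an edge extends a path from an earlier row, and delays are only rounded up. -/
theorem tbl_sound {sc : ℝ} (hE : 0 < d.E) (hsc : 0 < sc) (hY : ∀ r, d.Y r < n) {k : ℕ}
    (hk : k ≤ d.L) {r I : ℕ} (hI : I ≤ d.N k) {v : ℕ} (hv : 1 ≤ d.tbl sc k r I v) :
    d.Joins k (d.Y r) v (d.tbl sc k r I v - 1) (I * d.g sc k) := by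
  induction k generalizing r I v with
  | zero | succ k ihk =>
    induction I using Nat.strong_induction_on generalizing v with
    | _ I ihI =>
    have hg := d.g_pos hE hsc
    rw [tbl_eq] at hv ⊢
    refine edgeRow_sound (R := fun v c => d.Joins _ (d.Y r) v (c - 1) (I * d.g sc _))
      (shortRow_sound (R := fun v c => d.Joins _ (d.Y r) v (c - 1) (I * d.g sc _)) ?_
        fun r' hr' h => ?_) (fun e he hrd h => ?_) v hv
    · rw [sub_self]
      exact d.joins_refl (hY r) (mul_nonneg (Nat.cast_nonneg _) (hg _).le)
    -- Level 0 takes no shortcuts (`Mp 0 = 0`); the second alternative serves level `k + 1`.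
    · first
      | exact absurd hr' (Nat.not_lt_zero _)
      | have := (ihk (by omega) (by rw [d.N_eq hk]; omega) h).swap hk
        convert this using 1
        · simp [sht]
        · push_cast
          rw [g_succ]
          ring
    -- Since `rd ≤ I ≤ N`, the scan is not saturated and the rounded delay dominates the true one.
    · have h2 := le_scan_mul _ _ _ (hrd.trans hI)
      change _ ≤ ((d.rd sc _ e : ℕ) : ℝ) * _ at h2
      rw [add_sub_right_comm]
      refine Joins.edge he (ihI _ (Nat.sub_lt ((d.rd_pos sc _ e).trans hrd)
        (d.rd_pos sc _ e)) ((Nat.sub_le _ _).trans hI) h) ?_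
      rw [Nat.cast_sub hrd]
      linarith

/-! ### Completeness of the tables -/

/-- The row index bounds the delay from above, so the empty path starts every row. -/
theorem tbl_self (sc : ℝ) (k r I : ℕ) : UB (d.tbl sc k r I (d.Y r)) 1 := by
  rw [tbl_eq]
  refine UB.edgeRow_mono d.len_nonneg (Nat.zero_le _) (UB.shortRow_mono (Nat.zero_le _) ?_)
  simp [shortRow, initRow, UB]

theorem tbl_shortcut {sc : ℝ} {k r r' I : ℕ} {b : ℝ} (hr' : r' < d.M k)
    (h : UB (d.tbl sc k r' (2 * I) (d.Y r)) b) : UB (d.tbl sc (k + 1) r I (d.Y r')) b := by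
  rw [tbl_eq]
  refine UB.edgeRow_mono d.len_nonneg (Nat.zero_le _)
    (UB.shortRow_mono (c := r' + 1) (by simpa [Mp, M] using hr') ?_)
  have := UB.relax_new (f := shortRow d.Y (d.Y r) (fun r' => d.sht sc (k + 1) (d.Y r) r' I) r')
    (y := d.Y r') le_rfl h
  simpa [shortRow, sht] using this

theorem tbl_edge {sc : ℝ} {k r e I : ℕ} {b : ℝ} (he : e < m) (hI : d.rd sc k e ≤ I)
    (h : UB (d.tbl sc k r (I - d.rd sc k e) (d.tail k e)) b) :
    UB (d.tbl sc k r I (d.head k e)) (b + d.len e) := by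
  rw [tbl_eq]
  refine UB.edgeRow_mono (c := e + 1) d.len_nonneg he ?_
  rw [edgeRow, if_pos hI]
  exact UB.relax_new (d.len_nonneg e) h

/-- A path with `h` edges in the direction of the level `k`, through the vertices `p 0, …, p h`. -/
structure Route (k h : ℕ) (p e : ℕ → ℕ) : Prop where
  lt : ∀ t < h, e t < m
  tail : ∀ t < h, d.tail k (e t) = p t
  head : ∀ t < h, d.head k (e t) = p (t + 1)

theorem Route.reverse {d : Data n m} {k h : ℕ} {p e : ℕ → ℕ} (hR : d.Route (k + 1) h p e)
    (hk : k + 1 ≤ d.L) : d.Route k h (fun t => p (h - t)) (fun t => e (h - 1 - t)) := by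
  have hht : ∀ e, d.tail k e = d.head (k + 1) e ∧ d.head k e = d.tail (k + 1) e := by
    intro e
    unfold Data.tail Data.head
    by_cases h0 : (d.L - k) % 2 = 0
    · rw [if_pos h0, if_neg (by omega), if_pos h0, if_neg (by omega)]; simp
    · rw [if_neg h0, if_pos (by omega), if_neg h0, if_pos (by omega)]; simp
  refine ⟨fun t ht => hR.lt _ (by omega), fun t ht => ?_, fun t ht => ?_⟩
  · rw [(hht _).1, hR.head _ (by omega)]
    congr 1; omega
  · rw [(hht _).2, hR.tail _ (by omega)]
    congr 1; omega

theorem tbl_route {sc : ℝ} {k h r I' i j : ℕ} {p e : ℕ → ℕ} {b : ℝ} (hR : d.Route k h p e)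
    (hij : i ≤ j) (hj : j ≤ h) (h0 : UB (d.tbl sc k r I' (p i)) b) :
    UB (d.tbl sc k r (I' + ∑ t ∈ Finset.Ico i j, d.rd sc k (e t)) (p j))
      (b + ∑ t ∈ Finset.Ico i j, d.len (e t)) := by
  induction j, hij using Nat.le_induction with
  | base => simpa using h0
  | succ j hij ih =>
    rw [Finset.sum_Ico_succ_top hij, Finset.sum_Ico_succ_top hij, ← hR.head j (by omega),
      ← add_assoc, ← add_assoc]
    refine d.tbl_edge (hR.lt j (by omega)) (by omega) ?_
    rw [Nat.add_sub_cancel, hR.tail j (by omega)]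
    exact ih (by omega)

/-- The vertex `y` is among the sources of the level `k`. -/
def Hit (k y : ℕ) : Prop := ∃ r < d.M k, d.Y r = y

/-- The sources of the levels are nested initial segments of one sequence. -/
theorem Hit.mono {d : Data n m} {k k' y : ℕ} (h : d.Hit k y) (hk : k ≤ k') : d.Hit k' y := by
  obtain ⟨r, hr, hy⟩ := h
  exact ⟨r, hr.trans_le (Nat.mul_le_mul_left _ (Nat.pow_le_pow_right (by norm_num) (by omega))), hy⟩

/-- Unless the path `p 0, …, p h` has at most `x` edges, there are sources of the level `k` within
`x` steps of both of its ends. -/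
def Near (k h : ℕ) (p : ℕ → ℕ) (x : ℕ) : Prop :=
  h ≤ x ∨ (∃ t ≤ h, t ≤ x ∧ d.Hit k (p t)) ∧ ∃ t ≤ h, h ≤ t + x ∧ d.Hit k (p t)

theorem Near.reverse {d : Data n m} {k h x : ℕ} {p : ℕ → ℕ} (hN : d.Near k h p x) :
    d.Near k h (fun t => p (h - t)) x := by
  rcases hN with hN | ⟨⟨t, ht, htx, hit⟩, ⟨t', ht', htx', hit'⟩⟩
  · exact Or.inl hN
  · refine Or.inr ⟨⟨h - t', by omega, by omega, ?_⟩, ⟨h - t, by omega, by omega, ?_⟩⟩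
    · simpa [Nat.sub_sub_self ht'] using hit'
    · simpa [Nat.sub_sub_self ht] using hit

/-- The accumulated rounding error of the levels up to `k`. -/
noncomputable def err (sc : ℝ) (h : ℕ) (X : ℕ → ℕ) : ℕ → ℝ
  | 0 => h * d.g sc 0
  | k + 1 => err sc h X k + X k * d.g sc (k + 1)

theorem err_nonneg {sc : ℝ} (hE : 0 < d.E) (hsc : 0 < sc) (h : ℕ) (X : ℕ → ℕ) (k : ℕ) :
    0 ≤ d.err sc h X k := by
  have hg := d.g_pos hE hsc
  induction k with
  | zero => exact mul_nonneg (Nat.cast_nonneg _) (hg 0).le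
  | succ k ih => exact add_nonneg ih (mul_nonneg (Nat.cast_nonneg _) (hg _).le)

theorem sum_rd_le (sc : ℝ) (k : ℕ) (e : ℕ → ℕ) {i j : ℕ} (hij : i ≤ j) :
    (∑ t ∈ Finset.Ico i j, d.rd sc k (e t) : ℕ) * d.g sc k ≤
      ∑ t ∈ Finset.Ico i j, d.delay (e t) + (j - i : ℕ) * d.g sc k := by
  induction j, hij using Nat.le_induction with
  | base => simp
  | succ j hij ih =>
    rw [Finset.sum_Ico_succ_top hij, Finset.sum_Ico_succ_top hij, Nat.succ_sub hij]
    push_cast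
    have := scan_mul_le (d.delay_nonneg (e j)) (d.g sc k) (d.N k)
    change (d.rd sc k (e j) : ℝ) * _ ≤ _ at this
    push_cast at ih
    linarith

/-- Bookkeeping of the delay budget: the rounding of the last `j - i'` edges is paid from the
allowance `x`, and the remaining budget `I'` still covers the first part together with the unspent
allowance. -/
theorem exists_add_sum_rd {sc : ℝ} (hE : 0 < d.E) (hsc : 0 < sc) {k i i' j I : ℕ} (e : ℕ → ℕ)
    (hi : i ≤ i') (hij : i' ≤ j) {x : ℝ} (hx : (j - i' : ℕ) * d.g sc k ≤ x)
    (hI : ∑ t ∈ Finset.Ico i j, d.delay (e t) + x ≤ I * d.g sc k) :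
    ∃ I', I = I' + ∑ t ∈ Finset.Ico i' j, d.rd sc k (e t) ∧
      ∑ t ∈ Finset.Ico i i', d.delay (e t) + (x - (j - i' : ℕ) * d.g sc k) ≤ I' * d.g sc k := by
  have h1 := d.sum_rd_le sc k e hij
  have h2 := Finset.sum_Ico_consecutive (fun t => d.delay (e t)) hi hij
  have h0 : 0 ≤ ∑ t ∈ Finset.Ico i i', d.delay (e t) :=
    Finset.sum_nonneg fun t _ => d.delay_nonneg _
  have h3 : ∑ t ∈ Finset.Ico i' j, d.rd sc k (e t) ≤ I := by
    have : ((∑ t ∈ Finset.Ico i' j, d.rd sc k (e t) : ℕ) : ℝ) ≤ (I : ℝ) :=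
      le_of_mul_le_mul_right (by linarith) (d.g_pos hE hsc k)
    exact_mod_cast this
  obtain ⟨I', hI'⟩ := Nat.exists_eq_add_of_le h3
  refine ⟨I', by omega, ?_⟩
  have h4 : (I : ℝ) = (∑ t ∈ Finset.Ico i' j, d.rd sc k (e t) : ℕ) + I' := by
    rw [hI']; push_cast; ring
  rw [h4, add_mul] at hI
  linarith

/-- Cut the segment at its last source `p s` of level `k`. By `hout` and nestedness this is the last
such source on the whole path, so at most `X k` edges follow, and only these are rounded on level `k
+ 1`. The segment from `i` to `s` is handed, reversed, to level `k`, where `hout` holds again. Thus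
only the two ends of the entire path need nearby sources. If there is no cut point, then `Near`
forces `h ≤ X k` and all edges are rounded on this level. -/
theorem tbl_complete {sc : ℝ} (hE : 0 < d.E) (hsc : 0 < sc) {h : ℕ} {X : ℕ → ℕ} {k : ℕ}
    (hk : k ≤ d.L) {p e : ℕ → ℕ} (hR : d.Route k h p e)
    (hX : ∀ k' < k, d.Near k' h p (X k')) {i j r I : ℕ} (hij : i ≤ j) (hj : j ≤ h)
    (hout : ∀ t ≤ h, t < i ∨ j < t → ¬ d.Hit k (p t)) (hr : r < d.M k) (hi : d.Y r = p i)
    (hI : ∑ t ∈ Finset.Ico i j, d.delay (e t) + d.err sc h X k ≤ I * d.g sc k) :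
    UB (d.tbl sc k r I (p j)) (∑ t ∈ Finset.Ico i j, d.len (e t) + 1) := by
  have hg := d.g_pos hE hsc
  induction k generalizing p e i j r I with
  | zero =>
    -- On level 0 all edges of the segment are rounded with the finest unit, which explains the term
    -- `h * g 0` of the error.
    obtain ⟨I', rfl, -⟩ := d.exists_add_sum_rd hE hsc e le_rfl hij (mul_le_mul_of_nonneg_right
      (Nat.cast_le.2 (by omega : j - i ≤ h)) (hg 0).le) hI
    have := d.tbl_route hR hij hj (hi ▸ d.tbl_self sc 0 r I')
    rwa [add_comm 1] at this
  | succ k ih =>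
    have hnear := hX k (by omega)
    have herr := d.err_nonneg hE hsc h X k
    by_cases hex : ∃ t, (i ≤ t ∧ t ≤ j) ∧ d.Hit k (p t)
    · obtain ⟨t₀, ⟨hit₀, htj₀⟩, hhit₀⟩ := hex
      classical
      obtain ⟨s, hs⟩ : ∃ s, s = Nat.findGreatest (fun t => d.Hit k (p t)) j := ⟨_, rfl⟩
      have hsj : s ≤ j := hs ▸ Nat.findGreatest_le _
      have his : i ≤ s := hit₀.trans (hs ▸ Nat.le_findGreatest htj₀ hhit₀)
      have hhit : d.Hit k (p s) := hs ▸ Nat.findGreatest_spec (P := fun t => d.Hit k (p t)) htj₀ hhit₀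
      have hgt : ∀ t ≤ h, s < t → ¬ d.Hit k (p t) := by
        intro t ht hst
        by_cases htj : t ≤ j
        · exact Nat.findGreatest_is_greatest (P := fun t => d.Hit k (p t)) (hs ▸ hst) htj
        · exact fun hh => hout t ht (Or.inr (by omega)) (hh.mono (by omega))
      -- A source within `X k` steps of the end cannot lie behind `s`.
      have hlast : j - s ≤ X k := by
        rcases hnear with hn | ⟨-, t, ht, htx, hh⟩
        · omega
        · have : ¬ s < t := fun hst => hgt t ht hst hh
          omega
      have hlast' : ((j - s : ℕ) : ℝ) * d.g sc (k + 1) ≤ X k * d.g sc (k + 1) :=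
        mul_le_mul_of_nonneg_right (Nat.cast_le.2 hlast) (hg _).le
      obtain ⟨I', rfl, hI'⟩ := d.exists_add_sum_rd hE hsc e his hsj (show _ ≤ d.err sc h X (k + 1) by rw [err]; linarith) hI
      obtain ⟨r', hr', hY'⟩ := hhit
      have hrec : UB (d.tbl sc k r' (2 * I') (p i))
          (∑ t ∈ Finset.Ico i s, d.len (e t) + 1) := by
        have hrefl : ∀ f : ℕ → ℝ, ∑ t ∈ Finset.Ico (h - s) (h - i), f (e (h - 1 - t)) =
            ∑ t ∈ Finset.Ico i s, f (e t) := by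
          intro f
          refine Finset.sum_nbij' (fun t => h - 1 - t) (fun t => h - 1 - t) ?_ ?_ ?_ ?_ ?_ <;>
            simp only [Finset.mem_Ico] <;> intros <;> first | omega | trivial
        -- Reversal sends position `t` to `h - t`, and row `2 * I'` of level `k` stands for the same
        -- delay as row `I'` of level `k + 1`.
        have := ih (by omega) (hR.reverse hk) (fun k' hk' => (hX k' (by omega)).reverse)
          (i := h - s) (j := h - i) (r := r') (I := 2 * I') (by omega) (by omega) ?_ hr' ?_ ?_
        · simpa [Nat.sub_sub_self (by omega : i ≤ h), hrefl d.len] using this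
        · intro t ht hor hh
          rcases hor with hor | hor
          · exact hgt (h - t) (by omega) (by omega) hh
          · exact hout (h - t) (by omega) (Or.inl (by omega)) (hh.mono (by omega))
        · simp [Nat.sub_sub_self (by omega : s ≤ h), hY']
        · rw [hrefl d.delay]
          push_cast
          rw [err] at hI'
          have := d.g_succ sc k
          nlinarith
      have h2 := d.tbl_route hR hsj hj (hY' ▸ d.tbl_shortcut hr' (hi ▸ hrec))
      rw [← Finset.sum_Ico_consecutive (fun t => d.len (e t)) his hsj]
      convert h2 using 1
      ring
    · have hnone : ∀ t ≤ h, ¬ d.Hit k (p t) := by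
        intro t ht hh
        by_cases hti : t < i ∨ j < t
        · exact hout t ht hti (hh.mono (by omega))
        · exact hex ⟨t, by omega, hh⟩
      have hlen : h ≤ X k := by
        rcases hnear with hn | ⟨⟨t, ht, -, hh⟩, -⟩
        · exact hn
        · exact absurd hh (hnone t ht)
      have hlast' : ((j - i : ℕ) : ℝ) * d.g sc (k + 1) ≤ X k * d.g sc (k + 1) :=
        mul_le_mul_of_nonneg_right (Nat.cast_le.2 (by omega)) (hg _).le
      obtain ⟨I', rfl, -⟩ := d.exists_add_sum_rd hE hsc e le_rfl hij (show _ ≤ d.err sc h X (k + 1) by rw [err]; linarith) hI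
      have := d.tbl_route hR hij hj (hi ▸ d.tbl_self sc (k + 1) r I')
      rwa [add_comm 1] at this

end Data
end RSP

/-! ### The program for the tables: addresses and single rows. -/

namespace RSP

variable {A : ℕ} {σ τ : Store} {ω : Tape} {n m : ℕ}

theorem Runs.setW_eq {x : ℕ} {e : WExp} {v : ℕ} (hA : 32 ≤ A) (hσ : Bounded A σ)
    (hev : e.val σ = v) (hv : v ≤ A)
    (hl : e.leaves ≤ slack ∧ e.maxLit ≤ 32 := by decide) :
    Runs A ω (.setW x e) σ (e.cost + 1) fun τ => τ = σ.setW x v :=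
  Runs.setW hA hσ (hev ▸ hv) (by rw [hev]) hl

theorem Runs.setR_eq {x : ℕ} {e : RExp} {v : ℝ} (hA : 32 ≤ A) (hσ : Bounded A σ)
    (hev : e.val σ = v) (hl : e.leaves ≤ slack ∧ e.maxLit ≤ 32 := by decide) :
    Runs A ω (.setR x e) σ (e.cost + 1) fun τ => τ = σ.setR x v :=
  Runs.setR hA hσ (by rw [hev]) hl

theorem Runs.storeW_eq {a : ℕ} {i e : WExp} {j v : ℕ} (hA : 32 ≤ A) (hσ : Bounded A σ)
    (hij : i.val σ = j) (hev : e.val σ = v) (hv : v ≤ A)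
    (hi : i.leaves ≤ slack ∧ i.maxLit ≤ 32 := by decide)
    (hl : e.leaves ≤ slack ∧ e.maxLit ≤ 32 := by decide) :
    Runs A ω (.storeW a i e) σ (i.cost + e.cost + 1) fun τ => τ = σ.putW a j v :=
  Runs.storeW hA hσ (hev ▸ hv) (by rw [hev, hij]) hi hl

theorem Runs.storeR_eq {a : ℕ} {i : WExp} {e : RExp} {j : ℕ} {v : ℝ} (hA : 32 ≤ A)
    (hσ : Bounded A σ) (hij : i.val σ = j) (hev : e.val σ = v)
    (hi : i.leaves ≤ slack ∧ i.maxLit ≤ 32 := by decide)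
    (hl : e.leaves ≤ slack ∧ e.maxLit ≤ 32 := by decide) :
    Runs A ω (.storeR a i e) σ (i.cost + e.cost + 1) fun τ => τ = σ.putR a j v :=
  Runs.storeR hA hσ (by rw [hev, hij]) hi hl

/-! ### The program for the tables -/

namespace Prog

/-- The position of a table entry. The word registers `0`, `4`, `8`, `9`, `11` hold the number of
vertices, the last level, the number of sources of the last level, the length of a table row, and
the delay scale. -/
def ix (k r v I : WExp) : WExp :=
  .add (.mul (.add (.mul (.add (.mul (.add (.mul (.var 11) (.add (.var 4) (.lit 1))) k)
    (.var 8)) r) (.var 0)) v) (.var 9)) I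

/-- The relaxation of the entry of the vertex in the word register `27` in the current row. -/
def relaxCell : Cmd :=
  .ite (.and (.rle (.ofWord (.lit 1)) (.var 5))
      (.not (.and (.rle (.ofWord (.lit 1)) (.arr 2 (ix (.var 12) (.var 22) (.var 27) (.var 24))))
        (.rle (.arr 2 (ix (.var 12) (.var 22) (.var 27) (.var 24))) (.add (.var 5) (.var 6))))))
    (.storeR 2 (ix (.var 12) (.var 22) (.var 27) (.var 24)) (.add (.var 5) (.var 6)))
    Cmd.skip

def clearRow : Cmd :=
  .for 25 0 (.storeR 2 (ix (.var 12) (.var 22) (.var 25) (.var 24)) (.ofWord (.lit 0)))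

/-- The register `17` holds `Mp`, which is `0` on level 0; so the truncated `k - 1` is harmless
there, as the loop does not run. -/
def relaxShortcuts : Cmd :=
  .for 26 17 (.seq (.setW 27 (.arr 5 (.var 26)))
    (.seq (.setR 5 (.arr 2 (ix (.sub (.var 12) (.lit 1)) (.var 26) (.var 23)
      (.mul (.lit 2) (.var 24)))))
    (.seq (.setR 6 (.ofWord (.lit 0))) relaxCell)))

/-- The word arrays `2`, `3`, `4` hold the tails, heads and rounded delays of the current level, so
the direction plays no role here. -/
def relaxEdges : Cmd :=
  .for 19 1 (.ite (.wle (.arr 4 (.var 19)) (.var 24))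
    (.seq (.setW 27 (.arr 3 (.var 19)))
    (.seq (.setR 5 (.arr 2 (ix (.var 12) (.var 22) (.arr 2 (.var 19))
      (.sub (.var 24) (.arr 4 (.var 19))))))
    (.seq (.setR 6 (.arr 0 (.var 19))) relaxCell))) Cmd.skip)

/-- The computation of one table row. -/
def row : Cmd :=
  .seq clearRow
  (.seq (.storeR 2 (ix (.var 12) (.var 22) (.var 23) (.var 24)) (.ofWord (.lit 1)))
  (.seq relaxShortcuts relaxEdges))

/-- The computation of the table of one source. -/
def source : Cmd := .seq (.setW 23 (.arr 5 (.var 22))) (.for 24 31 row)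

/-- The rounding of the delay of one edge. -/
def roundEdge : Cmd :=
  .seq (.ite (.wle (.mod (.sub (.var 4) (.var 12)) (.lit 2)) (.lit 0))
    (.seq (.storeW 2 (.var 19) (.arr 0 (.var 19))) (.storeW 3 (.var 19) (.arr 1 (.var 19))))
    (.seq (.storeW 2 (.var 19) (.arr 1 (.var 19))) (.storeW 3 (.var 19) (.arr 0 (.var 19)))))
  (.seq (.setW 21 (.lit 1))
  (.seq (.setR 5 (.arr 1 (.var 19)))
  (.seq (.for 20 16 (.ite (.rle (.var 5) (.mul (.ofWord (.var 21)) (.var 4))) Cmd.skip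
    (.setW 21 (.add (.var 21) (.lit 1)))))
  (.storeW 4 (.var 19) (.var 21)))))

/-- The computation of the tables of one level. -/
def level : Cmd :=
  .seq (.setW 16 (.mul (.var 10) (.var 14)))
  (.seq (.setW 31 (.add (.var 16) (.lit 1)))
  (.seq (.for 19 1 roundEdge)
  (.seq (.for 22 15 source)
  (.seq (.setW 17 (.var 15))
  (.seq (.setW 15 (.mul (.lit 2) (.var 15)))
  (.seq (.setW 14 (.div (.var 14) (.lit 2)))
  (.setR 4 (.add (.var 4) (.var 4)))))))))

/-- The computation of the tables of one delay scale. -/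
def scale : Cmd :=
  .seq (.storeR 3 (.var 11) (.var 3))
  (.seq (.setW 14 (.var 5))
  (.seq (.setW 15 (.mul (.lit 2) (.var 6)))
  (.seq (.setW 17 (.lit 0))
  (.seq (.setR 4 (.div (.var 3) (.mul (.mul (.ofWord (.lit 8)) (.ofWord (.var 2)))
    (.ofWord (.var 5)))))
  (.seq (.for 12 30 level)
  (.setR 3 (.add (.var 3) (.var 3))))))))

/-- The computation of all tables. -/
def tables : Cmd := .seq (.setR 3 (.var 1)) (.for 11 7 scale)

end Prog

open Prog

/-! ### Positions of table entries -/

namespace Data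

variable (d : Data n m)

/-- The position of a table entry. -/
def pos (j k r v I : ℕ) : ℕ :=
  (((j * (d.L + 1) + k) * (d.lam * 2 ^ (d.L + 1)) + r) * n + v) * (32 * d.E * 2 ^ d.L + 1) + I

theorem _root_.RSP.mul_add_inj {a b a' b' c : ℕ} (hb : b < c) (hb' : b' < c)
    (h : a * c + b = a' * c + b') : a = a' ∧ b = b' := by
  have h1 := congrArg (· / c) h
  have h2 := congrArg (· % c) h
  have hc : 0 < c := by omega
  simp only [Nat.mul_add_mod', Nat.mod_eq_of_lt hb, Nat.mod_eq_of_lt hb'] at h2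
  subst h2
  exact ⟨Nat.eq_of_mul_eq_mul_right hc (by omega), rfl⟩

/-- The ranges of the indices of table entries. -/
structure InRange (k r v I : ℕ) : Prop where
  k_le : k ≤ d.L
  r_lt : r < d.M k
  v_lt : v < n
  I_le : I ≤ d.N k

theorem M_le {k : ℕ} (hk : k ≤ d.L) : d.M k ≤ d.lam * 2 ^ (d.L + 1) :=
  Nat.mul_le_mul_left _ (Nat.pow_le_pow_right (by norm_num) (by omega))

theorem N_le (k : ℕ) : d.N k ≤ 32 * d.E * 2 ^ d.L :=
  Nat.mul_le_mul_left _ (Nat.pow_le_pow_right (by norm_num) (by omega))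

/-- An address is a mixed-radix number, whose digits are recovered from the last one on. The leading
digit `j` needs no bound. -/
theorem pos_inj {j k r v I j' k' r' v' I' : ℕ} (h : d.InRange k r v I) (h' : d.InRange k' r' v' I')
    (he : d.pos j k r v I = d.pos j' k' r' v' I') :
    j = j' ∧ k = k' ∧ r = r' ∧ v = v' ∧ I = I' := by
  have h1 := d.N_le k
  have h2 := d.N_le k'
  have h3 := d.M_le h.k_le
  have h4 := d.M_le h'.k_le
  obtain ⟨he, hI⟩ := mul_add_inj (by have := h.I_le; omega) (by have := h'.I_le; omega) he
  obtain ⟨he, hv⟩ := mul_add_inj h.v_lt h'.v_lt he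
  obtain ⟨he, hr⟩ := mul_add_inj (h.r_lt.trans_le h3) (h'.r_lt.trans_le h4) he
  obtain ⟨he, hk⟩ := mul_add_inj (Nat.lt_succ_of_le h.k_le) (Nat.lt_succ_of_le h'.k_le) he
  exact ⟨he, hk, hr, hv, hI⟩

/-! ### The contents of the memory -/

/-- The memory holds the input and the parameters. -/
structure Env (σ : Store) : Prop where
  wn : σ.wvar 0 = n
  wm : σ.wvar 1 = m
  wE : σ.wvar 2 = d.E
  wL : σ.wvar 4 = d.L
  wP : σ.wvar 5 = 2 ^ d.L
  wlam : σ.wvar 6 = d.lam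
  wW : σ.wvar 8 = d.lam * 2 ^ (d.L + 1)
  wN1 : σ.wvar 9 = 32 * d.E * 2 ^ d.L + 1
  wN0 : σ.wvar 10 = 32 * d.E
  wL1 : σ.wvar 30 = d.L + 1
  asrc : σ.warr 0 = d.src
  atgt : σ.warr 1 = d.tgt
  aY : ∀ r < d.lam * 2 ^ (d.L + 1), σ.warr 5 r = d.Y r
  alen : σ.rarr 0 = d.len
  adelay : σ.rarr 1 = d.delay

theorem Env.frame {d : Data n m} {c : Cmd} (h : d.Env σ) (hF : Frame c σ τ)
    (hw : (∀ x ∈ [0, 1, 2, 4, 5, 6, 8, 9, 10, 30], x ∉ c.wmod) ∧ (∀ x ∈ [0, 1, 5], x ∉ c.wamod) ∧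
      ∀ x ∈ [0, 1], x ∉ c.ramod := by decide) : d.Env τ := by
  obtain ⟨h1, h2, h3⟩ := hw
  simp only [List.forall_mem_cons, List.not_mem_nil, false_imp_iff, implies_true, and_true]
    at h1 h2 h3
  exact ⟨(hF.w _ (by tauto)).trans h.wn, (hF.w _ (by tauto)).trans h.wm,
    (hF.w _ (by tauto)).trans h.wE, (hF.w _ (by tauto)).trans h.wL,
    (hF.w _ (by tauto)).trans h.wP, (hF.w _ (by tauto)).trans h.wlam,
    (hF.w _ (by tauto)).trans h.wW, (hF.w _ (by tauto)).trans h.wN1,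
    (hF.w _ (by tauto)).trans h.wN0, (hF.w _ (by tauto)).trans h.wL1,
    (hF.wa _ (by tauto)).trans h.asrc, (hF.wa _ (by tauto)).trans h.atgt,
    fun r hr => by rw [hF.wa _ (by tauto)]; exact h.aY r hr,
    (hF.ra _ (by tauto)).trans h.alen, (hF.ra _ (by tauto)).trans h.adelay⟩

/-- The memory holds the data for the tables of the level `k` of the delay scale `j`. -/
structure LevelEnv (sc : ℝ) (j k : ℕ) (σ : Store) : Prop extends d.Env σ where
  wj : σ.wvar 11 = j
  wk : σ.wvar 12 = k
  wM : σ.wvar 15 = d.M k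
  wN : σ.wvar 31 = d.N k + 1
  wMp : σ.wvar 17 = d.Mp k
  atail : ∀ e < m, σ.warr 2 e = d.tail k e
  ahead : ∀ e < m, σ.warr 3 e = d.head k e
  ard : ∀ e < m, σ.warr 4 e = d.rd sc k e

theorem LevelEnv.frame {d : Data n m} {sc : ℝ} {j k : ℕ} {c : Cmd} (h : d.LevelEnv sc j k σ)
    (hF : Frame c σ τ)
    (hw : ((∀ x ∈ [0, 1, 2, 4, 5, 6, 8, 9, 10, 30], x ∉ c.wmod) ∧ (∀ x ∈ [0, 1, 5], x ∉ c.wamod) ∧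
      ∀ x ∈ [0, 1], x ∉ c.ramod) ∧ (∀ x ∈ [11, 12, 15, 31, 17], x ∉ c.wmod) ∧
      (∀ x ∈ [2, 3, 4], x ∉ c.wamod) := by decide) : d.LevelEnv sc j k τ := by
  obtain ⟨h0, h1, h2⟩ := hw
  simp only [List.forall_mem_cons, List.not_mem_nil, false_imp_iff, implies_true, and_true]
    at h1 h2
  exact ⟨h.toEnv.frame hF h0, (hF.w _ (by tauto)).trans h.wj, (hF.w _ (by tauto)).trans h.wk,
    (hF.w _ (by tauto)).trans h.wM, (hF.w _ (by tauto)).trans h.wN,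
    (hF.w _ (by tauto)).trans h.wMp, fun e he => by rw [hF.wa _ (by tauto)]; exact h.atail e he,
    fun e he => by rw [hF.wa _ (by tauto)]; exact h.ahead e he,
    fun e he => by rw [hF.wa _ (by tauto)]; exact h.ard e he⟩

/-- The memory holds the data for the row `I` of the source number `r`. -/
structure RowEnv (sc : ℝ) (j k r I : ℕ) (σ : Store) : Prop extends d.LevelEnv sc j k σ where
  wr : σ.wvar 22 = r
  wx : σ.wvar 23 = d.Y r
  wI : σ.wvar 24 = I

theorem RowEnv.frame {d : Data n m} {sc : ℝ} {j k r I : ℕ} {c : Cmd}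
    (h : d.RowEnv sc j k r I σ) (hF : Frame c σ τ)
    (hw : (((∀ x ∈ [0, 1, 2, 4, 5, 6, 8, 9, 10, 30], x ∉ c.wmod) ∧ (∀ x ∈ [0, 1, 5], x ∉ c.wamod) ∧
      ∀ x ∈ [0, 1], x ∉ c.ramod) ∧ (∀ x ∈ [11, 12, 15, 31, 17], x ∉ c.wmod) ∧
      (∀ x ∈ [2, 3, 4], x ∉ c.wamod)) ∧ ∀ x ∈ [22, 23, 24], x ∉ c.wmod := by decide) :
    d.RowEnv sc j k r I τ := by
  obtain ⟨h0, h1⟩ := hw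
  simp only [List.forall_mem_cons, List.not_mem_nil, false_imp_iff, implies_true, and_true] at h1
  exact ⟨h.toLevelEnv.frame hF h0, (hF.w _ (by tauto)).trans h.wr,
    (hF.w _ (by tauto)).trans h.wx, (hF.w _ (by tauto)).trans h.wI⟩

theorem Env.ix_val {d : Data n m} (h : d.Env σ) (k r v I : WExp) :
    (ix k r v I).val σ =
      d.pos (σ.wvar 11) (k.val σ) (r.val σ) (v.val σ) (I.val σ) := by
  simp only [ix, WExp.val, h.wL, h.wW, h.wn, h.wN1, pos]

/-- In `τ` the current row is `f`, and all other table entries are as in `σ`. -/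
def IsRow (σ : Store) (j k r I : ℕ) (f : ℕ → ℝ) (τ : Store) : Prop :=
  (∀ v < n, τ.rarr 2 (d.pos j k r v I) = f v) ∧
  ∀ q, (∀ v < n, q ≠ d.pos j k r v I) → τ.rarr 2 q = σ.rarr 2 q

variable {d} {sc : ℝ} {j k r I : ℕ}

theorem IsRow.put {f : ℕ → ℝ} {σ₀ : Store} (h : d.IsRow σ₀ j k r I f σ) {y : ℕ} (hy : y < n)
    (hk : k ≤ d.L) (hr : r < d.M k) (hI : I ≤ d.N k) (c : ℝ) :
    d.IsRow σ₀ j k r I (Function.update f y c) (σ.putR 2 (d.pos j k r y I) c) := by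
  refine ⟨fun v hv => ?_, fun q hq => ?_⟩
  · rw [Store.putR_rarr, Function.update_apply]
    by_cases hvy : v = y
    · simp [hvy]
    · rw [if_neg, if_neg hvy, h.1 v hv]
      exact fun hc => hvy (d.pos_inj ⟨hk, hr, hv, hI⟩ ⟨hk, hr, hy, hI⟩ hc.2).2.2.2.1
  · rw [Store.putR_rarr, if_neg (fun hc => hq y hy hc.2), h.2 q hq]

theorem runs_relaxCell {f : ℕ → ℝ} {σ₀ : Store} (hA : 32 ≤ A) (hB : Bounded A σ)
    (hE : d.RowEnv sc j k r I σ) (hk : k ≤ d.L) (hr : r < d.M k) (hI : I ≤ d.N k)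
    (h : d.IsRow σ₀ j k r I f σ) {y : ℕ} (hy : y < n) (h27 : σ.wvar 27 = y) :
    Runs A ω relaxCell σ 120
      (d.IsRow σ₀ j k r I (relax f y (σ.rvar 5) (σ.rvar 6))) := by
  have hpos : (ix (.var 12) (.var 22) (.var 27) (.var 24)).val σ = d.pos j k r y I := by
    rw [hE.ix_val]; simp only [WExp.val, hE.wj, hE.wk, hE.wr, hE.wI, h27]
  have hiff : (Test.and (.rle (.ofWord (.lit 1)) (.var 5))
      (.not (.and (.rle (.ofWord (.lit 1)) (.arr 2 (ix (.var 12) (.var 22) (.var 27) (.var 24))))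
        (.rle (.arr 2 (ix (.var 12) (.var 22) (.var 27) (.var 24))) (.add (.var 5) (.var 6)))))).holds
        σ ↔ 1 ≤ σ.rvar 5 ∧ ¬ (1 ≤ f y ∧ f y ≤ σ.rvar 5 + σ.rvar 6) := by
    simp only [Test.holds, RExp.val, hpos, h.1 y hy, WExp.val, Nat.cast_one]
  refine Runs.time (Runs.ite (T := 30) hA hB ?_ ?_) ?_
  · intro ht
    rw [hiff] at ht
    refine ((Runs.storeR_eq hA hB hpos (by rfl : _ = σ.rvar 5 + σ.rvar 6)).time
      (by decide)).post ?_
    rintro _ - - rfl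
    rw [relax, if_pos ht]
    exact h.put hy hk hr hI _
  · intro ht
    rw [hiff] at ht
    refine (Runs.skip hB ?_).time (by norm_num)
    rw [relax, if_neg ht]
    exact h
  · decide

/-- The cost is one step each, up to a constant, for every vertex cleared and every shortcut and
edge relaxed. -/
theorem runs_row (hA : 32 ≤ A) (hB : Bounded A σ) (hY : ∀ r, d.Y r < n)
    (hE : d.RowEnv sc j k r I σ) (hk : k ≤ d.L) (hr : r < d.M k) (hI : I ≤ d.N k)
    (hprev : ∀ I' < I, ∀ v < n, σ.rarr 2 (d.pos j k r v I') = d.tbl sc k r I' v)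
    (hsh : k ≠ 0 → ∀ r' < d.M (k - 1),
      σ.rarr 2 (d.pos j (k - 1) r' (d.Y r) (2 * I)) = d.tbl sc (k - 1) r' (2 * I) (d.Y r)) :
    Runs A ω row σ (400 * (n + m + d.Mp k + 1)) (d.IsRow σ j k r I (d.tbl sc k r I)) := by
  have hclear : Runs A ω clearRow σ (n * (30 + 9) + 7) (d.IsRow σ j k r I fun _ => 0) := by
    refine (Runs.for n (fun i τ => (∀ v < i, τ.rarr 2 (d.pos j k r v I) = 0) ∧
      ∀ q, (∀ v < n, q ≠ d.pos j k r v I) → τ.rarr 2 q = σ.rarr 2 q) hA hB hE.wn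
      (by simp) ?_).post fun τ _ _ h => h.2
    rintro i τ hi hBτ hF hx ⟨h1, h2⟩
    have hEτ := hE.frame hF
    have hpos : (ix (.var 12) (.var 22) (.var 25) (.var 24)).val τ = d.pos j k r i I := by
      rw [hEτ.ix_val]; simp only [WExp.val, hEτ.wj, hEτ.wk, hEτ.wr, hEτ.wI, hx]
    refine ((Runs.storeR_eq hA hBτ hpos (v := 0) (by simp [RExp.val, WExp.val])).time
      (by decide)).post ?_
    rintro _ - - rfl
    refine ⟨fun v hv => ?_, fun q hq => ?_⟩
    · simp only [Store.setW_rarr, Store.putR_rarr, true_and]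
      split_ifs with hc
      · rfl
      · refine h1 v ?_
        have : v ≠ i := fun hvi => hc (by rw [hvi])
        omega
    · simp only [Store.setW_rarr, Store.putR_rarr]
      rw [if_neg fun hc => hq i hi hc.2, h2 q hq]
  -- Writing the current row does not disturb the entries read by the relaxations, since addresses
  -- are injective.
  have hother : ∀ {τ : Store} {f : ℕ → ℝ}, d.IsRow σ j k r I f τ → ∀ {k' r' v' I' : ℕ},
      d.InRange k' r' v' I' → (k', r', I') ≠ (k, r, I) →
      τ.rarr 2 (d.pos j k' r' v' I') = σ.rarr 2 (d.pos j k' r' v' I') := by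
    intro τ f hτ k' r' v' I' hin hne
    refine hτ.2 _ fun v hv hc => hne ?_
    obtain ⟨-, rfl, rfl, -, rfl⟩ := d.pos_inj hin ⟨hk, hr, hv, hI⟩ hc
    rfl
  refine Runs.time (hclear.seq fun τ₁ hB₁ hF₁ h₁ => (Runs.seq (T := 40)
    (R := d.IsRow σ j k r I (initRow (d.Y r))) ?_
    fun τ₂ hB₂ hF₂ h₂ => Runs.seq (T := d.Mp k * (200 + 9) + 7) (T' := m * (200 + 9) + 7)
      (R := d.IsRow σ j k r I
        (shortRow d.Y (d.Y r) (fun r' => d.sht sc k (d.Y r) r' I) (d.Mp k))) ?_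
        fun τ₃ hB₃ hF₃ h₃ => ?_)) ?_
  · have hE₁ := hE.frame hF₁
    have hpos : (ix (.var 12) (.var 22) (.var 23) (.var 24)).val τ₁ = d.pos j k r (d.Y r) I := by
      rw [hE₁.ix_val]; simp only [WExp.val, hE₁.wj, hE₁.wk, hE₁.wr, hE₁.wI, hE₁.wx]
    refine ((Runs.storeR_eq hA hB₁ hpos (v := 1) (by simp [RExp.val, WExp.val])).time
      (by decide)).post ?_
    rintro _ - - rfl
    have := h₁.put (hY r) hk hr hI 1
    convert this using 1
    funext v
    simp [initRow, Function.update_apply]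
  · have hE₂ := (hE.frame hF₁).frame hF₂
    refine (Runs.for (d.Mp k) (fun c τ => d.IsRow σ j k r I
      (shortRow d.Y (d.Y r) (fun r' => d.sht sc k (d.Y r) r' I) c) τ) hA hB₂ hE₂.wMp
      h₂ ?_).post fun τ _ _ h => h.2
    intro c τ hc hBτ hF hx hrow
    have hEτ := hE₂.frame hF
    obtain ⟨k, rfl⟩ : ∃ k', k = k' + 1 := by
      cases k with
      | zero => simp [Mp] at hc
      | succ k => exact ⟨k, rfl⟩
    have hcM : c < d.M k := by simpa [Mp, M] using hc
    have hcY := hEτ.aY c (hcM.trans_le (d.M_le (by omega)))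
    have hin : d.InRange k c (d.Y r) (2 * I) :=
      ⟨by omega, hcM, hY r, by rw [d.N_eq hk]; omega⟩
    refine Runs.time ((Runs.setW_eq hA hBτ (v := d.Y c) (by simp [WExp.val, hx, hcY])
      (hcY ▸ hBτ.2 5 c)).seq (T' := 180) ?_) (by decide)
    rintro τ₄ hB₄ hF₄ heq₄
    have hE₄ := hEτ.frame hF₄
    have hpos : (ix (.sub (.var 12) (.lit 1)) (.var 26) (.var 23)
      (.mul (.lit 2) (.var 24))).val τ₄ = d.pos j k c (d.Y r) (2 * I) := by
      rw [hE₄.ix_val]; simp [WExp.val, hEτ.wj, hEτ.wk, hEτ.wI, hEτ.wx, heq₄, hx]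
    have hval : τ₄.rarr 2 (d.pos j k c (d.Y r) (2 * I)) = d.tbl sc k c (2 * I) (d.Y r) := by
      rw [heq₄, Store.setW_rarr, hother hrow hin (by simp)]
      exact hsh (by omega) c hcM
    refine Runs.time ((Runs.setR_eq hA hB₄ (v := d.tbl sc k c (2 * I) (d.Y r))
      (by simp [RExp.val, hpos, hval])).seq (T' := 140) ?_) (by decide)
    rintro τ₅ hB₅ hF₅ heq₅
    have hE₅ := hE₄.frame hF₅
    refine Runs.time ((Runs.setR_eq hA hB₅ (v := 0)
      (by simp [RExp.val, WExp.val])).seq (T' := 120) ?_) (by decide)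
    rintro τ₆ hB₆ hF₆ heq₆
    have hE₆ := hE₅.frame hF₆
    have hrow₆ : d.IsRow σ j (k + 1) r I
      (shortRow d.Y (d.Y r) (fun r' => d.sht sc (k + 1) (d.Y r) r' I) c) τ₆ := by
      rw [heq₆, heq₅, heq₄]; exact hrow
    refine (runs_relaxCell hA hB₆ hE₆ hk hr hI hrow₆ (hY c) (by simp [heq₆, heq₅, heq₄])).post ?_
    intro τ₇ _ _ h₇
    have h5 : τ₆.rvar 5 = d.tbl sc k c (2 * I) (d.Y r) := by simp [heq₆, heq₅]
    have h6 : τ₆.rvar 6 = 0 := by simp [heq₆]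
    rw [h5, h6] at h₇
    exact h₇
  · have hE₃ := ((hE.frame hF₁).frame hF₂).frame hF₃
    refine (Runs.for m (fun c τ => d.IsRow σ j k r I
      (edgeRow (d.tail k) (d.head k) (d.rd sc k) d.len (d.tbl sc k r) I
        (shortRow d.Y (d.Y r) (fun r' => d.sht sc k (d.Y r) r' I) (d.Mp k)) c) τ) hA hB₃ hE₃.wm
      h₃ ?_).post fun τ _ _ h => by rw [tbl_eq]; exact h.2
    intro c τ hc hBτ hF hx hrow
    have hEτ := hE₃.frame hF
    have hrd := hEτ.ard c hc
    have htl := hEτ.atail c hc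
    have hhd := hEτ.ahead c hc
    have htn : d.tail k c < n := by
      simp only [tail, src, tgt, pad, hc, dif_pos]
      split_ifs <;> exact Fin.is_lt _
    have hhn : d.head k c < n := by
      simp only [head, src, tgt, pad, hc, dif_pos]
      split_ifs <;> exact Fin.is_lt _
    refine Runs.time (Runs.ite (T := 190) hA hBτ (fun ht => ?_) (fun ht => ?_)) (by decide)
    · replace ht : d.rd sc k c ≤ I := by simpa [Test.holds, WExp.val, hx, hrd, hEτ.wI] using ht
      have hpos1 := d.rd_pos sc k c
      refine Runs.time ((Runs.setW_eq hA hBτ (v := d.head k c) (by simp [WExp.val, hx, hhd])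
        (hhd ▸ hBτ.2 3 c)).seq (T' := 180) ?_) (by decide)
      rintro τ₄ hB₄ hF₄ heq₄
      have hE₄ := hEτ.frame hF₄
      have hpos : (ix (.var 12) (.var 22) (.arr 2 (.var 19))
          (.sub (.var 24) (.arr 4 (.var 19)))).val τ₄ =
          d.pos j k r (d.tail k c) (I - d.rd sc k c) := by
        rw [hE₄.ix_val]
        simp [WExp.val, hEτ.wj, hEτ.wk, hEτ.wI, hEτ.wr, heq₄, hx, htl, hrd]
      have hval : τ₄.rarr 2 (d.pos j k r (d.tail k c) (I - d.rd sc k c)) =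
          d.tbl sc k r (I - d.rd sc k c) (d.tail k c) := by
        rw [heq₄, Store.setW_rarr, hother hrow ⟨hk, hr, htn, by omega⟩ (by simp; omega),
          hprev _ (by omega) _ htn]
      refine Runs.time ((Runs.setR_eq hA hB₄ (v := d.tbl sc k r (I - d.rd sc k c) (d.tail k c))
        (by simp [RExp.val, hpos, hval])).seq (T' := 140) ?_) (by decide)
      rintro τ₅ hB₅ hF₅ heq₅
      have hE₅ := hE₄.frame hF₅
      refine Runs.time ((Runs.setR_eq hA hB₅ (v := d.len c)
        (by simp [RExp.val, WExp.val, hEτ.alen, heq₅, heq₄, hx])).seq (T' := 120) ?_) (by decide)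
      rintro τ₆ hB₆ hF₆ heq₆
      have hE₆ := hE₅.frame hF₆
      have hrow₆ : d.IsRow σ j k r I
        (edgeRow (d.tail k) (d.head k) (d.rd sc k) d.len (d.tbl sc k r) I
        (shortRow d.Y (d.Y r) (fun r' => d.sht sc k (d.Y r) r' I) (d.Mp k)) c) τ₆ := by
        rw [heq₆, heq₅, heq₄]; exact hrow
      refine (runs_relaxCell hA hB₆ hE₆ hk hr hI hrow₆ hhn (by simp [heq₆, heq₅, heq₄])).post ?_
      intro τ₇ _ _ h₇
      have h5 : τ₆.rvar 5 = d.tbl sc k r (I - d.rd sc k c) (d.tail k c) := by simp [heq₆, heq₅]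
      have h6 : τ₆.rvar 6 = d.len c := by simp [heq₆]
      rw [h5, h6] at h₇
      rw [edgeRow, if_pos ht]
      exact h₇
    · replace ht : ¬ d.rd sc k c ≤ I := by simpa [Test.holds, WExp.val, hx, hrd, hEτ.wI] using ht
      refine (Runs.skip hBτ ?_).time (by norm_num)
      rw [edgeRow, if_neg ht]
      exact hrow
  · omega

end Data
end RSP

/-! ### The loops over sources, levels and delay scales. -/

namespace RSP

variable {A : ℕ} {σ τ : Store} {ω : Tape} {n m : ℕ}

open Prog

namespace Data

variable (d : Data n m)

/-- All table entries before the row `I` of the source `r` of the level `k` of the scale `j` have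
been computed. -/
def Done (sc : ℝ) (j k r I : ℕ) (σ : Store) : Prop :=
  ∀ j' k' r' v' I', d.InRange k' r' v' I' →
    (j' < j ∨ j' = j ∧ (k' < k ∨ k' = k ∧ (r' < r ∨ r' = r ∧ I' < I))) →
    σ.rarr 2 (d.pos j' k' r' v' I') = d.tbl (sc * 2 ^ j') k' r' I' v'

variable {d} {sc : ℝ} {j k r I : ℕ}

/-- Indices out of range impose no condition. Hence the position behind the last row may be replaced
by the first row of the next source, and likewise for levels and scales. -/
theorem Done.next {j' k' r' I' : ℕ} (h : d.Done sc j k r I σ)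
    (hlt : ∀ j₁ k₁ r₁ v₁ I₁, d.InRange k₁ r₁ v₁ I₁ →
      (j₁ < j' ∨ j₁ = j' ∧ (k₁ < k' ∨ k₁ = k' ∧ (r₁ < r' ∨ r₁ = r' ∧ I₁ < I'))) →
      (j₁ < j ∨ j₁ = j ∧ (k₁ < k ∨ k₁ = k ∧ (r₁ < r ∨ r₁ = r ∧ I₁ < I)))) :
    d.Done sc j' k' r' I' σ :=
  fun j₁ k₁ r₁ v₁ I₁ hin hl => h j₁ k₁ r₁ v₁ I₁ hin (hlt _ _ _ _ _ hin hl)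

theorem Done.congr (h : d.Done sc j k r I σ) (hστ : τ.rarr 2 = σ.rarr 2) :
    d.Done sc j k r I τ := by
  intro j' k' r' v' I' hin hlt
  rw [hστ]
  exact h j' k' r' v' I' hin hlt

theorem Done.row (h : d.Done sc j k r I σ) (hk : k ≤ d.L) (hr : r < d.M k) (hI : I ≤ d.N k)
    (hrow : d.IsRow σ j k r I (d.tbl (sc * 2 ^ j) k r I) τ) : d.Done sc j k r (I + 1) τ := by
  intro j' k' r' v' I' hin hlt
  by_cases heq : j' = j ∧ k' = k ∧ r' = r ∧ I' = I
  · obtain ⟨rfl, rfl, rfl, rfl⟩ := heq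
    exact hrow.1 v' hin.v_lt
  · rw [hrow.2, h j' k' r' v' I' hin (by omega)]
    intro v hv hc
    obtain ⟨h1, h2, h3, -, h5⟩ := d.pos_inj hin ⟨hk, hr, hv, hI⟩ hc
    exact heq ⟨h1, h2, h3, h5⟩

theorem runs_source (hA : 32 ≤ A) (hB : Bounded A σ) (hY : ∀ r, d.Y r < n)
    (hE : d.LevelEnv (sc * 2 ^ j) j k σ) (hk : k ≤ d.L) (hr : r < d.M k) (h22 : σ.wvar 22 = r)
    (hD : d.Done sc j k r 0 σ) :
    Runs A ω source σ ((d.N k + 1) * (400 * (n + m + d.Mp k + 1) + 9) + 10)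
      (d.Done sc j k (r + 1) 0) := by
  have hrW := hr.trans_le (d.M_le hk)
  refine Runs.time ((Runs.setW_eq hA hB (v := d.Y r) (by simp [WExp.val, h22, hE.aY r hrW])
    (hE.aY r hrW ▸ hB.2 5 r)).seq
    (T' := (d.N k + 1) * (400 * (n + m + d.Mp k + 1) + 9) + 7) ?_) ?_
  · rintro τ₁ hB₁ hF₁ heq₁
    have hE₁ := hE.frame hF₁
    refine (Runs.for (d.N k + 1) (fun i τ => d.Done sc j k r i τ) hA hB₁ hE₁.wN
      (by rw [heq₁]; exact hD) ?_).post ?_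
    · intro i τ hi hBτ hF hx hDi
      have hEτ : d.RowEnv (sc * 2 ^ j) j k r i τ :=
        ⟨hE₁.frame hF, by rw [hF.w 22 (by decide), heq₁]; simpa using h22,
          by rw [hF.w 23 (by decide), heq₁]; simp, hx⟩
      refine (runs_row hA hBτ hY hEτ hk hr (by omega) ?_ ?_).post ?_
      · intro I' hI' v hv
        exact hDi _ _ _ _ _ ⟨hk, hr, hv, by omega⟩ (by omega)
      -- The shortcuts read row `2 * i` of the preceding level, which is in range by `N_eq` and
      -- already complete.
      · intro h0 r' hr'
        have := d.N_eq (k := k - 1) (by omega)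
        rw [Nat.sub_add_cancel (by omega)] at this
        exact hDi _ _ _ _ _ ⟨by omega, hr', hY r, by omega⟩ (by omega)
      · intro τ₂ _ _ hrow
        exact hDi.row hk hr (by omega) hrow
    · rintro τ - - ⟨-, h⟩
      refine h.next fun j₁ k₁ r₁ v₁ I₁ hin hlt => ?_
      have := hin.I_le
      rcases hlt with h1 | ⟨rfl, h1 | ⟨rfl, h1⟩⟩
      · omega
      · omega
      · omega
  · simp only [WExp.cost]
    omega

/-- The memory before the computation of a level. -/
structure LevelStart (d : Data n m) (sc : ℝ) (j k : ℕ) (σ : Store) : Prop where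
  -- After the last level this register holds `1 / 2 = 0`, hence the restriction.
  w14 : k ≤ d.L → σ.wvar 14 = 2 ^ (d.L - k)
  w15 : σ.wvar 15 = d.M k
  w17 : σ.wvar 17 = d.Mp k
  r4 : σ.rvar 4 = d.g (sc * 2 ^ j) k
  done : d.Done sc j k 0 0 σ

/-- Reals become words only through logarithms, so the rounding is done by counting. Its `O(N k)`
steps per edge stay below the cost of the tables. -/
theorem runs_roundEdge (hA : 32 ≤ A) (hB : Bounded A σ) (hE : d.Env σ)
    (h12 : σ.wvar 12 = k) (h16 : σ.wvar 16 = d.N k) (hg : σ.rvar 4 = d.g sc k) {e : ℕ}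
    (h19 : σ.wvar 19 = e) :
    Runs A ω roundEdge σ (d.N k * 29 + 107) fun τ =>
      τ.warr 2 e = d.tail k e ∧ τ.warr 3 e = d.head k e ∧ τ.warr 4 e = d.rd sc k e ∧
      ∀ e' ≠ e, τ.warr 2 e' = σ.warr 2 e' ∧ τ.warr 3 e' = σ.warr 3 e' ∧
        τ.warr 4 e' = σ.warr 4 e' := by
  have hN1 : d.N k + 1 ≤ A := by
    have := hE.wN1 ▸ hB.1 9
    have := d.N_le k
    omega
  have hcopy : ∀ {a b u v : ℕ}, a = σ.warr u e → b = σ.warr v e → u ≠ 2 → v ≠ 2 →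
      Runs A ω (.seq (.storeW 2 (.var 19) (.arr u (.var 19)))
        (.storeW 3 (.var 19) (.arr v (.var 19)))) σ 20
        fun τ => τ.warr 2 e = a ∧ τ.warr 3 e = b ∧ τ.warr 4 = σ.warr 4 ∧
          ∀ e' ≠ e, τ.warr 2 e' = σ.warr 2 e' ∧ τ.warr 3 e' = σ.warr 3 e' := by
    intro a b u v ha hb hu hv
    refine Runs.time ((Runs.storeW_eq hA hB (j := e) (v := a) (by simpa [WExp.val] using h19)
      (by simp [WExp.val, h19, ha]) (ha ▸ hB.2 _ _) (by simp [WExp.leaves, slack, WExp.maxLit])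
      (by simp [WExp.leaves, slack, WExp.maxLit])).seq (T' := 10) ?_)
      (by simp [WExp.cost])
    rintro τ₁ hB₁ - rfl
    refine ((Runs.storeW_eq hA hB₁ (j := e) (v := b) (by simpa [WExp.val] using h19)
      (by simp [WExp.val, h19, hb, hv]) (hb ▸ hB.2 _ _) (by simp [WExp.leaves, slack, WExp.maxLit])
      (by simp [WExp.leaves, slack, WExp.maxLit])).time (by simp [WExp.cost])).post ?_
    rintro _ - - rfl
    refine ⟨by simp, by simp, by funext i; simp, fun e' he' => by simp [he']⟩
  refine Runs.time (Runs.seq (T := 40)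
    (R := fun τ => τ.warr 2 e = d.tail k e ∧ τ.warr 3 e = d.head k e ∧ τ.warr 4 = σ.warr 4 ∧
      ∀ e' ≠ e, τ.warr 2 e' = σ.warr 2 e' ∧ τ.warr 3 e' = σ.warr 3 e') ?_ ?_ (T' := d.N k * 29 + 67))
    (by omega)
  · refine Runs.time (Runs.ite (T := 20) hA hB (fun ht => ?_) (fun ht => ?_)) (by decide)
    · replace ht : (d.L - k) % 2 = 0 := by simpa [Test.holds, WExp.val, hE.wL, h12] using ht
      refine hcopy ?_ ?_ (by norm_num) (by norm_num)
      · rw [hE.asrc, tail, if_pos ht]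
      · rw [hE.atgt, head, if_pos ht]
    · replace ht : ¬ (d.L - k) % 2 = 0 := by simpa [Test.holds, WExp.val, hE.wL, h12] using ht
      refine hcopy ?_ ?_ (by norm_num) (by norm_num)
      · rw [hE.atgt, tail, if_neg ht]
      · rw [hE.asrc, head, if_neg ht]
  rintro τ₁ hB₁ hF₁ ⟨ha2, ha3, ha4, hae⟩
  have hE₁ := hE.frame hF₁
  refine Runs.time ((Runs.setW_eq hA hB₁ (v := 1) (by simp [WExp.val]) (by omega)).seq
    (T' := d.N k * 29 + 47) ?_) (by simp only [WExp.cost]; omega)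
  rintro τ₂ hB₂ hF₂ heq₂
  have h19' : τ₁.wvar 19 = e := by rw [hF₁.w 19 (by decide)]; exact h19
  refine Runs.time ((Runs.setR_eq hA hB₂ (v := d.delay e)
    (by simp [RExp.val, WExp.val, heq₂, hE₁.adelay, h19'])).seq
    (T' := d.N k * 29 + 27) ?_) (by simp only [WExp.cost, RExp.cost]; omega)
  rintro τ₃ hB₃ hF₃ heq₃
  have h16' : τ₃.wvar 16 = d.N k := by
    simp [heq₃, heq₂, hF₁.w 16 (by decide), h16]
  have hg' : τ₃.rvar 4 = d.g sc k := by
    simp [heq₃, heq₂, hF₁.r 4 (by decide), hg]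
  refine Runs.time ((Runs.for (d.N k) (T := 20)
    (fun i τ => τ.wvar 21 = scan (d.delay e) (d.g sc k) i) hA hB₃ h16'
    (by simp [heq₃, heq₂, scan]) ?_).seq (T' := 10) ?_) (by omega)
  · intro i τ hi hBτ hF hx hI
    have h5 : τ.rvar 5 = d.delay e := by rw [hF.r 5 (by decide), heq₃]; simp
    have h4 : τ.rvar 4 = d.g sc k := by rw [hF.r 4 (by decide), hg']
    refine Runs.time (Runs.ite (T := 10) hA hBτ (fun ht => ?_) (fun ht => ?_)) (by decide)
    · simp only [Test.holds, RExp.val, WExp.val, hI, h5, h4] at ht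
      refine (Runs.skip hBτ ?_).time (by norm_num)
      rw [scan, if_pos ht]
      simpa using hI
    · simp only [Test.holds, RExp.val, WExp.val, hI, h5, h4] at ht
      have := scan_le (d.delay e) (d.g sc k) i
      refine ((Runs.setW_eq hA hBτ (v := scan (d.delay e) (d.g sc k) i + 1)
        (by simp [WExp.val, hI]) (by omega)).time (by decide)).post ?_
      rintro _ - - rfl
      rw [scan, if_neg ht]
      simp
  · rintro τ₄ hB₄ hF₄ ⟨-, h21⟩
    have h19'' : τ₄.wvar 19 = e := by
      rw [hF₄.w 19 (by decide), heq₃, heq₂]; simpa using h19'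
    have hwa : τ₄.warr = τ₁.warr := by
      funext a
      rw [hF₄.wa a (by decide +revert), heq₃, heq₂]
      rfl
    refine ((Runs.storeW_eq hA hB₄ (j := e) (v := d.rd sc k e) (by simpa [WExp.val] using h19'')
      (by rw [WExp.val]; exact h21) ((scan_le _ _ _).trans hN1)).time (by decide)).post ?_
    rintro _ - - rfl
    refine ⟨by simp [hwa, ha2], by simp [hwa, ha3], by simp, fun e' he' => ?_⟩
    simp [hwa, he', hae e' he', ha4]

/-- The reason why all levels have the same cost bound: more sources are balanced by fewer delays.
-/
theorem M_mul_N {k : ℕ} (hk : k ≤ d.L) : d.M k * d.N k = 64 * (d.lam * d.E * 2 ^ d.L) := by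
  unfold M N
  have : 2 ^ d.L = 2 ^ k * 2 ^ (d.L - k) := by rw [← pow_add]; congr 1; omega
  rw [this, pow_succ]
  ring

theorem Mp_le {k : ℕ} (hk : k ≤ d.L) : d.Mp k ≤ d.lam * 2 ^ d.L := by
  unfold Mp
  split_ifs
  · exact Nat.zero_le _
  · exact Nat.mul_le_mul_left _ (Nat.pow_le_pow_right (by norm_num) hk)

/-- The unit in which the time for a level is measured. -/
def unit (d : Data n m) : ℕ := d.lam * d.E * 2 ^ d.L * (n + m + d.lam * 2 ^ d.L + 1)

theorem runs_level (hA : 32 ≤ A) (hB : Bounded A σ) (hY : ∀ r, d.Y r < n) (hE0 : 0 < d.E)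
    (hl0 : 0 < d.lam)
    (hcap : d.lam * 2 ^ (d.L + 2) ≤ A) (hE : d.Env σ) (hk : k ≤ d.L) (h11 : σ.wvar 11 = j)
    (h12 : σ.wvar 12 = k) (hS : d.LevelStart sc j k σ) :
    Runs A ω level σ (100000 * d.unit) (d.LevelStart sc j (k + 1)) := by
  have hNA : 32 * d.E * 2 ^ d.L + 1 ≤ A := hE.wN1 ▸ hB.1 9
  have hN1 := d.N_le k
  have hN0 : 0 < d.N k := by unfold N; positivity
  refine Runs.time ((Runs.setW_eq hA hB (v := d.N k)
    (by simp [WExp.val, hE.wN0, hS.w14 hk, N]) (by omega)).seq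
    (T' := 5 + ((m * (d.N k * 29 + 107 + 9) + 7) +
      ((d.M k * ((d.N k + 1) * (400 * (n + m + d.Mp k + 1) + 9) + 10 + 9) + 7) + 40))) ?_) ?_
  · rintro τ₁ hB₁ hF₁ heq₁
    have hE₁ := hE.frame hF₁
    refine Runs.time ((Runs.setW_eq hA hB₁ (v := d.N k + 1)
      (by simp [WExp.val, heq₁]) (by omega)).seq
      (T' := ((m * (d.N k * 29 + 107 + 9) + 7) +
      ((d.M k * ((d.N k + 1) * (400 * (n + m + d.Mp k + 1) + 9) + 10 + 9) + 7) + 40))) ?_)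
      (by simp only [WExp.cost]; omega)
    rintro τ₂ hB₂ hF₂ heq₂
    have hE₂ := hE₁.frame hF₂
    have e12 : τ₂.wvar 12 = k := by simp [heq₂, heq₁, h12]
    have e16 : τ₂.wvar 16 = d.N k := by simp [heq₂, heq₁]
    have e31 : τ₂.wvar 31 = d.N k + 1 := by simp [heq₂]
    have e11 : τ₂.wvar 11 = j := by simp [heq₂, heq₁, h11]
    have e15 : τ₂.wvar 15 = d.M k := by simp [heq₂, heq₁, hS.w15]
    have e17 : τ₂.wvar 17 = d.Mp k := by simp [heq₂, heq₁, hS.w17]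
    have e14 : τ₂.wvar 14 = σ.wvar 14 := by simp [heq₂, heq₁]
    have e4 : τ₂.rvar 4 = d.g (sc * 2 ^ j) k := by simp [heq₂, heq₁, hS.r4]
    have eD : τ₂.rarr = σ.rarr := by simp [heq₂, heq₁]
    refine (Runs.for m (fun c τ => ∀ e < c, τ.warr 2 e = d.tail k e ∧ τ.warr 3 e = d.head k e ∧
      τ.warr 4 e = d.rd (sc * 2 ^ j) k e) hA hB₂ hE₂.wm (by simp) ?_).seq ?_
    · intro e τ he hBτ hF hx hI
      refine (runs_roundEdge hA hBτ (hE₂.frame hF) (by rw [hF.w 12 (by decide), e12])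
        (by rw [hF.w 16 (by decide), e16]) (by rw [hF.r 4 (by decide), e4]) hx).post ?_
      rintro τ' - - ⟨h1, h2, h3, h4⟩ e' he'
      by_cases hee : e' = e
      · subst hee; exact ⟨h1, h2, h3⟩
      · obtain ⟨g1, g2, g3⟩ := h4 e' hee
        obtain ⟨f1, f2, f3⟩ := hI e' (by omega)
        exact ⟨g1.trans f1, g2.trans f2, g3.trans f3⟩
    rintro τ₃ hB₃ hF₃ ⟨-, hedge⟩
    have hE₃ : d.LevelEnv (sc * 2 ^ j) j k τ₃ :=
      ⟨hE₂.frame hF₃, by rw [hF₃.w 11 (by decide), e11], by rw [hF₃.w 12 (by decide), e12],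
        by rw [hF₃.w 15 (by decide), e15], by rw [hF₃.w 31 (by decide), e31],
        by rw [hF₃.w 17 (by decide), e17], fun e he => (hedge e he).1,
        fun e he => (hedge e he).2.1, fun e he => (hedge e he).2.2⟩
    refine (Runs.for (d.M k) (fun r τ => d.Done sc j k r 0 τ) hA hB₃ hE₃.wM
      (hS.done.congr (by rw [Store.setW_rarr, hF₃.ra 2 (by decide), eD])) ?_).seq ?_
    · intro r τ hr hBτ hF hx hI
      exact (runs_source hA hBτ hY (hE₃.frame hF) hk hr hx hI).post fun τ' _ _ h => h
    rintro τ₄ hB₄ hF₄ ⟨-, hdone⟩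
    have hE₄ := hE₃.frame hF₄
    have h14 : τ₄.wvar 14 = 2 ^ (d.L - k) := by
      rw [hF₄.w 14 (by decide), hF₃.w 14 (by decide), e14, hS.w14 hk]
    have h4 : τ₄.rvar 4 = d.g (sc * 2 ^ j) k := by
      rw [hF₄.r 4 (by decide), hF₃.r 4 (by decide), e4]
    refine Runs.time ((Runs.setW_eq hA hB₄ (v := d.M k) (by simp [WExp.val, hE₄.wM])
      (hE₄.wM ▸ hB₄.1 15)).seq (T' := 30) ?_) (by decide)
    rintro τ₅ hB₅ hF₅ heq₅
    have hM2 : 2 * d.M k = d.M (k + 1) := by unfold M; ring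
    -- For `k = L` the register receives `M (L + 1) = lam * 2 ^ (L + 2)`, which is never used but
    -- has to fit; this is what `hcap` is for.
    have hMA : d.M (k + 1) ≤ A := by
      refine le_trans (Nat.mul_le_mul_left _ (Nat.pow_le_pow_right (by norm_num) ?_)) hcap
      omega
    refine Runs.time ((Runs.setW_eq hA hB₅ (v := d.M (k + 1))
      (by simp [WExp.val, heq₅, hE₄.wM, hM2]) hMA).seq (T' := 20) ?_) (by decide)
    rintro τ₆ hB₆ hF₆ heq₆
    have h14A : 2 ^ (d.L - k) / 2 ≤ A := (Nat.div_le_self _ _).trans (h14 ▸ hB₄.1 14)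
    refine Runs.time ((Runs.setW_eq hA hB₆ (v := 2 ^ (d.L - k) / 2)
      (by simp [WExp.val, heq₆, heq₅, h14]) h14A).seq (T' := 10) ?_) (by decide)
    rintro τ₇ hB₇ hF₇ heq₇
    refine ((Runs.setR_eq hA hB₇ (v := d.g (sc * 2 ^ j) (k + 1))
      (by simp [RExp.val, heq₇, heq₆, heq₅, h4, g_succ, two_mul])).time (by decide)).post ?_
    rintro τ₈ - - heq₈
    refine ⟨fun hk' => ?_, by simp [heq₈, heq₇, heq₆], ?_, by simp [heq₈], ?_⟩
    · rw [show d.L - k = d.L - (k + 1) + 1 by omega, pow_succ] at heq₇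
      simp [heq₈, heq₇]
    · simp [heq₈, heq₇, heq₆, heq₅, Mp, M]
    · have : d.Done sc j (k + 1) 0 0 τ₄ := by
        refine hdone.next fun j₁ k₁ r₁ v₁ I₁ hin hlt => ?_
        have := hin.r_lt
        rcases hlt with h1 | ⟨rfl, h1 | ⟨rfl, h1⟩⟩
        · omega
        · rcases Nat.lt_succ_iff_lt_or_eq.1 h1 with h1 | rfl <;> omega
        · omega
      exact this.congr (by simp [heq₈, heq₇, heq₆, heq₅])
  · have h1 := d.M_mul_N hk
    have h2 := d.Mp_le hk
    obtain ⟨Q, hQ⟩ : ∃ Q, Q = d.lam * d.E * 2 ^ d.L := ⟨_, rfl⟩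
    obtain ⟨S, hS⟩ : ∃ S, S = n + m + d.lam * 2 ^ d.L + 1 := ⟨_, rfl⟩
    have hu : d.unit = Q * S := by rw [unit, ← hQ, ← hS]
    rw [← hQ] at h1
    have hNQ : d.N k ≤ 32 * Q := by
      rw [hQ]
      refine hN1.trans ?_
      have : 1 * (32 * d.E * 2 ^ d.L) ≤ d.lam * (32 * d.E * 2 ^ d.L) :=
        Nat.mul_le_mul_right _ hl0
      nlinarith
    have hMQ : d.M k ≤ 64 * Q := by rw [← h1]; exact Nat.le_mul_of_pos_right _ hN0
    rw [hu]
    have hS1 : 1 ≤ S := by omega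
    have hQ1 : 1 ≤ Q := by rw [hQ]; exact Nat.succ_le_of_lt (by positivity)
    have hmS : m ≤ S := by omega
    have hb1 : m * (d.N k * 29 + 107 + 9) ≤ S * (145 * (32 * Q)) := Nat.mul_le_mul hmS (by omega)
    -- About `M k * N k = 64 * Q` rows with `O(S)` steps each; the extra row per source is absorbed
    -- by `M k ≤ 64 * Q`.
    have hb2 : d.M k * ((d.N k + 1) * (400 * (n + m + d.Mp k + 1) + 9) + 10 + 9) ≤
        128 * Q * (428 * S) := by
      have hx : 400 * (n + m + d.Mp k + 1) + 9 ≤ 409 * S := by omega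
      calc _ ≤ d.M k * ((d.N k + 1) * (409 * S) + (d.N k + 1) * (19 * S)) := by
            refine Nat.mul_le_mul_left _ ?_
            have := Nat.mul_le_mul_left (d.N k + 1) hx
            have h19 : 1 * 19 ≤ (d.N k + 1) * (19 * S) := Nat.mul_le_mul (by omega) (by omega)
            rw [one_mul] at h19
            rw [Nat.add_assoc _ 10 9]
            exact Nat.add_le_add this h19
        _ = (d.M k * d.N k + d.M k) * (428 * S) := by ring
        _ ≤ _ := Nat.mul_le_mul_right _ (by omega)
    have hb3 : 1 * 1 ≤ Q * S := Nat.mul_le_mul hQ1 hS1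
    have hr1 : S * (145 * (32 * Q)) = 4640 * (Q * S) := by ring
    have hr2 : 128 * Q * (428 * S) = 54784 * (Q * S) := by ring
    simp only [WExp.cost]
    omega

theorem runs_scale (hA : 32 ≤ A) (hB : Bounded A σ) (hY : ∀ r, d.Y r < n) (hE0 : 0 < d.E)
    (hl0 : 0 < d.lam) (hcap : d.lam * 2 ^ (d.L + 2) ≤ A) (hE : d.Env σ) (h11 : σ.wvar 11 = j)
    (h3 : σ.rvar 3 = sc * 2 ^ j) (hD : d.Done sc j 0 0 0 σ) :
    Runs A ω scale σ ((d.L + 1) * (100000 * d.unit + 9) + 100) fun τ =>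
      τ.rvar 3 = sc * 2 ^ (j + 1) ∧ d.Done sc (j + 1) 0 0 0 τ ∧ τ.rarr 3 j = sc * 2 ^ j ∧
        ∀ j' ≠ j, τ.rarr 3 j' = σ.rarr 3 j' := by
  refine Runs.time ((Runs.storeR_eq hA hB (j := j) (v := sc * 2 ^ j) (by simpa [WExp.val] using h11)
    (by simpa [RExp.val] using h3)).seq
    (T' := 2 + (4 + (2 + (11 + (((d.L + 1) * (100000 * d.unit + 9) + 7) + 10))))) ?_)
    (by simp only [WExp.cost, RExp.cost]; omega)
  rintro τ₁ hB₁ hF₁ heq₁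
  have hE₁ := hE.frame hF₁
  refine (Runs.setW_eq hA hB₁ (v := 2 ^ d.L) (by simp [WExp.val, hE₁.wP])
    (hE₁.wP ▸ hB₁.1 5)).seq ?_
  rintro τ₂ hB₂ hF₂ heq₂
  have hE₂ := hE₁.frame hF₂
  refine (Runs.setW_eq hA hB₂ (v := d.M 0) (by simp [WExp.val, hE₂.wlam, M, mul_comm])
    (le_trans (Nat.mul_le_mul_left _ (Nat.pow_le_pow_right (by norm_num) (by omega))) hcap)).seq ?_
  rintro τ₃ hB₃ hF₃ heq₃
  have hE₃ := hE₂.frame hF₃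
  refine (Runs.setW_eq hA hB₃ (v := 0) (by simp [WExp.val]) (by omega)).seq ?_
  rintro τ₄ hB₄ hF₄ heq₄
  have hE₄ := hE₃.frame hF₄
  refine Runs.time ((Runs.setR_eq hA hB₄ (v := d.g (sc * 2 ^ j) 0) (by
    have : τ₄.rvar 3 = sc * 2 ^ j := by simp [heq₄, heq₃, heq₂, heq₁, h3]
    simp [RExp.val, WExp.val, this, hE₄.wE, hE₄.wP, g])).seq
    (T' := (((d.L + 1) * (100000 * d.unit + 9) + 7) + 10)) ?_)
    (by simp only [WExp.cost, RExp.cost]; omega)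
  rintro τ₅ hB₅ hF₅ heq₅
  have hE₅ := hE₄.frame hF₅
  have h3' : τ₅.rvar 3 = sc * 2 ^ j := by simp [heq₅, heq₄, heq₃, heq₂, heq₁, h3]
  have h11' : τ₅.wvar 11 = j := by simp [heq₅, heq₄, heq₃, heq₂, heq₁, h11]
  have hstart : d.LevelStart sc j 0 τ₅ := by
    refine ⟨fun _ => by simp [heq₅, heq₄, heq₃, heq₂], by simp [heq₅, heq₄, heq₃],
      by simp [heq₅, heq₄, Mp], by simp [heq₅], hD.congr ?_⟩
    funext i
    simp [heq₅, heq₄, heq₃, heq₂, heq₁]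
  refine (Runs.for (d.L + 1) (fun k τ => d.LevelStart sc j k τ) hA hB₅ hE₅.wL1 ?_ ?_).seq ?_
  · exact ⟨by simpa using hstart.w14, by simpa using hstart.w15, by simpa using hstart.w17,
      by simpa using hstart.r4, hstart.done.congr rfl⟩
  · intro k τ hk hBτ hF hx hS
    refine (runs_level hA hBτ hY hE0 hl0 hcap (hE₅.frame hF) (by omega)
      (by rw [hF.w 11 (by decide), h11']) hx hS).post ?_
    rintro τ' - - h
    exact ⟨by simpa using h.w14, by simpa using h.w15, by simpa using h.w17,
      by simpa using h.r4, h.done.congr rfl⟩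
  · rintro τ₆ hB₆ hF₆ ⟨-, hS⟩
    have hr3 : τ₆.rvar 3 = sc * 2 ^ j := by rw [hF₆.r 3 (by decide), h3']
    refine ((Runs.setR_eq hA hB₆ (v := sc * 2 ^ (j + 1))
      (by simp only [RExp.val, hr3]; ring)).time (by decide)).post ?_
    rintro τ₇ - - heq₇
    have hra : τ₇.rarr 3 = τ₁.rarr 3 := by
      rw [heq₇, Store.setR_rarr, hF₆.ra 3 (by decide), heq₅, heq₄, heq₃, heq₂]
      rfl
    refine ⟨by simp [heq₇], ?_, by simp [hra, heq₁], fun j' hj' => by simp [hra, heq₁, hj']⟩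
    have : d.Done sc (j + 1) 0 0 0 τ₆ := by
      refine hS.done.next fun j₁ k₁ r₁ v₁ I₁ hin hlt => ?_
      have := hin.k_le
      omega
    exact this.congr (by rw [heq₇]; rfl)

theorem runs_tables (hA : 32 ≤ A) (hB : Bounded A σ) (hY : ∀ r, d.Y r < n) (hE0 : 0 < d.E)
    (hl0 : 0 < d.lam) (hcap : d.lam * 2 ^ (d.L + 2) ≤ A) (hE : d.Env σ) {J : ℕ}
    (h7 : σ.wvar 7 = J) (h1 : σ.rvar 1 = sc) :
    Runs A ω tables σ (J * ((d.L + 1) * (100000 * d.unit + 9) + 109) + 9) fun τ =>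
      d.Done sc J 0 0 0 τ ∧ ∀ j < J, τ.rarr 3 j = sc * 2 ^ j := by
  refine Runs.time ((Runs.setR_eq hA hB (v := sc) (by simp [RExp.val, h1])).seq
    (T' := J * ((d.L + 1) * (100000 * d.unit + 9) + 100 + 9) + 7) ?_)
    (le_of_eq (by simp only [RExp.cost]; ring))
  rintro τ₁ hB₁ hF₁ heq₁
  have hE₁ := hE.frame hF₁
  refine (Runs.for J (fun j τ => τ.rvar 3 = sc * 2 ^ j ∧ d.Done sc j 0 0 0 τ ∧
    ∀ j' < j, τ.rarr 3 j' = sc * 2 ^ j') hA hB₁ (by rw [hF₁.w 7 (by decide), h7]) ?_ ?_).post ?_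
  · refine ⟨by simp [heq₁], fun j' k' r' v' I' _ hlt => by omega, by omega⟩
  · rintro j τ hj hBτ hF hx ⟨h3, hD, ha⟩
    refine (runs_scale hA hBτ hY hE0 hl0 hcap (hE₁.frame hF) hx h3 hD).post ?_
    rintro τ' - - ⟨g1, g2, g3, g4⟩
    refine ⟨g1, g2, fun j' hj' => ?_⟩
    by_cases hjj : j' = j
    · subst hjj; exact g3
    · exact (g4 j' hjj).trans (ha j' (by omega))
  · rintro τ - - ⟨-, -, h⟩
    exact h

end Data
end RSP

/-! ### Parameters, sampling, preprocessing and queries. -/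

namespace RSP

variable {A : ℕ} {σ τ : Store} {ω : Tape} {n m : ℕ}

namespace Prog

/-- The number of levels `L` and `2 ^ L`. -/
def initLevels : Cmd :=
  .seq (.log 4 (.ofWord (.lit 2)) (.ofWord (.var 0)))
  (.seq (.setW 4 (.add (.var 4) (.lit 1)))
  (.seq (.setW 5 (.lit 1)) (.for 20 4 (.setW 5 (.mul (.lit 2) (.var 5))))))

/-- The accuracy `E`. -/
def initAccuracy : Cmd :=
  .seq (.log 3 (.ofWord (.lit 2)) (.div (.ofWord (.lit 1)) (.var 0)))
  (.seq (.setW 3 (.add (.var 3) (.lit 1)))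
  (.seq (.setW 2 (.lit 1)) (.for 20 3 (.setW 2 (.mul (.lit 2) (.var 2))))))

/-- The number of delay scales. -/
def initScales : Cmd :=
  .seq (.log 7 (.ofWord (.lit 2)) (.div (.var 2) (.var 1))) (.setW 7 (.add (.var 7) (.lit 1)))

/-- The remaining parameters, and a copy of the parameters for the queries. -/
def initRest : Cmd :=
  .seq (.setW 28 (.mul (.var 6) (.var 5)))
  (.seq (.setW 8 (.mul (.lit 2) (.var 28)))
  (.seq (.setW 10 (.mul (.lit 32) (.var 2)))
  (.seq (.setW 9 (.add (.mul (.var 10) (.var 5)) (.lit 1)))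
  (.seq (.setW 30 (.add (.var 4) (.lit 1)))
  (.seq (.storeW 7 (.lit 0) (.var 2))
  (.seq (.storeW 7 (.lit 1) (.var 4))
  (.seq (.storeW 7 (.lit 2) (.var 8))
  (.seq (.storeW 7 (.lit 3) (.var 28))
  (.seq (.storeW 7 (.lit 4) (.var 0))
  (.storeW 7 (.lit 5) (.var 9)))))))))))

/-- The sources: random vertices, followed by all vertices. -/
def sample : Cmd :=
  .seq (.for 20 28 (.seq (.rand 21 (.var 0)) (.storeW 5 (.var 20) (.var 21))))
    (.for 20 28 (.storeW 5 (.add (.var 28) (.var 20)) (.mod (.var 20) (.var 0))))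

/-- The rounded delays at which the queries look up their answers. -/
def indexTable : Cmd :=
  .seq (.setR 3 (.mul (.ofWord (.lit 8)) (.ofWord (.add (.var 2) (.lit 1)))))
  (.seq (.setR 4 (.add (.ofWord (.lit 1)) (.div (.ofWord (.lit 1))
    (.mul (.ofWord (.lit 2)) (.ofWord (.var 2))))))
  (.seq (.setW 29 (.mul (.lit 2) (.var 2)))
  (.for 22 29 (.seq (.setW 21 (.lit 0))
    (.seq (.for 20 10 (.ite (.rle (.ofWord (.add (.var 21) (.lit 1))) (.var 3))
      (.setW 21 (.add (.var 21) (.lit 1))) Cmd.skip))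
    (.seq (.storeW 6 (.var 22) (.var 21)) (.setR 3 (.mul (.var 3) (.var 4)))))))))

/-- The preprocessing. -/
def pre (c₀ : ℕ) : Cmd :=
  .seq initLevels (.seq initAccuracy (.seq initScales
    (.seq (.setW 6 (.mul (.lit c₀) (.var 4))) (.seq initRest
    (.seq sample (.seq indexTable tables))))))

/-- The position of the answer to a query. -/
def queryIx : WExp :=
  .add (.mul (.add (.mul (.add (.mul (.add (.mul (.var 2) (.add (.arr 7 (.lit 1)) (.lit 1)))
    (.arr 7 (.lit 1))) (.arr 7 (.lit 2))) (.add (.arr 7 (.lit 3)) (.var 0))) (.arr 7 (.lit 4)))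
    (.var 1)) (.arr 7 (.lit 5))) (.arr 6 (.var 3))

/-- The answer to a query. -/
def query : Cmd :=
  .seq (.log 2 (.ofWord (.lit 2)) (.div (.var 0) (.arr 3 (.lit 0))))
  (.seq (.log 3 (.add (.ofWord (.lit 1)) (.div (.ofWord (.lit 1))
    (.mul (.ofWord (.lit 2)) (.ofWord (.arr 7 (.lit 0)))))) (.div (.var 0) (.arr 3 (.var 2))))
  (.seq (.setR 1 (.arr 2 queryIx))
  (.ite (.rle (.ofWord (.lit 1)) (.var 1))
    (.seq (.setW 0 (.lit 1)) (.setR 0 (.sub (.var 1) (.ofWord (.lit 1)))))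
    (.setW 0 (.lit 0)))))

end Prog

open Prog

theorem pow_floor_logb {b z : ℝ} (hb : 1 < b) (hz : 1 ≤ z) :
    b ^ ⌊Real.logb b z⌋₊ ≤ z ∧ z < b ^ (⌊Real.logb b z⌋₊ + 1) := by
  have hb0 : 0 < b := by linarith
  have hz0 : 0 < z := by linarith
  have h0 : 0 ≤ Real.logb b z := Real.logb_nonneg hb hz
  constructor
  · rw [← Real.rpow_natCast, ← Real.le_logb_iff_rpow_le hb hz0]
    exact Nat.floor_le h0
  · rw [← Real.rpow_natCast, ← Real.logb_lt_iff_lt_rpow hb hz0]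
    push_cast
    exact Nat.lt_floor_add_one _

theorem runs_doubling {x b N : ℕ} (hA : 32 ≤ A) (hB : Bounded A σ) (hb : σ.wvar b = N)
    (hx : σ.wvar x = 1) (hN : 2 ^ N ≤ A) (hmod : x ≠ 20 ∧ b ≠ 20 ∧ b ≠ x) :
    Runs A ω (.for 20 b (.setW x (.mul (.lit 2) (.var x)))) σ (N * 13 + 7)
      fun τ => τ.wvar x = 2 ^ N := by
  obtain ⟨h1, h2, h3⟩ := hmod
  refine (Runs.for N (T := 4) (fun i τ => τ.wvar x = 2 ^ i) hA hB hb (by simp [h1, hx]) ?_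
    ⟨h2.symm, by simp [Cmd.wmod, h1.symm], by simp [Cmd.wmod, h3]⟩).post fun τ _ _ h => h.2
  intro i τ hi hBτ _ _ hI
  refine ((Runs.setW_eq hA hBτ (v := 2 ^ (i + 1)) (by simp [WExp.val, hI, pow_succ, mul_comm])
    ((Nat.pow_le_pow_right (by norm_num) hi).trans hN) ⟨by simp [WExp.leaves, slack],
    by simp [WExp.maxLit]⟩)).post ?_
  rintro _ - - rfl
  simp [h1]

theorem runs_initLevels (hA : 32 ≤ A) (hB : Bounded A σ) {L : ℕ} (hn : 1 ≤ n) (h0 : σ.wvar 0 = n)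
    (hL : ⌊Real.logb 2 n⌋₊ + 1 = L) (hP : 2 ^ L ≤ A) :
    Runs A ω initLevels σ (L * 13 + 30) fun τ => τ.wvar 4 = L ∧ τ.wvar 5 = 2 ^ L := by
  have hLA : L < A := Nat.lt_two_pow_self.trans_le hP
  have hv : Real.logb ((RExp.ofWord (.lit 2)).val σ) ((RExp.ofWord (.var 0)).val σ) =
      Real.logb 2 n := by simp [RExp.val, WExp.val, h0]
  refine Runs.time ((Runs.log (Q := fun τ => τ = σ.setW 4 ⌊Real.logb 2 n⌋₊) hA hB ?_ ?_ ?_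
    (by rw [hv])).seq (T' := L * 13 + 20) ?_) (by simp only [RExp.cost, WExp.cost]; omega)
  · simp [RExp.val, WExp.val]
  · simpa [RExp.val, WExp.val, h0] using hn
  · rw [hv]; omega
  rintro τ₁ hB₁ hF₁ heq₁
  refine Runs.time ((Runs.setW_eq hA hB₁ (v := L) (by simp [WExp.val, heq₁, hL])
    (by omega)).seq (T' := L * 13 + 10) ?_) (by simp only [WExp.cost]; omega)
  rintro τ₂ hB₂ hF₂ heq₂
  refine Runs.time ((Runs.setW_eq hA hB₂ (v := 1) (by simp [WExp.val])
    (by omega)).seq (T' := L * 13 + 7) ?_) (by simp only [WExp.cost]; omega)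
  rintro τ₃ hB₃ hF₃ heq₃
  refine (runs_doubling hA hB₃ (by simp [heq₃, heq₂]) (by simp [heq₃]) hP (by decide)).post ?_
  intro τ₄ _ hF₄ h
  exact ⟨by rw [hF₄.w 4 (by decide)]; simp [heq₃, heq₂], h⟩

theorem runs_initAccuracy (hA : 32 ≤ A) (hB : Bounded A σ) {a : ℕ} {ε : ℝ} (h0 : σ.rvar 0 = ε)
    (hε : 1 ≤ 1 / ε) (ha : ⌊Real.logb 2 (1 / ε)⌋₊ + 1 = a) (hP : 2 ^ a ≤ A) :
    Runs A ω initAccuracy σ (a * 13 + 30) fun τ => τ.wvar 2 = 2 ^ a := by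
  have haA : a < A := Nat.lt_two_pow_self.trans_le hP
  have hv : Real.logb ((RExp.ofWord (.lit 2)).val σ)
      ((RExp.div (.ofWord (.lit 1)) (.var 0)).val σ) = Real.logb 2 (1 / ε) := by
    simp [RExp.val, WExp.val, h0]
  refine Runs.time ((Runs.log (Q := fun τ => τ = σ.setW 3 ⌊Real.logb 2 (1 / ε)⌋₊) hA hB ?_ ?_ ?_
    (by rw [hv])).seq (T' := a * 13 + 20) ?_) (by simp only [RExp.cost, WExp.cost]; omega)
  · simp [RExp.val, WExp.val]
  · simpa [RExp.val, WExp.val, h0] using hε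
  · rw [hv]; omega
  rintro τ₁ hB₁ hF₁ heq₁
  refine Runs.time ((Runs.setW_eq hA hB₁ (v := a) (by simp only [WExp.val, heq₁]; simpa using ha)
    (by omega)).seq (T' := a * 13 + 10) ?_) (by simp only [WExp.cost]; omega)
  rintro τ₂ hB₂ hF₂ heq₂
  refine Runs.time ((Runs.setW_eq hA hB₂ (v := 1) (by simp [WExp.val])
    (by omega)).seq (T' := a * 13 + 7) ?_) (by simp only [WExp.cost]; omega)
  rintro τ₃ hB₃ hF₃ heq₃
  exact (runs_doubling hA hB₃ (by simp [heq₃, heq₂]) (by simp [heq₃]) hP (by decide))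

theorem runs_initScales (hA : 32 ≤ A) (hB : Bounded A σ) {J : ℕ} {x y : ℝ} (h1 : σ.rvar 1 = x)
    (h2 : σ.rvar 2 = y) (hxy : 1 ≤ y / x) (hJ : ⌊Real.logb 2 (y / x)⌋₊ + 1 = J) (hJA : J ≤ A) :
    Runs A ω initScales σ 20 fun τ => τ.wvar 7 = J := by
  have hv : Real.logb ((RExp.ofWord (.lit 2)).val σ)
      ((RExp.div (.var 2) (.var 1)).val σ) = Real.logb 2 (y / x) := by
    simp [RExp.val, WExp.val, h1, h2]
  refine Runs.time ((Runs.log (Q := fun τ => τ = σ.setW 7 ⌊Real.logb 2 (y / x)⌋₊) hA hB ?_ ?_ ?_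
    (by rw [hv])).seq (T' := 10) ?_) (by decide)
  · simp [RExp.val, WExp.val]
  · simpa [RExp.val, WExp.val, h1, h2] using hxy
  · rw [hv]; omega
  rintro τ₁ hB₁ hF₁ heq₁
  refine ((Runs.setW_eq hA hB₁ (v := J) (by simp only [WExp.val, heq₁]; simpa using hJ)
    hJA).time (by decide)).post ?_
  rintro τ₂ - - heq₂
  simp [heq₂]

namespace Data

/-- The copy of the parameters for the queries. -/
structure Consts (d : Data n m) (f : ℕ → ℕ) : Prop where
  c0 : f 0 = d.E
  c1 : f 1 = d.L
  c2 : f 2 = d.lam * 2 ^ (d.L + 1)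
  c3 : f 3 = d.lam * 2 ^ d.L
  c4 : f 4 = n
  c5 : f 5 = 32 * d.E * 2 ^ d.L + 1

variable {d : Data n m}

theorem runs_initRest (hA : 32 ≤ A) (hB : Bounded A σ) (hcap : d.lam * 2 ^ (d.L + 2) ≤ A)
    (hN : 32 * d.E * 2 ^ d.L + 1 ≤ A) (h0 : σ.wvar 0 = n)
    (h2 : σ.wvar 2 = d.E) (h4 : σ.wvar 4 = d.L) (h5 : σ.wvar 5 = 2 ^ d.L)
    (h6 : σ.wvar 6 = d.lam) :
    Runs A ω initRest σ 100 fun τ => τ.wvar 28 = d.lam * 2 ^ d.L ∧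
      τ.wvar 8 = d.lam * 2 ^ (d.L + 1) ∧ τ.wvar 10 = 32 * d.E ∧
      τ.wvar 9 = 32 * d.E * 2 ^ d.L + 1 ∧ τ.wvar 30 = d.L + 1 ∧ d.Consts (τ.warr 7) := by
  have hW : d.lam * 2 ^ (d.L + 1) = 2 * (d.lam * 2 ^ d.L) := by ring
  have hW2 : d.lam * 2 ^ (d.L + 2) = 4 * (d.lam * 2 ^ d.L) := by ring
  have hP : 2 ^ d.L ≤ A := h5 ▸ hB.1 5
  have hL : d.L < 2 ^ d.L := Nat.lt_two_pow_self
  have hE : 32 * d.E * 1 ≤ 32 * d.E * 2 ^ d.L := Nat.mul_le_mul_left _ (by omega)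
  refine Runs.time ((Runs.setW_eq hA hB (v := d.lam * 2 ^ d.L) (by simp [WExp.val, h6, h5])
    (by omega)).seq (T' := 90) ?_) (by decide)
  rintro τ₁ hB₁ - rfl
  refine Runs.time ((Runs.setW_eq hA hB₁ (v := d.lam * 2 ^ (d.L + 1)) (by simp [WExp.val, hW])
    (by omega)).seq (T' := 80) ?_) (by decide)
  rintro τ₁ hB₁ - rfl
  refine Runs.time ((Runs.setW_eq hA hB₁ (v := 32 * d.E) (by simp [WExp.val, h2])
    (by omega)).seq (T' := 70) ?_) (by decide)
  rintro τ₁ hB₁ - rfl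
  refine Runs.time ((Runs.setW_eq hA hB₁ (v := 32 * d.E * 2 ^ d.L + 1) (by simp [WExp.val, h5])
    (by omega)).seq (T' := 60) ?_) (by decide)
  rintro τ₁ hB₁ - rfl
  refine Runs.time ((Runs.setW_eq hA hB₁ (v := d.L + 1) (by simp [WExp.val, h4])
    (by omega)).seq (T' := 50) ?_) (by decide)
  rintro τ₁ hB₁ - rfl
  refine Runs.time ((Runs.storeW_eq hA hB₁ (j := 0) (v := d.E) (by simp [WExp.val])
    (by simp [WExp.val, h2]) (by omega)).seq (T' := 40) ?_) (by decide)
  rintro τ₁ hB₁ - rfl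
  refine Runs.time ((Runs.storeW_eq hA hB₁ (j := 1) (v := d.L) (by simp [WExp.val])
    (by simp [WExp.val, h4]) (by omega)).seq (T' := 30) ?_) (by decide)
  rintro τ₁ hB₁ - rfl
  refine Runs.time ((Runs.storeW_eq hA hB₁ (j := 2) (v := d.lam * 2 ^ (d.L + 1))
    (by simp [WExp.val]) (by simp [WExp.val]) (by omega)).seq (T' := 20) ?_) (by decide)
  rintro τ₁ hB₁ - rfl
  refine Runs.time ((Runs.storeW_eq hA hB₁ (j := 3) (v := d.lam * 2 ^ d.L) (by simp [WExp.val])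
    (by simp [WExp.val]) (by omega)).seq (T' := 15) ?_) (by decide)
  rintro τ₁ hB₁ - rfl
  refine Runs.time ((Runs.storeW_eq hA hB₁ (j := 4) (v := n) (by simp [WExp.val])
    (by simp [WExp.val, h0]) (h0 ▸ hB.1 0)).seq (T' := 10) ?_) (by decide)
  rintro τ₁ hB₁ - rfl
  refine ((Runs.storeW_eq hA hB₁ (j := 5) (v := 32 * d.E * 2 ^ d.L + 1) (by simp [WExp.val])
    (by simp [WExp.val]) hN).time (by decide)).post ?_
  rintro τ₁ - - rfl
  refine ⟨by simp, by simp, by simp, by simp, by simp, ?_⟩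
  constructor <;> simp

end Data

/-- The sources for a random tape: `N` random vertices, followed by all vertices. -/
def sources (n N : ℕ) (ω : Tape) (r : ℕ) : ℕ := if r < N then ω (r, n - 1) else (r - N) % n

theorem sources_lt {N : ℕ} (hn : 1 ≤ n) (ω : Tape) (r : ℕ) : sources n N ω r < n := by
  unfold sources
  split_ifs
  · have := (ω (r, n - 1)).2
    simp only at this
    omega
  · exact Nat.mod_lt _ hn

/-- Since sampling makes the first draws of the run, source number `r < N` is the tape entry `(r, n
- 1)`. The second half lists all vertices as soon as `n ≤ N`. -/
theorem runs_sample (hA : 32 ≤ A) (hB : Bounded A σ) {N : ℕ} (hn : 1 ≤ n) (h0 : σ.wvar 0 = n)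
    (h28 : σ.wvar 28 = N) (hd : σ.draws = 0) :
    Runs A ω sample σ (N * 40 + 20) fun τ => ∀ r < 2 * N, τ.warr 5 r = sources n N ω r := by
  have hnA : n ≤ A := h0 ▸ hB.1 0
  refine Runs.time (((Runs.for N (T := 10) (fun i τ => τ.draws = i ∧
    ∀ r < i, τ.warr 5 r = ω (r, n - 1)) hA hB h28 (by simp [hd]) ?_)).seq
    (T' := N * 19 + 7) ?_) (by omega)
  · rintro i τ hi hBτ hF hx ⟨hdr, hI⟩
    refine Runs.time ((Runs.rand (k := n - 1) (Q := fun τ' => τ' = τ.draw 21 (ω (i, n - 1))) hA hBτ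
      (by simp only [WExp.val]; rw [hF.w 0 (by decide), h0]; omega) (by omega)
      (by rw [hdr])).seq (T' := 6) ?_) (by decide)
    rintro τ₁ hB₁ hF₁ heq₁
    have hle : (ω (i, n - 1) : ℕ) ≤ A := (Nat.lt_succ_iff.1 (ω (i, n - 1)).2).trans
      ((Nat.sub_le _ _).trans hnA)
    refine ((Runs.storeW_eq hA hB₁ (j := i) (v := ω (i, n - 1)) (by simp [WExp.val, heq₁, hx])
      (by simp [WExp.val, heq₁]) hle).time (by decide)).post ?_
    rintro τ₂ - - heq₂
    refine ⟨by simp [heq₂, heq₁, hdr], fun r hr => ?_⟩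
    by_cases hri : r = i
    · subst hri; simp [heq₂]
    · simp [heq₂, heq₁, hri, hI r (by omega)]
  · rintro τ₁ hB₁ hF₁ ⟨-, -, h₁⟩
    refine (Runs.for N (T := 10) (fun i τ => ∀ r < N + i, τ.warr 5 r = sources n N ω r) hA hB₁
      (by rw [hF₁.w 28 (by decide), h28]) ?_ ?_).post ?_
    · intro r hr
      rw [sources, if_pos (by omega), Store.setW_warr, h₁ r (by omega)]
    · intro i τ hi hBτ hF hx hI
      have e0 : τ.wvar 0 = n := by rw [hF.w 0 (by decide), hF₁.w 0 (by decide), h0]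
      have e28 : τ.wvar 28 = N := by rw [hF.w 28 (by decide), hF₁.w 28 (by decide), h28]
      refine ((Runs.storeW_eq hA hBτ (j := N + i) (v := i % n) (by simp [WExp.val, e28, hx])
        (by simp [WExp.val, e0, hx]) ((Nat.mod_lt _ hn).le.trans hnA)).time (by decide)).post ?_
      rintro τ₂ - - heq₂ r hr
      by_cases hri : r = N + i
      · subst hri; simp [heq₂, sources]
      · simp [heq₂, hri, hI r (by omega)]
    · rintro τ - - ⟨-, h⟩ r hr
      exact h r (by omega)

open Classical in
/-- The largest natural number that is at most `y` and at most the bound `N`. -/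
noncomputable def floorTo (y : ℝ) : ℕ → ℕ
  | 0 => 0
  | i + 1 => if ((floorTo y i : ℕ) : ℝ) + 1 ≤ y then floorTo y i + 1 else floorTo y i

theorem floorTo_le (y : ℝ) (N : ℕ) : floorTo y N ≤ N := by
  induction N with
  | zero => exact le_rfl
  | succ i ih => rw [floorTo]; split_ifs <;> omega

theorem floorTo_le_self {y : ℝ} (hy : 0 ≤ y) (N : ℕ) : (floorTo y N : ℝ) ≤ y := by
  induction N with
  | zero => simpa [floorTo] using hy
  | succ i ih =>
    rw [floorTo]
    split_ifs with h
    · push_cast; exact h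
    · exact ih

/-- If the count ever fails to advance, it has reached the true floor; otherwise it equals `N`. -/
theorem lt_floorTo {y : ℝ} {N : ℕ} (hy : y < N + 1) : y < floorTo y N + 1 := by
  have : floorTo y N = N ∨ y < floorTo y N + 1 := by
    clear hy
    induction N with
    | zero => exact Or.inl rfl
    | succ i ih =>
      rw [floorTo]
      split_ifs with h
      · rcases ih with ih | ih
        · exact Or.inl (by omega)
        · exact absurd h (not_le.2 ih)
      · exact Or.inr (not_le.1 h)
  rcases this with h | h
  · rw [h]; exact hy
  · exact h

/-- The ratio of successive delays of the index table. -/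
noncomputable def ratio (E : ℕ) : ℝ := 1 + 1 / (2 * E)

/-- A query cannot round `8 * (E + 1) * z` in constant time, so these values are tabulated for all
`2 * E` slots, by counting, in `O(E ^ 2)` steps. -/
theorem runs_indexTable (hA : 32 ≤ A) (hB : Bounded A σ) {E : ℕ} (h2 : σ.wvar 2 = E)
    (h10 : σ.wvar 10 = 32 * E) :
    Runs A ω indexTable σ (2 * E * (32 * E * 29 + 50) + 50) fun τ =>
      ∀ i < 2 * E, τ.warr 6 i = floorTo (8 * (E + 1) * ratio E ^ i) (32 * E) := by
  have hEA : 32 * E ≤ A := h10 ▸ hB.1 10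
  refine Runs.time ((Runs.setR_eq hA hB (v := 8 * (E + 1)) (by simp [RExp.val, WExp.val, h2])).seq
    (T' := 2 * E * (32 * E * 29 + 50) + 35) ?_) (by simp only [RExp.cost, WExp.cost]; omega)
  rintro τ₁ hB₁ hF₁ heq₁
  refine Runs.time ((Runs.setR_eq hA hB₁ (v := ratio E)
    (by simp [RExp.val, WExp.val, heq₁, h2, ratio])).seq
    (T' := 2 * E * (32 * E * 29 + 50) + 20) ?_) (by simp only [RExp.cost, WExp.cost]; omega)
  rintro τ₂ hB₂ hF₂ heq₂
  refine Runs.time ((Runs.setW_eq hA hB₂ (v := 2 * E) (by simp [WExp.val, heq₂, heq₁, h2])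
    (by omega)).seq (T' := 2 * E * (32 * E * 29 + 41 + 9) + 7) ?_)
    (by rw [show 32 * E * 29 + 41 + 9 = 32 * E * 29 + 50 by omega]; simp only [WExp.cost]; omega)
  rintro τ₃ hB₃ hF₃ heq₃
  refine (Runs.for (2 * E) (fun i τ => τ.rvar 3 = 8 * (E + 1) * ratio E ^ i ∧
    ∀ i' < i, τ.warr 6 i' = floorTo (8 * (E + 1) * ratio E ^ i') (32 * E)) hA hB₃
    (by simp [heq₃]) (by simp [heq₃, heq₂, heq₁]) ?_).post fun τ _ _ h => h.2.2
  rintro i τ hi hBτ hF hx ⟨h3, hI⟩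
  have e10 : τ.wvar 10 = 32 * E := by rw [hF.w 10 (by decide), heq₃, heq₂, heq₁]; simp [h10]
  have e4 : τ.rvar 4 = ratio E := by rw [hF.r 4 (by decide), heq₃, heq₂]; simp
  refine Runs.time ((Runs.setW_eq hA hBτ (v := 0) (by simp [WExp.val]) (by omega)).seq
    (T' := 32 * E * 29 + 7 + 20) ?_) (by simp only [WExp.cost]; omega)
  rintro τ₄ hB₄ hF₄ heq₄
  refine (Runs.for (32 * E) (T := 20)
    (fun i' τ => τ.wvar 21 = floorTo (8 * (E + 1) * ratio E ^ i) i') hA hB₄ (by simp [heq₄, e10])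
    (by simp [heq₄, floorTo]) ?_).seq (T' := 20) ?_
  · intro i' τ' hi' hB' hF' hx' hI'
    have hle := floorTo_le (8 * (E + 1) * ratio E ^ i) i'
    have e3 : τ'.rvar 3 = 8 * (E + 1) * ratio E ^ i := by
      rw [hF'.r 3 (by decide), heq₄]; exact h3
    refine Runs.time (Runs.ite (T := 6) hA hB' (fun ht => ?_) (fun ht => ?_)) (by decide)
    · simp only [Test.holds, RExp.val, WExp.val, hI', e3, Nat.cast_add, Nat.cast_one] at ht
      refine ((Runs.setW_eq hA hB' (v := floorTo (8 * (E + 1) * ratio E ^ i) i' + 1)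
        (by simp [WExp.val, hI']) (by omega)).time (by decide)).post ?_
      rintro _ - - rfl
      rw [floorTo, if_pos ht]
      simp
    · simp only [Test.holds, RExp.val, WExp.val, hI', e3, Nat.cast_add, Nat.cast_one] at ht
      refine (Runs.skip hB' ?_).time (by norm_num)
      rw [floorTo, if_neg ht]
      simpa using hI'
  · rintro τ₅ hB₅ hF₅ ⟨-, h21⟩
    have e22 : τ₅.wvar 22 = i := by rw [hF₅.w 22 (by decide), heq₄]; simpa using hx
    have e6 : τ₅.warr 6 = τ.warr 6 := by rw [hF₅.wa 6 (by decide), heq₄]; rfl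
    have e3 : τ₅.rvar 3 = 8 * (E + 1) * ratio E ^ i := by
      rw [hF₅.r 3 (by decide), heq₄]; exact h3
    have e4' : τ₅.rvar 4 = ratio E := by rw [hF₅.r 4 (by decide), heq₄]; exact e4
    refine Runs.time ((Runs.storeW_eq hA hB₅ (j := i) (by simpa [WExp.val] using e22)
      (by simpa [WExp.val] using h21) ((floorTo_le _ _).trans hEA)).seq (T' := 10) ?_) (by decide)
    rintro τ₆ hB₆ hF₆ heq₆
    refine ((Runs.setR_eq hA hB₆ (v := 8 * (E + 1) * ratio E ^ (i + 1))
      (by simp [RExp.val, heq₆, e3, e4', pow_succ, mul_assoc])).time (by decide)).post ?_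
    rintro τ₇ - - heq₇
    refine ⟨by simp [heq₇], fun i' hi' => ?_⟩
    by_cases hii : i' = i
    · subst hii; simp [heq₇, heq₆]
    · simp [heq₇, heq₆, hii, e6, hI i' (by omega)]

/-! ### The preprocessing and the queries -/

namespace Data

/-- The memory holds the data structure for the queries. -/
structure Ready (d : Data n m) (sc : ℝ) (J : ℕ) (σ : Store) : Prop where
  done : d.Done sc J 0 0 0 σ
  scales : ∀ j < J, σ.rarr 3 j = sc * 2 ^ j
  index : ∀ i < 2 * d.E, σ.warr 6 i = floorTo (8 * (d.E + 1) * ratio d.E ^ i) (32 * d.E)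
  consts : d.Consts (σ.warr 7)

theorem runs_pre {c₀ a J : ℕ} {G : Net n m} {ε Dmin Dmax : ℝ} {d : Data n m} (hA : 32 ≤ A)
    (hn : 2 ≤ n) (hnA : n ≤ A) (hmA : m ≤ A)
    (hε : 1 ≤ 1 / ε) (hD : 1 ≤ Dmax / Dmin) (hdG : d.net = G)
    (hL : ⌊Real.logb 2 n⌋₊ + 1 = d.L) (ha : ⌊Real.logb 2 (1 / ε)⌋₊ + 1 = a) (hEa : d.E = 2 ^ a)
    (hJ : ⌊Real.logb 2 (Dmax / Dmin)⌋₊ + 1 = J) (hlam : d.lam = c₀ * d.L) (hc₀ : 0 < c₀)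
    (hY : d.Y = sources n (d.lam * 2 ^ d.L) ω) (hJA : J ≤ A) (hc₀A : c₀ ≤ A)
    (hcap : d.lam * 2 ^ (d.L + 2) ≤ A) (hN : 32 * d.E * 2 ^ d.L + 1 ≤ A) :
    Runs A ω (pre c₀) (startStore G ε Dmin Dmax) (d.L * 13 + 30 + (a * 13 + 30 + (20 + (4 + (100 +
      (d.lam * 2 ^ d.L * 40 + 20 + (2 * d.E * (32 * d.E * 29 + 50) + 50 +
      (J * ((d.L + 1) * (100000 * d.unit + 9) + 109) + 9))))))))
      (d.Ready Dmin J) := by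
  have hL0 : 0 < d.L := by omega
  have hlam0 : 0 < d.lam := hlam ▸ Nat.mul_pos hc₀ hL0
  have hE0 : 0 < d.E := hEa ▸ by positivity
  have hP : 2 ^ d.L ≤ A := by
    refine le_trans ?_ hcap
    calc 2 ^ d.L = 1 * 2 ^ d.L := (one_mul _).symm
      _ ≤ _ := Nat.mul_le_mul hlam0 (Nat.pow_le_pow_right (by norm_num) (by omega))
  have hEA : 2 ^ a ≤ A := by
    rw [← hEa]
    have : 32 * d.E * 1 ≤ 32 * d.E * 2 ^ d.L := Nat.mul_le_mul_left _ Nat.one_le_two_pow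
    omega
  have hlamA : d.lam ≤ A := by
    refine le_trans ?_ hcap
    exact Nat.le_mul_of_pos_right _ (by positivity)
  have hB : Bounded A (startStore G ε Dmin Dmax) := by
    constructor
    · intro x
      simp only [startStore]
      split_ifs <;> omega
    · intro b i
      simp only [startStore]
      split_ifs <;> first
        | exact Nat.zero_le _
        | (unfold pad; split_ifs <;>
            first | exact Nat.zero_le _ | exact (Fin.is_lt _).le.trans hnA)
  refine (runs_initLevels (n := n) hA hB (by omega) rfl hL hP).seq ?_
  rintro τ₁ hB₁ hF₁ ⟨h14, h15⟩
  refine (runs_initAccuracy (ε := ε) hA hB₁ (by rw [hF₁.r 0 (by decide)]; rfl) hε ha hEA).seq ?_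
  rintro τ₂ hB₂ hF₂ h22
  refine (runs_initScales (x := Dmin) (y := Dmax) hA hB₂
    (by rw [hF₂.r 1 (by decide), hF₁.r 1 (by decide)]; rfl)
    (by rw [hF₂.r 2 (by decide), hF₁.r 2 (by decide)]; rfl) hD hJ hJA).seq ?_
  rintro τ₃ hB₃ hF₃ h37
  have h34 : τ₃.wvar 4 = d.L := by rw [hF₃.w 4 (by decide), hF₂.w 4 (by decide), h14]
  -- The literal `c₀` is not bounded by 32 but depends on the exponents of the theorem; here `c₀ ≤
  -- A` is used instead.
  refine (Runs.setW' (Q := fun τ => τ = τ₃.setW 6 d.lam) (by omega) hB₃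
    (by simp [WExp.leaves, slack]) (by simpa [WExp.maxLit] using hc₀A)
    (by simpa [WExp.val, h34, ← hlam] using hlamA) (by simp [WExp.val, h34, hlam])).seq ?_
  rintro τ₄ hB₄ hF₄ heq₄
  have w (x : ℕ) (h1 : x ∉ initScales.wmod) (h2 : x ∉ initAccuracy.wmod) (h3 : x ≠ 6) :
      τ₄.wvar x = τ₁.wvar x := by
    rw [heq₄, Store.setW_wvar, if_neg h3, hF₃.w x h1, hF₂.w x h2]
  have h40 : τ₄.wvar 0 = n := by rw [w 0 (by decide) (by decide) (by decide), hF₁.w 0 (by decide)]; rfl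
  have h41 : τ₄.wvar 1 = m := by rw [w 1 (by decide) (by decide) (by decide), hF₁.w 1 (by decide)]; rfl
  have h44 : τ₄.wvar 4 = d.L := by rw [w 4 (by decide) (by decide) (by decide), h14]
  have h45 : τ₄.wvar 5 = 2 ^ d.L := by rw [w 5 (by decide) (by decide) (by decide), h15]
  have h46 : τ₄.wvar 6 = d.lam := by simp [heq₄]
  have h42 : τ₄.wvar 2 = d.E := by
    rw [heq₄, Store.setW_wvar, if_neg (by decide), hF₃.w 2 (by decide), h22, hEa]
  have h47 : τ₄.wvar 7 = J := by simp [heq₄, h37]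
  have hw₄ : τ₄.warr = (startStore G ε Dmin Dmax).warr := by
    funext b
    rw [heq₄, Store.setW_warr, hF₃.wa b (by decide +revert), hF₂.wa b (by decide +revert),
      hF₁.wa b (by decide +revert)]
  have hr₄ : τ₄.rarr = (startStore G ε Dmin Dmax).rarr := by
    funext b
    rw [heq₄, Store.setW_rarr, hF₃.ra b (by decide +revert), hF₂.ra b (by decide +revert),
      hF₁.ra b (by decide +revert)]
  have hd₄ : τ₄.draws = 0 := by
    rw [heq₄, Store.setW_draws, hF₃.d (by decide), hF₂.d (by decide), hF₁.d (by decide)]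
    rfl
  have hr1₄ : τ₄.rvar 1 = Dmin := by
    rw [heq₄, Store.setW_rvar, hF₃.r 1 (by decide), hF₂.r 1 (by decide), hF₁.r 1 (by decide)]
    rfl
  refine (runs_initRest hA hB₄ hcap hN h40 h42 h44 h45 h46).seq ?_
  rintro τ₅ hB₅ hF₅ ⟨h528, h58, h510, h59, h530, hconst⟩
  refine (runs_sample (n := n) hA hB₅ (by omega) (by rw [hF₅.w 0 (by decide), h40]) h528
    (by rw [hF₅.d (by decide), hd₄])).seq ?_
  rintro τ₆ hB₆ hF₆ hsamp
  refine (runs_indexTable hA hB₆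
    (by rw [hF₆.w 2 (by decide), hF₅.w 2 (by decide), h42])
    (by rw [hF₆.w 10 (by decide), h510])).seq ?_
  rintro τ₇ hB₇ hF₇ hindex
  have hE : d.Env τ₇ := by
    have w (x : ℕ) (h1 : x ∉ indexTable.wmod) (h2 : x ∉ sample.wmod) (h3 : x ∉ initRest.wmod) :
        τ₇.wvar x = τ₄.wvar x := by
      rw [hF₇.w x h1, hF₆.w x h2, hF₅.w x h3]
    have w' (x : ℕ) (h1 : x ∉ indexTable.wmod) (h2 : x ∉ sample.wmod) : τ₇.wvar x = τ₅.wvar x := by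
      rw [hF₇.w x h1, hF₆.w x h2]
    refine ⟨(w 0 (by decide) (by decide) (by decide)).trans h40,
      (w 1 (by decide) (by decide) (by decide)).trans h41,
      (w 2 (by decide) (by decide) (by decide)).trans h42,
      (w 4 (by decide) (by decide) (by decide)).trans h44,
      (w 5 (by decide) (by decide) (by decide)).trans h45,
      (w 6 (by decide) (by decide) (by decide)).trans h46,
      (w' 8 (by decide) (by decide)).trans h58, (w' 9 (by decide) (by decide)).trans h59,
      (w' 10 (by decide) (by decide)).trans h510, (w' 30 (by decide) (by decide)).trans h530,
      ?_, ?_, ?_, ?_, ?_⟩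
    · rw [hF₇.wa 0 (by decide), hF₆.wa 0 (by decide), hF₅.wa 0 (by decide), hw₄]
      subst hdG; rfl
    · rw [hF₇.wa 1 (by decide), hF₆.wa 1 (by decide), hF₅.wa 1 (by decide), hw₄]
      subst hdG; rfl
    · intro r hr
      rw [hF₇.wa 5 (by decide), hsamp r (by rw [pow_succ, ← mul_assoc] at hr; omega), hY]
    · rw [hF₇.ra 0 (by decide), hF₆.ra 0 (by decide), hF₅.ra 0 (by decide), hr₄]
      subst hdG; rfl
    · rw [hF₇.ra 1 (by decide), hF₆.ra 1 (by decide), hF₅.ra 1 (by decide), hr₄]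
      subst hdG; rfl
  refine (runs_tables (sc := Dmin) (J := J) hA hB₇ (by rw [hY]; exact sources_lt (by omega) ω) hE0
    hlam0 hcap hE ?_ ?_).post ?_
  · rw [hF₇.w 7 (by decide), hF₆.w 7 (by decide), hF₅.w 7 (by decide), h47]
  · rw [hF₇.r 1 (by decide), hF₆.r 1 (by decide), hF₅.r 1 (by decide), hr1₄]
  · rintro τ₈ - hF₈ ⟨hdone, hsc⟩
    refine ⟨hdone, hsc, ?_, ?_⟩
    · rw [hF₈.wa 6 (by decide)]; exact hindex
    · rw [hF₈.wa 7 (by decide), hF₇.wa 7 (by decide), hF₆.wa 7 (by decide)]; exact hconst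

/-- The delay scale of a query. -/
noncomputable def scaleOf (sc D : ℝ) : ℕ := ⌊Real.logb 2 (D / sc)⌋₊

/-- The entry of the index table for a query. -/
noncomputable def slotOf (E : ℕ) (sc D : ℝ) : ℕ :=
  ⌊Real.logb (ratio E) (D / (sc * 2 ^ scaleOf sc D))⌋₊

/-- The table entry that answers a query. -/
noncomputable def cellOf (d : Data n m) (sc : ℝ) (s t : ℕ) (D : ℝ) : ℝ :=
  d.tbl (sc * 2 ^ scaleOf sc D) d.L (d.lam * 2 ^ d.L + s)
    (floorTo (8 * (d.E + 1) * ratio d.E ^ slotOf d.E sc D) (32 * d.E)) t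

open Classical in
/-- The answer to a query. -/
noncomputable def answerOf (d : Data n m) (sc : ℝ) (s t : ℕ) (D : ℝ) : Option ℝ :=
  if 1 ≤ d.cellOf sc s t D then some (d.cellOf sc s t D - 1) else none

theorem one_lt_ratio {E : ℕ} (hE : 0 < E) : 1 < ratio E := by
  have : (0 : ℝ) < E := by exact_mod_cast hE
  unfold ratio
  have : (0 : ℝ) < 1 / (2 * E) := by positivity
  linarith

theorem scaleOf_spec {sc D : ℝ} (hsc : 0 < sc) (hD : sc ≤ D) :
    sc * 2 ^ scaleOf sc D ≤ D ∧ D < 2 * (sc * 2 ^ scaleOf sc D) := by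
  obtain ⟨h1, h2⟩ := pow_floor_logb (b := 2) (by norm_num) ((one_le_div hsc).2 hD)
  rw [le_div_iff₀ hsc] at h1
  rw [div_lt_iff₀ hsc, pow_succ] at h2
  constructor
  · unfold scaleOf; linarith
  · unfold scaleOf; linarith

/-- By Bernoulli's inequality `ratio E ^ (2 * E) ≥ 2`, whereas `D` is less than twice its scale; so
`2 * E` slots suffice. -/
theorem slotOf_spec {E : ℕ} (hE : 0 < E) {sc D : ℝ} (hsc : 0 < sc) (hD : sc ≤ D) :
    sc * 2 ^ scaleOf sc D * ratio E ^ slotOf E sc D ≤ D ∧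
      D < sc * 2 ^ scaleOf sc D * ratio E ^ (slotOf E sc D + 1) ∧ slotOf E sc D < 2 * E := by
  obtain ⟨h1, h2⟩ := scaleOf_spec hsc hD
  have hpos : 0 < sc * 2 ^ scaleOf sc D := by positivity
  have hz : 1 ≤ D / (sc * 2 ^ scaleOf sc D) := (one_le_div hpos).2 h1
  obtain ⟨h3, h4⟩ := pow_floor_logb (one_lt_ratio hE) hz
  refine ⟨?_, ?_, ?_⟩
  · rw [le_div_iff₀ hpos] at h3; unfold slotOf; linarith
  · rw [div_lt_iff₀ hpos] at h4; unfold slotOf; linarith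
  · by_contra hge
    rw [not_lt] at hge
    have h5 : (2 : ℝ) ≤ ratio E ^ (2 * E) := by
      have hE' : (0 : ℝ) < E := by exact_mod_cast hE
      have h1E : (0 : ℝ) < 1 / (2 * E) := by positivity
      have := one_add_mul_le_pow (a := 1 / (2 * (E : ℝ))) (by linarith) (2 * E)
      calc (2 : ℝ) = 1 + (2 * E : ℕ) * (1 / (2 * (E : ℝ))) := by push_cast; field_simp; norm_num
        _ ≤ _ := this
    have h6 := pow_le_pow_right₀ (one_lt_ratio hE).le hge
    have h7 : D / (sc * 2 ^ scaleOf sc D) < 2 := by rw [div_lt_iff₀ hpos]; exact h2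
    have h3' : ratio E ^ slotOf E sc D ≤ D / (sc * 2 ^ scaleOf sc D) := h3
    linarith

/-- Two logarithms find the scale and the slot. The table consulted is that of source number `lam *
2 ^ L + s`, where the list of all vertices contains `s`. -/
theorem runs_query {d : Data n m} {sc : ℝ} {J : ℕ} (hA : 32 ≤ A) (hB : Bounded A σ)
    (hR : d.Ready sc J σ)
    (hE : 0 < d.E) (hlam : 0 < d.lam) (hnA : n ≤ A) (hnL : n ≤ 2 ^ d.L) (hsc : 0 < sc)
    (hJA : J ≤ A) (s t : Fin n) {D : ℝ} (hD : sc ≤ D) (hJ : scaleOf sc D < J) :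
    Runs A ω query (queryStore σ s t D) 150 fun τ =>
      τ.warr = σ.warr ∧ τ.rarr = σ.rarr ∧ τ.answer = d.answerOf sc s t D := by
  have hEA : 2 * d.E ≤ A := by
    have h5 := hR.consts.c5 ▸ hB.2 7 5
    have : 32 * d.E * 1 ≤ 32 * d.E * 2 ^ d.L := Nat.mul_le_mul_left _ Nat.one_le_two_pow
    omega
  have hBq : Bounded A (queryStore σ s t D) := by
    refine ⟨fun x => ?_, hB.2⟩
    simp only [queryStore]
    split_ifs
    · exact s.2.le.trans hnA
    · exact t.2.le.trans hnA
    · exact Nat.zero_le _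
  have hs0 : σ.rarr 3 0 = sc := by rw [hR.scales 0 (by omega)]; simp
  have hsj : σ.rarr 3 (scaleOf sc D) = sc * 2 ^ scaleOf sc D := hR.scales _ hJ
  obtain ⟨h1, h2⟩ := scaleOf_spec hsc hD
  obtain ⟨h3, h4, h5⟩ := slotOf_spec hE hsc hD
  have hpos : 0 < sc * 2 ^ scaleOf sc D := by positivity
  have hv : ∀ v, v = D / sc → Real.logb ((2 : ℕ) : ℝ) v = Real.logb 2 (D / sc) := by
    rintro _ rfl; norm_num
  have hvy : (RExp.div (.var 0) (.arr 3 (.lit 0))).val (queryStore σ s t D) = D / sc := by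
    simp [RExp.val, WExp.val, queryStore, hs0]
  have hvb : (RExp.ofWord (.lit 2)).val (queryStore σ s t D) = 2 := by simp [RExp.val, WExp.val]
  have hfl : ⌊Real.logb 2 (D / sc)⌋₊ = scaleOf sc D := rfl
  refine Runs.time ((Runs.log (Q := fun τ => τ = (queryStore σ s t D).setW 2 (scaleOf sc D))
    hA hBq ?_ ?_ ?_ ?_).seq (T' := 140) ?_) (by decide)
  · rw [hvb]; norm_num
  · rw [hvy]; exact (one_le_div hsc).2 hD
  · rw [hvb, hvy, hfl]; omega
  · rw [hvb, hvy, hfl]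
  rintro τ₁ hB₁ - heq₁
  have hvy' : (RExp.div (.var 0) (.arr 3 (.var 2))).val τ₁ = D / (sc * 2 ^ scaleOf sc D) := by
    simp [RExp.val, WExp.val, heq₁, queryStore, hsj]
  have hvb' : (RExp.add (.ofWord (.lit 1)) (.div (.ofWord (.lit 1))
    (.mul (.ofWord (.lit 2)) (.ofWord (.arr 7 (.lit 0)))))).val τ₁ = ratio d.E := by
    simp [RExp.val, WExp.val, heq₁, queryStore, hR.consts.c0, ratio]
  have hfl' : ⌊Real.logb (ratio d.E) (D / (sc * 2 ^ scaleOf sc D))⌋₊ = slotOf d.E sc D := rfl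
  refine Runs.time ((Runs.log (Q := fun τ => τ = τ₁.setW 3 (slotOf d.E sc D))
    hA hB₁ ?_ ?_ ?_ ?_).seq (T' := 110) ?_) (by decide)
  · rw [hvb']; exact one_lt_ratio hE
  · rw [hvy']; exact (one_le_div hpos).2 h1
  · rw [hvb', hvy', hfl']; omega
  · rw [hvb', hvy', hfl']
  rintro τ₂ hB₂ - heq₂
  have hcell : (RExp.arr 2 queryIx).val τ₂ = d.cellOf sc s t D := by
    have hix : queryIx.val τ₂ = d.pos (scaleOf sc D) d.L (d.lam * 2 ^ d.L + s) t
        (floorTo (8 * (d.E + 1) * ratio d.E ^ slotOf d.E sc D) (32 * d.E)) := by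
      simp [queryIx, WExp.val, heq₂, heq₁, queryStore, hR.consts.c1, hR.consts.c2, hR.consts.c3,
        hR.consts.c4, hR.consts.c5, hR.index _ h5, pos]
    rw [RExp.val, hix, heq₂, heq₁]
    refine hR.done _ _ _ _ _ ⟨le_rfl, ?_, t.2, ?_⟩ (Or.inl hJ)
    · have := s.2
      have h1l : 1 * 2 ^ d.L ≤ d.lam * 2 ^ d.L := Nat.mul_le_mul_right _ hlam
      unfold M
      rw [pow_succ, ← mul_assoc]
      omega
    · unfold N
      simpa using floorTo_le _ _
  refine Runs.time ((Runs.setR_eq hA hB₂ hcell).seq (T' := 30) ?_) (by decide)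
  rintro τ₃ hB₃ - heq₃
  have hwa : τ₃.warr = σ.warr := by rw [heq₃, heq₂, heq₁]; rfl
  have hra : τ₃.rarr = σ.rarr := by rw [heq₃, heq₂, heq₁]; rfl
  have hc3 : τ₃.rvar 1 = d.cellOf sc s t D := by simp [heq₃]
  refine Runs.time (Runs.ite (T := 20) hA hB₃ (fun ht => ?_) (fun ht => ?_)) (by decide)
  · replace ht : 1 ≤ d.cellOf sc s t D := by simpa [Test.holds, RExp.val, WExp.val, hc3] using ht
    refine Runs.time ((Runs.setW_eq hA hB₃ (v := 1) (by simp [WExp.val]) (by omega)).seq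
      (T' := 10) ?_) (by decide)
    rintro τ₄ hB₄ - heq₄
    refine ((Runs.setR_eq hA hB₄ (v := d.cellOf sc s t D - 1)
      (by simp [RExp.val, WExp.val, heq₄, hc3])).time (by decide)).post ?_
    rintro τ₅ - - heq₅
    refine ⟨by rw [heq₅, heq₄]; exact hwa, by rw [heq₅, heq₄]; exact hra, ?_⟩
    simp [Store.answer, answerOf, ht, heq₅, heq₄]
  · replace ht : ¬ 1 ≤ d.cellOf sc s t D := by simpa [Test.holds, RExp.val, WExp.val, hc3] using ht
    refine ((Runs.setW_eq hA hB₃ (v := 0) (by simp [WExp.val]) (by omega)).time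
      (by decide)).post ?_
    rintro τ₄ - - heq₄
    refine ⟨by rw [heq₄]; exact hwa, by rw [heq₄]; exact hra, ?_⟩
    simp [Store.answer, answerOf, ht, heq₄]

end Data
end RSP

/-! ### Probability: random sources are dense on a fixed simple path. -/

namespace RSP

variable {n m : ℕ}

/-! ### The random sources -/

/-- The probability equals `1 - |S| / (N + 1)`, and `1 - x ≤ exp (-x)`. -/
theorem uniform_avoid_le (N : ℕ) (S : Finset ℕ) (hS : ∀ y ∈ S, y < N + 1) :
    (PMF.uniformOfFintype (Fin (N + 1))).toMeasure {v | (v : ℕ) ∉ S} ≤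
      ENNReal.ofReal (Real.exp (-(S.card / (N + 1 : ℝ)))) := by
  classical
  have hcard : Fintype.card {v : Fin (N + 1) | (v : ℕ) ∉ S} = N + 1 - S.card := by
    have h1 : (Finset.univ.filter fun v : Fin (N + 1) => (v : ℕ) ∈ S).card = S.card := by
      refine Finset.card_nbij (fun v => (v : ℕ)) ?_ ?_ ?_
      · intro v hv; simpa using hv
      · intro a _ b _ hab; exact Fin.ext hab
      · intro y hy; exact ⟨⟨y, hS y hy⟩, by simpa using hy, rfl⟩
    have h2 := Finset.card_filter_add_card_filter_not (s := (Finset.univ : Finset (Fin (N + 1))))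
      (fun v : Fin (N + 1) => (v : ℕ) ∈ S)
    rw [h1, Finset.card_univ, Fintype.card_fin] at h2
    rw [Fintype.card_ofFinset]
    have : (Finset.univ.filter fun v : Fin (N + 1) => (v : ℕ) ∉ S).card = N + 1 - S.card := by omega
    convert this using 2
    ext v
    rw [Finset.mem_filter, Finset.mem_filter]
    rfl
  have hle : S.card ≤ N + 1 := by
    have := Finset.card_le_card (s := S) (t := Finset.range (N + 1)) fun y hy => by
      simpa using hS y hy
    simpa using this
  rw [PMF.toMeasure_uniformOfFintype_apply _ MeasurableSet.of_discrete, hcard, Fintype.card_fin]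
  have hpos : (0 : ℝ) < (N : ℝ) + 1 := by positivity
  have h3 : (((N + 1 - S.card : ℕ) : ℝ≥0∞) / ((N + 1 : ℕ) : ℝ≥0∞)) =
      ENNReal.ofReal (1 - S.card / (N + 1 : ℝ)) := by
    rw [← ENNReal.ofReal_natCast, ← ENNReal.ofReal_natCast,
      ← ENNReal.ofReal_div_of_pos (by positivity)]
    congr 1
    rw [Nat.cast_sub hle]
    push_cast
    field_simp
  rw [h3]
  refine ENNReal.ofReal_le_ofReal ?_
  have := Real.add_one_le_exp (-(S.card / (N + 1 : ℝ)))
  linarith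

/-- The draws number `[lam * 2 ^ k, lam * 2 ^ (k + 1))`, for `k < L`, avoid the sets `S k`. -/
def Avoids (n L lam : ℕ) (S : ℕ → Finset ℕ) : Set Tape :=
  {ω | ∀ k < L, ∀ r ∈ Finset.Ico (lam * 2 ^ k) (lam * 2 ^ (k + 1)), (ω (r, n - 1) : ℕ) ∉ S k}

/-- The blocks of draws belonging to different levels are disjoint, so the probability factors over
the single draws; block `k` consists of `lam * 2 ^ k` of them. -/
theorem tapeLaw_avoids_le {L lam : ℕ} (hn : 1 ≤ n) {S : ℕ → Finset ℕ}
    (hS : ∀ k < L, ∀ y ∈ S k, y < n) :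
    tapeLaw (Avoids n L lam S) ≤
      ∏ k ∈ Finset.range L, ENNReal.ofReal (Real.exp (-(lam * 2 ^ k * ((S k).card / (n : ℝ))))) := by
  classical
  have hn1 : n - 1 + 1 = n := by omega
  let I : ℕ → Finset ℕ := fun k => Finset.Ico (lam * 2 ^ k) (lam * 2 ^ (k + 1))
  let Q : Finset (ℕ × ℕ) := (Finset.range L).biUnion fun k => (I k).image fun r => (r, n - 1)
  let B : (q : ℕ × ℕ) → Set (Fin (q.2 + 1)) := fun q => {v | ∀ k < L, q.1 ∈ I k → (v : ℕ) ∉ S k}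
  have hsub : Avoids n L lam S ⊆ Set.pi Q B := by
    intro ω hω q hq k hk hqk
    obtain ⟨k', hk', hq'⟩ := Finset.mem_biUnion.1 (Finset.mem_coe.1 hq)
    obtain ⟨r, -, rfl⟩ := Finset.mem_image.1 hq'
    exact hω k hk r hqk
  refine (MeasureTheory.measure_mono hsub).trans ?_
  rw [tapeLaw, MeasureTheory.Measure.infinitePi_pi _ fun _ _ => MeasurableSet.of_discrete]
  have hdisj : ∀ k₁ < L, ∀ k₂ < L, ∀ r, r ∈ I k₁ → r ∈ I k₂ → k₁ = k₂ := by
    have key : ∀ k₁ k₂ r, r ∈ I k₁ → r ∈ I k₂ → ¬ k₁ < k₂ := by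
      intro k₁ k₂ r h1 h2 hlt
      have h1' := (Finset.mem_Ico.1 h1).2
      have h2' := (Finset.mem_Ico.1 h2).1
      have : lam * 2 ^ (k₁ + 1) ≤ lam * 2 ^ k₂ :=
        Nat.mul_le_mul_left _ (Nat.pow_le_pow_right (by norm_num) hlt)
      omega
    intro k₁ _ k₂ _ r h1 h2
    have := key k₁ k₂ r h1 h2
    have := key k₂ k₁ r h2 h1
    omega
  rw [Finset.prod_biUnion]
  · refine Finset.prod_le_prod' fun k hk => ?_
    rw [Finset.prod_image fun a _ b _ h => (Prod.ext_iff.1 h).1]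
    have hk' := Finset.mem_range.1 hk
    have hexp : ENNReal.ofReal (Real.exp (-(lam * 2 ^ k * ((S k).card / (n : ℝ))))) =
        ENNReal.ofReal (Real.exp (-((S k).card / (n : ℝ)))) ^ (I k).card := by
      rw [← ENNReal.ofReal_pow (Real.exp_pos _).le, ← Real.exp_nat_mul]
      congr 2
      have : (I k).card = lam * 2 ^ k := by
        simp only [I, Nat.card_Ico, pow_succ, ← mul_assoc]; omega
      rw [this]; push_cast; ring
    rw [hexp]
    refine Finset.prod_le_pow_card _ _ _ fun r hr => ?_
    have h := uniform_avoid_le (n - 1) (S k) (by rw [hn1]; exact hS k hk')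
    have hc : ((n - 1 : ℕ) : ℝ) + 1 = n := by exact_mod_cast hn1
    rw [hc] at h
    exact (MeasureTheory.measure_mono fun v (hv : v ∈ B (r, n - 1)) => hv k hk' hr).trans h
  · intro k₁ hk₁ k₂ hk₂ hne
    refine Finset.disjoint_left.2 fun q hq₁ hq₂ => hne ?_
    obtain ⟨r, hr, rfl⟩ := Finset.mem_image.1 hq₁
    obtain ⟨r', hr', h⟩ := Finset.mem_image.1 hq₂
    have : r' = r := (Prod.ext_iff.1 h).1
    subst this
    exact hdisj k₁ (by simpa using hk₁) k₂ (by simpa using hk₂) _ hr hr'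

/-- As `2 / e ≤ 3 / 4`, the geometric sum is at most 4; the choice of an end of the path doubles it.
-/
theorem sum_two_div_exp_le (N : ℕ) :
    ∑ x ∈ Finset.range N ×ˢ (Finset.univ : Finset Bool),
      (2 * Real.exp (-1)) ^ x.1 ≤ 8 := by
  rw [Finset.sum_product]
  simp only [Finset.sum_const, Finset.card_univ, Fintype.card_bool, nsmul_eq_mul, ← Finset.mul_sum]
  have h1 : 2 * Real.exp (-1) ≤ 3 / 4 := by
    have := Real.exp_one_gt_d9
    rw [Real.exp_neg]
    have : (Real.exp 1)⁻¹ ≤ 3 / 8 := by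
      rw [inv_le_comm₀ (Real.exp_pos 1) (by norm_num)]; linarith
    linarith
  have h0 : 0 ≤ 2 * Real.exp (-1) := by positivity
  have h2 := geom_sum_mul_neg (2 * Real.exp (-1)) N
  have h3 : 0 ≤ (2 * Real.exp (-1)) ^ N := by positivity
  have h4 : 0 ≤ ∑ i ∈ Finset.range N, (2 * Real.exp (-1)) ^ i := by positivity
  push_cast
  nlinarith

namespace Data

/-- The data with the sources for a random tape. -/
def sampled (d : Data n m) (ω : Tape) : Data n m :=
  { d with Y := sources n (d.lam * 2 ^ d.L) ω }

/-- The sampled sources are dense on the path `p 0, …, p h`. -/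
def Dense (d : Data n m) (T h : ℕ) (p : ℕ → ℕ) : Prop :=
  ∃ X : ℕ → ℕ, (∀ k < d.L, d.Near k h p (X k)) ∧
    ∑ k ∈ Finset.range d.L, X k * (d.lam * 2 ^ k) ≤ (T + d.L) * 2 ^ d.L

/-- Take the least radius. By minimality the first `x` vertices counted from one of the two ends are
no sources; `b` tells which end. -/
theorem exists_near (d : Data n m) (k h : ℕ) (p : ℕ → ℕ) :
    ∃ (x : ℕ) (b : Bool), x ≤ h ∧ d.Near k h p x ∧
      ∀ t < x, ¬ d.Hit k (p (if b then t else h - t)) := by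
  classical
  have hex : ∃ x, d.Near k h p x := ⟨h, Or.inl le_rfl⟩
  obtain ⟨x, hx⟩ : ∃ x, x = Nat.find hex := ⟨_, rfl⟩
  have hnear : d.Near k h p x := hx ▸ Nat.find_spec hex
  have hxh : x ≤ h := hx ▸ Nat.find_min' hex (Or.inl le_rfl)
  cases x with
  | zero => exact ⟨0, true, hxh, hnear, by simp⟩
  | succ x =>
    have hnot : ¬ d.Near k h p x := Nat.find_min hex (by omega)
    unfold Near at hnot
    rw [not_or, not_and_or] at hnot
    rcases hnot.2 with h1 | h1
    · refine ⟨x + 1, true, hxh, hnear, fun t ht hh => h1 ⟨t, by omega, by omega, ?_⟩⟩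
      simpa using hh
    · refine ⟨x + 1, false, hxh, hnear, fun t ht hh => h1 ⟨h - t, by omega, by omega, ?_⟩⟩
      simpa using hh

/-- Measure the missed stretch of level `k` by `a k = ⌊X k * lam * 2 ^ k / 2 ^ L⌋`. If the sources
are not dense, then `∑ a k ≥ T`. For given `a` and given ends `b`, all the stretches are missed with
probability at most `exp (-∑ a k) ≤ ∏ (2 / e) ^ a k / 2 ^ T`, and the sum over all `(a, b)` is a
product of `L` geometric sums. Simplicity of the path makes the missed vertices distinct. -/
theorem tapeLaw_not_dense_le (d : Data n m) (hn : 1 ≤ n) (hnL : n ≤ 2 ^ d.L) (hlam : 0 < d.lam)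
    (T : ℕ) {h : ℕ} {p : ℕ → ℕ} (hp : ∀ t ≤ h, p t < n)
    (hinj : ∀ t ≤ h, ∀ t' ≤ h, p t = p t' → t = t') :
    tapeLaw {ω | ¬ (d.sampled ω).Dense T h p} ≤ ENNReal.ofReal (8 ^ d.L / 2 ^ T) := by
  classical
  obtain ⟨L, hLd⟩ : ∃ L, L = d.L := ⟨_, rfl⟩
  obtain ⟨lam, hlamd⟩ : ∃ lam, lam = d.lam := ⟨_, rfl⟩
  rw [← hLd] at hnL ⊢
  rw [← hlamd] at hlam
  have hlam' : (0 : ℝ) < lam := by exact_mod_cast hlam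
  -- The least number of missed vertices compatible with the normalized amount `a`.
  let w : ℕ → ℕ → ℕ := fun k a => ⌈(a * 2 ^ L : ℝ) / (lam * 2 ^ k)⌉₊
  let q : Bool → ℕ → ℕ := fun b t => p (if b then t else h - t)
  let N : ℕ := h * (lam * 2 ^ L) + 1
  let D : Finset (ℕ × Bool) := Finset.range N ×ˢ Finset.univ
  let P : Finset (Fin L → ℕ × Bool) := Fintype.piFinset fun _ => D
  let S : (Fin L → ℕ × Bool) → ℕ → Finset ℕ := fun f k =>
    if hk : k < L then (Finset.range (w k (f ⟨k, hk⟩).1)).image (q (f ⟨k, hk⟩).2) else ∅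
  let F : (Fin L → ℕ × Bool) → Prop := fun f =>
    (∀ k : Fin L, w k (f k).1 ≤ h) ∧ T ≤ ∑ k, (f k).1
  have hcover : {ω | ¬ (d.sampled ω).Dense T h p} ⊆
      ⋃ f ∈ P.filter F, Avoids n L lam (S f) := by
    intro ω hω
    have hex := fun k => (d.sampled ω).exists_near k h p
    choose X b hXh hnear hmiss using hex
    let a : ℕ → ℕ := fun k => X k * (lam * 2 ^ k) / 2 ^ L
    have haX : ∀ k, w k (a k) ≤ X k := by
      intro k
      refine Nat.ceil_le.2 ?_
      rw [div_le_iff₀ (by positivity)]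
      exact_mod_cast Nat.div_mul_le_self (X k * (lam * 2 ^ k)) (2 ^ L)
    have hsum : T ≤ ∑ k : Fin L, a k := by
      by_contra hlt
      rw [not_le, Fin.sum_univ_eq_sum_range (fun k => a k) L] at hlt
      refine hω ⟨X, fun k _ => hnear k, ?_⟩
      change ∑ k ∈ Finset.range d.L, X k * (d.lam * 2 ^ k) ≤ (T + d.L) * 2 ^ d.L
      rw [← hLd, ← hlamd]
      have hone : ∀ k ∈ Finset.range L, X k * (lam * 2 ^ k) ≤ (a k + 1) * 2 ^ L := by
        intro k _
        exact (Nat.lt_succ_iff.1 ((Nat.lt_mul_div_succ _ (by positivity)).trans_eq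
          (mul_comm _ _) |>.trans (Nat.lt_succ_self _)))
      refine (Finset.sum_le_sum hone).trans ?_
      rw [← Finset.sum_mul, Finset.sum_add_distrib]
      refine Nat.mul_le_mul_right _ ?_
      simp only [Finset.sum_const, Finset.card_range, smul_eq_mul, mul_one]
      omega
    refine Set.mem_iUnion₂.2 ⟨fun k => (a k, b k), ?_, ?_⟩
    · refine Finset.mem_filter.2 ⟨Fintype.mem_piFinset.2 fun k => Finset.mem_product.2
        ⟨Finset.mem_range.2 ?_, Finset.mem_univ _⟩, fun k => (haX k).trans (hXh k), hsum⟩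
      have h1 : X k * (lam * 2 ^ (k : ℕ)) ≤ h * (lam * 2 ^ L) := Nat.mul_le_mul (hXh k)
        (Nat.mul_le_mul_left _ (Nat.pow_le_pow_right (by norm_num) k.2.le))
      have h2 := Nat.div_le_self (X k * (lam * 2 ^ (k : ℕ))) (2 ^ L)
      change X k * (lam * 2 ^ (k : ℕ)) / 2 ^ L < h * (lam * 2 ^ L) + 1
      omega
    -- Only the second half of the sources of level `k` is used, which makes the levels independent.
    · intro k hk r hr hmem
      simp only [S, dif_pos hk] at hmem
      obtain ⟨t, ht, heq⟩ := Finset.mem_image.1 hmem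
      have hr2 := (Finset.mem_Ico.1 hr).2
      refine hmiss k t ((Finset.mem_range.1 ht).trans_le (haX k)) ⟨r, ?_, ?_⟩
      · change r < d.lam * 2 ^ (k + 1)
        rwa [← hlamd]
      · change sources n (d.lam * 2 ^ d.L) ω r = _
        rw [← hlamd, ← hLd]
        have : lam * 2 ^ (k + 1) ≤ lam * 2 ^ L :=
          Nat.mul_le_mul_left _ (Nat.pow_le_pow_right (by norm_num) hk)
        rw [sources, if_pos (by omega)]
        exact heq.symm
  have hone : ∀ f ∈ P.filter F, tapeLaw (Avoids n L lam (S f)) ≤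
      ENNReal.ofReal ((∏ k, (2 * Real.exp (-1)) ^ (f k).1) / 2 ^ T) := by
    intro f hf
    obtain ⟨-, hw, hT⟩ := Finset.mem_filter.1 hf
    refine (tapeLaw_avoids_le hn ?_).trans ?_
    · intro k hk y hy
      simp only [S, dif_pos hk] at hy
      obtain ⟨t, ht, rfl⟩ := Finset.mem_image.1 hy
      have ht' := Finset.mem_range.1 ht
      have hwk : w k (f ⟨k, hk⟩).1 ≤ h := hw ⟨k, hk⟩
      simp only [q]
      split_ifs
      · exact hp _ (by omega)
      · exact hp _ (by omega)
    · rw [← ENNReal.ofReal_prod_of_nonneg fun _ _ => (Real.exp_pos _).le]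
      refine ENNReal.ofReal_le_ofReal ?_
      rw [← Real.exp_sum, ← Fin.sum_univ_eq_sum_range
        (fun k => -((lam : ℝ) * 2 ^ k * ((S f k).card / (n : ℝ)))) L]
      -- With `w ≥ a * 2 ^ L / (lam * 2 ^ k)` and `2 ^ L ≥ n`, the exponent of level `k` is at least
      -- `a`.
      have hterm : ∀ k : Fin L, ((f k).1 : ℝ) ≤ lam * 2 ^ (k : ℕ) * ((S f k).card / (n : ℝ)) := by
        intro k
        have hcard : (S f k).card = w k (f k).1 := by
          simp only [S, dif_pos k.2]
          rw [Finset.card_image_of_injOn, Finset.card_range]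
          intro t ht t' ht' heq
          have h1 := Finset.mem_range.1 (Finset.mem_coe.1 ht)
          have h2 := Finset.mem_range.1 (Finset.mem_coe.1 ht')
          have h3 := hw k
          simp only [Fin.eta] at h1 h2
          simp only [q] at heq
          split_ifs at heq
          · exact hinj t (by omega) t' (by omega) heq
          · have := hinj _ (by omega) _ (by omega) heq
            omega
        rw [hcard]
        have h1 : ((f k).1 * 2 ^ L : ℝ) / (lam * 2 ^ (k : ℕ)) ≤ w k (f k).1 := Nat.le_ceil _
        rw [div_le_iff₀ (by positivity)] at h1
        have hn' : (0 : ℝ) < n := by exact_mod_cast hn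
        rw [← mul_div_assoc, le_div_iff₀ hn']
        have h2 : (n : ℝ) ≤ 2 ^ L := by exact_mod_cast hnL
        have h3 : ((f k).1 : ℝ) * n ≤ (f k).1 * 2 ^ L := mul_le_mul_of_nonneg_left h2 (by positivity)
        linarith
      have hexp : Real.exp (∑ k : Fin L, -(lam * 2 ^ (k : ℕ) * ((S f k).card / (n : ℝ)))) ≤
          Real.exp (-1) ^ (∑ k, (f k).1) := by
        rw [← Real.exp_nat_mul]
        refine Real.exp_le_exp.2 ?_
        rw [Finset.sum_neg_distrib]
        push_cast
        have := Finset.sum_le_sum fun k (_ : k ∈ Finset.univ) => hterm k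
        linarith
      refine hexp.trans ?_
      -- The factor `2 ^ (∑ a - T) ≥ 1` replaces the restriction `∑ a ≥ T`.
      rw [Finset.prod_pow_eq_pow_sum, mul_pow, le_div_iff₀ (by positivity), mul_comm]
      exact mul_le_mul_of_nonneg_right (pow_le_pow_right₀ (by norm_num) hT) (by positivity)
  refine (MeasureTheory.measure_mono hcover).trans ((MeasureTheory.measure_biUnion_finset_le _ _).trans
    ((Finset.sum_le_sum hone).trans ?_))
  rw [← ENNReal.ofReal_sum_of_nonneg fun _ _ => by positivity]
  refine ENNReal.ofReal_le_ofReal ?_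
  rw [← Finset.sum_div]
  refine div_le_div_of_nonneg_right ?_ (by positivity)
  calc ∑ f ∈ P.filter F, ∏ k, (2 * Real.exp (-1)) ^ (f k).1
      ≤ ∑ f ∈ P, ∏ k, (2 * Real.exp (-1)) ^ (f k).1 :=
        Finset.sum_le_sum_of_subset_of_nonneg (Finset.filter_subset _ _) fun _ _ _ => by positivity
    _ = ∏ _k : Fin L, ∑ x ∈ D, (2 * Real.exp (-1)) ^ x.1 :=
        (Finset.prod_univ_sum (fun _ => D) fun _ x => (2 * Real.exp (-1)) ^ x.1).symm
    _ ≤ ∏ _k : Fin L, (8 : ℝ) :=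
        Finset.prod_le_prod (fun _ _ => by positivity) fun _ _ => sum_two_div_exp_le N
    _ = 8 ^ L := by simp

end Data
end RSP

/-! ### Optimal simple paths and the correctness of the answers. -/

namespace RSP

variable {n m : ℕ}

/-! ### Simple paths -/

namespace Net

variable {G : Net n m}

/-- The vertices of a path from `a`. -/
def verts (G : Net n m) (a : Fin n) (p : List (Fin m)) : List (Fin n) := a :: p.map G.tgt

theorem IsPath.exists_suffix {a b x : Fin n} {p : List (Fin m)} (hp : G.IsPath a p b)
    (hx : x ∈ G.verts a p) :
    ∃ q, G.IsPath x q b ∧ q.Sublist p ∧ (G.verts x q).Sublist (G.verts a p) := by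
  induction p generalizing a with
  | nil =>
    simp only [verts, List.map_nil, List.mem_singleton] at hx
    subst hx
    exact ⟨[], hp, List.Sublist.refl _, List.Sublist.refl _⟩
  | cons e p ih =>
    by_cases hxa : x = a
    · subst hxa
      exact ⟨e :: p, hp, List.Sublist.refl _, List.Sublist.refl _⟩
    · obtain ⟨q, hq, hqp, hv⟩ := ih hp.2 (by simpa [verts, hxa] using hx)
      exact ⟨q, hq, hqp.cons e, hv.cons a⟩

theorem IsPath.exists_simple {a b : Fin n} {p : List (Fin m)} (hp : G.IsPath a p b) :
    ∃ q, G.IsPath a q b ∧ q.Sublist p ∧ (G.verts a q).Nodup := by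
  induction p generalizing a with
  | nil => exact ⟨[], hp, List.Sublist.refl _, by simp [verts]⟩
  | cons e p ih =>
    obtain ⟨q, hq, hqp, hnd⟩ := ih hp.2
    by_cases ha : a ∈ G.verts (G.tgt e) q
    · obtain ⟨q', hq', hqq, hv⟩ := hq.exists_suffix ha
      exact ⟨q', hq', (hqq.trans hqp).cons e, hnd.sublist hv⟩
    · exact ⟨e :: q, ⟨hp.1, hq⟩, hqp.cons_cons e, List.nodup_cons.2 ⟨ha, hnd⟩⟩

theorem length_lt_of_nodup {a : Fin n} {p : List (Fin m)} (h : (G.verts a p).Nodup) :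
    p.length < n := by
  have := h.length_le_card
  simpa [verts] using this

/-- Removing cycles increases neither length nor delay, so the minimum may be taken over the
finitely many simple paths. -/
theorem exists_shortest {a b : Fin n} {δ : ℝ}
    (h : ∃ p, G.IsPath a p b ∧ (G.pathDelay p : ℝ) ≤ δ) :
    ∃ p, G.IsPath a p b ∧ (G.verts a p).Nodup ∧ (G.pathDelay p : ℝ) ≤ δ ∧
      ∀ q, G.IsPath a q b → (G.pathDelay q : ℝ) ≤ δ → G.pathLen p ≤ G.pathLen q := by
  have hsimple : ∀ q, G.IsPath a q b → (G.pathDelay q : ℝ) ≤ δ →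
      ∃ p, (G.IsPath a p b ∧ (G.verts a p).Nodup ∧ (G.pathDelay p : ℝ) ≤ δ) ∧
        G.pathLen p ≤ G.pathLen q := by
    intro q hq hd
    obtain ⟨p, hp, hpq, hnd⟩ := hq.exists_simple
    refine ⟨p, ⟨hp, hnd, le_trans ?_ hd⟩, (hpq.map _).sum_le_sum fun _ _ => zero_le⟩
    exact NNReal.coe_le_coe.2 ((hpq.map _).sum_le_sum fun _ _ => zero_le)
  have hfin : {p | G.IsPath a p b ∧ (G.verts a p).Nodup ∧ (G.pathDelay p : ℝ) ≤ δ}.Finite :=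
    (List.finite_length_lt (Fin m) n).subset fun p hp => length_lt_of_nodup hp.2.1
  obtain ⟨q, hq, hqd⟩ := h
  obtain ⟨p₀, hp₀, -⟩ := hsimple q hq hqd
  obtain ⟨p, ⟨hp, hnd, hd⟩, hmin⟩ := Set.exists_min_image _ G.pathLen hfin ⟨p₀, hp₀⟩
  refine ⟨p, hp, hnd, hd, fun q hq hqd => ?_⟩
  obtain ⟨p', hp', hle⟩ := hsimple q hq hqd
  exact (hmin p' hp').trans hle

theorem IsPath.getElem {a b : Fin n} {p : List (Fin m)} (hp : G.IsPath a p b) :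
    (∀ (i : ℕ) (hi : i < p.length), G.src p[i] = (G.verts a p)[i]'(by simp [verts]; omega)) ∧
      (G.verts a p)[p.length]'(by simp [verts]) = b := by
  induction p generalizing a with
  | nil => exact ⟨fun i hi => absurd hi (Nat.not_lt_zero _), hp⟩
  | cons e p ih =>
    obtain ⟨h1, h2⟩ := ih hp.2
    refine ⟨fun i hi => ?_, h2⟩
    cases i with
    | zero => exact hp.1
    | succ i => exact h1 i (by simpa using hi)

end Net

namespace Data

variable {d : Data n m}

/-- A simple path that is shortest among the paths from `s` to `t` of delay at most `δ`. -/
structure Optimal (d : Data n m) (s t : Fin n) (δ : ℝ) (h : ℕ) (p e : ℕ → ℕ) : Prop where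
  route : d.Route d.L h p e
  start : p 0 = s
  finish : p h = t
  lt : ∀ i ≤ h, p i < n
  inj : ∀ i ≤ h, ∀ j ≤ h, p i = p j → i = j
  delay_le : ∑ i ∈ Finset.range h, d.delay (e i) ≤ δ
  len_le : ∀ q, d.net.IsPath s q t → (d.net.pathDelay q : ℝ) ≤ δ →
    ∑ i ∈ Finset.range h, d.len (e i) ≤ d.net.pathLen q

theorem exists_optimal {s t : Fin n} {δ : ℝ}
    (h : ∃ q, d.net.IsPath s q t ∧ (d.net.pathDelay q : ℝ) ≤ δ) :
    ∃ h p e, d.Optimal s t δ h p e := by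
  obtain ⟨q, hq, hnd, hdel, hmin⟩ := Net.exists_shortest h
  obtain ⟨hg1, hg2⟩ := hq.getElem
  have hlen : (d.net.verts s q).length = q.length + 1 := by simp [Net.verts]
  let p : ℕ → ℕ := pad fun i : Fin (q.length + 1) => ((d.net.verts s q)[i]'(by rw [hlen]; exact i.2) : ℕ)
  let e : ℕ → ℕ := pad fun i : Fin q.length => (q[i] : ℕ)
  have hp : ∀ (i : ℕ) (hi : i ≤ q.length), p i = (d.net.verts s q)[i]'(by omega) := by
    intro i hi
    simp only [p, pad]
    rw [dif_pos (by omega)]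
    rfl
  have he : ∀ (i : ℕ) (hi : i < q.length), e i = q[i] := by
    intro i hi
    simp only [e, pad]
    rw [dif_pos hi]
    rfl
  have hpad : ∀ {α : Type} [Zero α] (f : Fin m → α) (i : ℕ) (hi : i < q.length),
      pad f (e i) = f q[i] := by
    intro α _ f i hi
    rw [pad, dif_pos (by rw [he i hi]; exact Fin.is_lt _)]
    congr 1
    exact Fin.ext (he i hi)
  have hsum : ∀ f : Fin m → ℝ≥0, ∑ i ∈ Finset.range q.length, pad (fun x => (f x : ℝ)) (e i) =
      ((q.map f).sum : ℝ≥0) := by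
    intro f
    rw [Finset.sum_range, ← Fin.sum_univ_fun_getElem q f]
    push_cast
    exact Finset.sum_congr rfl fun i _ => hpad _ i i.2
  have h00 : (d.L - d.L) % 2 = 0 := by simp
  refine ⟨q.length, p, e, ⟨?_, ?_, ?_⟩, ?_, ?_, ?_, ?_, ?_, ?_⟩
  · intro i hi
    rw [he i hi]; exact Fin.is_lt _
  · intro i hi
    rw [Data.tail, if_pos h00, src, hpad _ i hi, hp i hi.le, hg1 i hi]
  · intro i hi
    rw [Data.head, if_pos h00, tgt, hpad _ i hi, hp (i + 1) hi]
    simp [Net.verts]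
  · rw [hp 0 (Nat.zero_le _)]; rfl
  · rw [hp _ le_rfl, hg2]
  · intro i hi
    rw [hp i hi]; exact Fin.is_lt _
  · intro i hi j hj hij
    rw [hp i hi, hp j hj] at hij
    exact (hnd.getElem_inj_iff).1 (Fin.ext hij)
  · exact (hsum _).trans_le hdel
  · intro q' hq' hd'
    exact (hsum _).trans_le (NNReal.coe_le_coe.2 (hmin q' hq' hd'))

/-- The sources are dense on a shortest path from `s` to `t` of delay at most `δ`. -/
def Covered (d : Data n m) (T : ℕ) (s t : Fin n) (δ : ℝ) : Prop :=
  (∃ q, d.net.IsPath s q t ∧ (d.net.pathDelay q : ℝ) ≤ δ) →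
    ∃ h p e, d.Optimal s t δ h p e ∧ d.Dense T h p

/-- The optimal path depends on the graph only and is fixed before the sources are drawn. -/
theorem tapeLaw_not_covered_le (d : Data n m) (hn : 1 ≤ n) (hnL : n ≤ 2 ^ d.L) (hlam : 0 < d.lam)
    (T : ℕ) (s t : Fin n) (δ : ℝ) :
    tapeLaw {ω | ¬ (d.sampled ω).Covered T s t δ} ≤ ENNReal.ofReal (8 ^ d.L / 2 ^ T) := by
  by_cases h : ∃ q, d.net.IsPath s q t ∧ (d.net.pathDelay q : ℝ) ≤ δ
  · obtain ⟨h', p, e, ho⟩ := exists_optimal h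
    refine (MeasureTheory.measure_mono fun ω (hω : ¬ (d.sampled ω).Covered T s t δ)
      (hd : (d.sampled ω).Dense T h' p) => hω fun _ => ⟨h', p, e, ?_, hd⟩).trans
      (d.tapeLaw_not_dense_le hn hnL hlam T ho.lt ho.inj)
    exact ⟨⟨ho.route.lt, ho.route.tail, ho.route.head⟩, ho.start, ho.finish, ho.lt, ho.inj,
      ho.delay_le, ho.len_le⟩
  · have : {ω | ¬ (d.sampled ω).Covered T s t δ} = ∅ := by
      ext ω
      simp only [Set.mem_ofPred_eq, Set.mem_empty_iff_false, iff_false, not_not]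
      exact fun hq => absurd hq h
    rw [this, MeasureTheory.measure_empty]
    exact zero_le

/-! ### Correctness of the answers -/

theorem err_eq (d : Data n m) (sc : ℝ) (h : ℕ) (X : ℕ → ℕ) (k : ℕ) :
    d.err sc h X k = h * d.g sc 0 + ∑ i ∈ Finset.range k, X i * d.g sc (i + 1) := by
  induction k with
  | zero => simp [err]
  | succ k ih => rw [err, ih, Finset.sum_range_succ]; ring

/-- The assumption on `T` turns density into `∑ X k * 2 ^ k ≤ 2 ^ L`. In units of `2 ^ L * g 0 = sc
/ (8 * E)`, level 0 contributes at most 1 and the other levels together at most 2. -/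
theorem err_le {T h : ℕ} {sc : ℝ} (hsc : 0 < sc) (hE : 0 < d.E) (hlam : 0 < d.lam)
    (hT : T + d.L ≤ d.lam) (hh : h ≤ 2 ^ d.L) {X : ℕ → ℕ}
    (hX : ∑ k ∈ Finset.range d.L, X k * (d.lam * 2 ^ k) ≤ (T + d.L) * 2 ^ d.L) :
    d.err sc h X d.L ≤ 3 * (sc / (8 * d.E)) := by
  have hE' : (0 : ℝ) < d.E := by exact_mod_cast hE
  have hX' : ∑ k ∈ Finset.range d.L, X k * 2 ^ k ≤ 2 ^ d.L := by
    refine Nat.le_of_mul_le_mul_left ?_ hlam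
    rw [Finset.mul_sum]
    calc ∑ k ∈ Finset.range d.L, d.lam * (X k * 2 ^ k)
        = ∑ k ∈ Finset.range d.L, X k * (d.lam * 2 ^ k) :=
          Finset.sum_congr rfl fun _ _ => by ring
      _ ≤ _ := hX.trans (Nat.mul_le_mul_right _ hT)
  have hX'' : ∑ k ∈ Finset.range d.L, (X k * 2 ^ k : ℝ) ≤ 2 ^ d.L := by exact_mod_cast hX'
  have hh' : (h : ℝ) ≤ 2 ^ d.L := by exact_mod_cast hh
  have hsum : ∑ i ∈ Finset.range d.L, (X i : ℝ) * d.g sc (i + 1) =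
      (∑ i ∈ Finset.range d.L, (X i * 2 ^ i : ℝ)) * (2 * (sc / (8 * d.E * 2 ^ d.L))) := by
    rw [Finset.sum_mul]
    refine Finset.sum_congr rfl fun i _ => ?_
    rw [g, pow_succ]; ring
  rw [err_eq, hsum, g, pow_zero, mul_one]
  have hu : 0 ≤ sc / (8 * d.E * 2 ^ d.L) := by positivity
  have h1 := mul_le_mul_of_nonneg_right hh' hu
  have h2 := mul_le_mul_of_nonneg_right hX'' (by linarith : 0 ≤ 2 * (sc / (8 * d.E * 2 ^ d.L)))
  have h3 : (2 : ℝ) ^ d.L * (sc / (8 * d.E * 2 ^ d.L)) = sc / (8 * d.E) := by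
    field_simp
  linarith

/-- With `u = D₀ / (8 * E)`, the optimal path for the next grid delay needs the budget `z * (8 * E +
4) * u + 3 * u`, and `I * u` exceeds `(8 * (E + 1) * z - 1) * u`; this suffices because `z ≥ 1`.
Conversely `I * u ≤ (1 + 1 / E) * D₀ * z ≤ (1 + ε) * D`. -/
theorem isAnswer {T : ℕ} {ε sc D : ℝ} {s t : Fin n} {ω : Tape} (hE : 0 < d.E)
    (hEε : 1 / (d.E : ℝ) ≤ ε) (hn : 1 ≤ n) (hnL : n ≤ 2 ^ d.L) (hlam : 0 < d.lam)
    (hT : T + d.L ≤ d.lam) (hY : d.Y = sources n (d.lam * 2 ^ d.L) ω) (hsc : 0 < sc) (hD : sc ≤ D)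
    (hcov : d.Covered T s t (sc * 2 ^ scaleOf sc D * ratio d.E ^ (slotOf d.E sc D + 1))) :
    d.net.IsAnswer ε s t D (d.answerOf sc s t D) := by
  have hE' : (1 : ℝ) ≤ d.E := by exact_mod_cast hE
  obtain ⟨-, hs2⟩ := scaleOf_spec hsc hD
  obtain ⟨h1, h2, -⟩ := slotOf_spec hE hsc hD
  obtain ⟨D₀, hD₀⟩ : ∃ D₀, D₀ = sc * 2 ^ scaleOf sc D := ⟨_, rfl⟩
  obtain ⟨z, hz⟩ : ∃ z, z = ratio d.E ^ slotOf d.E sc D := ⟨_, rfl⟩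
  have hD₀pos : 0 < D₀ := by rw [hD₀]; positivity
  have hz1 : 1 ≤ z := hz ▸ one_le_pow₀ (one_lt_ratio hE).le
  obtain ⟨I, hI⟩ : ∃ I, I = floorTo (8 * (d.E + 1) * z) (32 * d.E) := ⟨_, rfl⟩
  obtain ⟨r, hr⟩ : ∃ r, r = d.lam * 2 ^ d.L + s := ⟨_, rfl⟩
  have hcell : d.cellOf sc s t D = d.tbl D₀ d.L r I t := by
    rw [cellOf, ← hD₀, ← hz, ← hI, ← hr]
  rw [pow_succ, ← hz, ← hD₀] at h2 hcov
  rw [← hz, ← hD₀] at h1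
  rw [← hD₀] at hs2
  have hz2 : z ≤ 2 := by
    by_contra hlt
    have := mul_lt_mul_of_pos_left (not_le.1 hlt) hD₀pos
    linarith
  have hIup : (I : ℝ) ≤ 8 * (d.E + 1) * z := hI ▸ floorTo_le_self (by positivity) _
  have hIlo : 8 * (d.E + 1) * z < I + 1 := by
    rw [hI]
    refine lt_floorTo ?_
    push_cast
    -- By `z ≤ 2` and `E ≥ 1`, `8 * (E + 1) * z ≤ 16 * (E + 1) < 32 * E + 1`, so the bound `32 * E`
    -- does not cut off the floor.
    nlinarith
  have hrM : r < d.M d.L := by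
    have := s.2
    have h1l : 1 * 2 ^ d.L ≤ d.lam * 2 ^ d.L := Nat.mul_le_mul_right _ hlam
    unfold M
    rw [pow_succ, ← mul_assoc, hr]
    omega
  have hYr : d.Y r = s := by
    rw [hY, sources, if_neg (by omega), hr, Nat.add_sub_cancel_left, Nat.mod_eq_of_lt s.2]
  have hIN : I ≤ d.N d.L := by
    rw [hI, N, Nat.sub_self, pow_zero, mul_one]; exact floorTo_le _ _
  have hg : d.g D₀ d.L = D₀ / (8 * d.E) := by
    unfold g
    field_simp
  have hEne : (d.E : ℝ) ≠ 0 := by linarith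
  have hcomp : ∀ {h p e}, d.Optimal s t (D₀ * (z * ratio d.E)) h p e → d.Dense T h p →
      UB (d.tbl D₀ d.L r I t) (∑ i ∈ Finset.range h, d.len (e i) + 1) := by
    rintro h p e ho ⟨X, hX, hXs⟩
    have hhn : h ≤ 2 ^ d.L := by
      have hcard := Finset.card_le_card_of_injOn (s := Finset.range (h + 1)) (t := Finset.range n) p
        (fun i hi => by
          have := Finset.mem_range.1 hi
          simpa using ho.lt i (by omega))
        (fun i hi j hj hij => ho.inj i (by have := Finset.mem_range.1 (Finset.mem_coe.1 hi); omega) j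
          (by have := Finset.mem_range.1 (Finset.mem_coe.1 hj); omega) hij)
      rw [Finset.card_range, Finset.card_range] at hcard
      omega
    have herr := err_le (d := d) hD₀pos hE hlam hT hhn hXs
    have := d.tbl_complete hE hD₀pos le_rfl ho.route hX (i := 0) (j := h) (r := r) (I := I)
      (Nat.zero_le _) le_rfl (fun i hi hor => by omega) hrM (hYr.trans ho.start.symm) ?_
    · rwa [ho.finish, ← Finset.range_eq_Ico] at this
    · rw [← Finset.range_eq_Ico, hg]
      have hdel := ho.delay_le
      have hu : D₀ / (8 * d.E) * (8 * d.E) = D₀ := by field_simp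
      have hu0 : 0 < D₀ / (8 * d.E) := by positivity
      have hlow := mul_lt_mul_of_pos_right hIlo hu0
      have hrat : D₀ * (z * ratio d.E) = D₀ / (8 * d.E) * (z * (8 * d.E + 4)) := by
        unfold ratio
        field_simp
        ring
      nlinarith
  have hopt : (∃ q, d.net.IsPath s q t ∧ (d.net.pathDelay q : ℝ) ≤ D) →
      1 ≤ d.tbl D₀ d.L r I t ∧ ∀ q, d.net.IsPath s q t → (d.net.pathDelay q : ℝ) ≤ D →
        d.tbl D₀ d.L r I t - 1 ≤ d.net.pathLen q := by
    rintro ⟨q, hq, hqD⟩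
    -- The path is optimal for a delay larger than `D`, hence at least as short as every path of
    -- delay at most `D`.
    obtain ⟨h, p, e, ho, hd⟩ := hcov ⟨q, hq, hqD.trans h2.le⟩
    obtain ⟨hc1, hc2⟩ := hcomp ho hd
    refine ⟨hc1, fun q' hq' hqD' => ?_⟩
    have := ho.len_le q' hq' (hqD'.trans h2.le)
    linarith
  have hbot : ¬ (∃ q, d.net.IsPath s q t ∧ (d.net.pathDelay q : ℝ) ≤ D) →
      d.net.dist s t D = ⊤ := by
    intro hno
    unfold Net.dist
    simp only [iInf_eq_top]
    exact fun q hq => absurd ⟨q, hq⟩ hno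
  unfold answerOf
  rw [hcell]
  split_ifs with hc
  · obtain ⟨a, b, ha, hb, p, hp, hlen, hdel⟩ := d.tbl_sound hE hD₀pos
      (fun r => hY ▸ sources_lt hn ω r) le_rfl hIN hc
    rw [hYr] at ha
    obtain rfl := Fin.ext ha
    obtain rfl := Fin.ext hb
    rw [Nat.sub_self, if_pos rfl] at hp
    refine ⟨p, hp, hlen, ?_, hdel.trans ?_⟩
    · by_cases hex : ∃ q, d.net.IsPath a q b ∧ (d.net.pathDelay q : ℝ) ≤ D
      · refine le_iInf₂ fun q hq => ?_
        have := (hopt hex).2 q hq.1 hq.2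
        rw [hlen] at this
        exact_mod_cast this
      · rw [hbot hex]; exact le_top
    · rw [hg]
      have h3 : (I : ℝ) * (D₀ / (8 * d.E)) ≤ 8 * (d.E + 1) * z * (D₀ / (8 * d.E)) :=
        mul_le_mul_of_nonneg_right hIup (by positivity)
      have h4 : 8 * (d.E + 1) * z * (D₀ / (8 * d.E)) = (1 + 1 / d.E) * (D₀ * z) := by
        field_simp
      have h5 : (1 + 1 / (d.E : ℝ)) * (D₀ * z) ≤ (1 + ε) * D :=
        mul_le_mul (by linarith) h1 (by positivity) (by
          have : 0 < 1 / (d.E : ℝ) := by positivity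
          linarith)
      linarith
  · refine hbot fun hex => hc (hopt hex).1

end Data
end RSP

/-! ### The constants: failure probability, running time and word size. -/

namespace RSP

variable {n m : ℕ}

/-! ### The parameters -/

theorem le_two_pow_levels {L : ℕ} (hn : 2 ≤ n) (hL : ⌊Real.logb 2 n⌋₊ + 1 = L) :
    n ≤ 2 ^ L ∧ 2 ^ L ≤ 2 * n ∧ (L : ℝ) ≤ 4 * Real.log n := by
  have hn' : (2 : ℝ) ≤ n := by exact_mod_cast hn
  obtain ⟨h1, h2⟩ := pow_floor_logb (b := 2) (z := n) (by norm_num) (by linarith)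
  rw [hL] at h2
  refine ⟨by exact_mod_cast h2.le, ?_, ?_⟩
  · rw [← hL, pow_succ, mul_comm]
    exact Nat.mul_le_mul_left _ (by exact_mod_cast h1)
  · have hlog2 := Real.log_two_gt_d9
    have hlog := Real.log_le_log (by norm_num) hn'
    have h3 := Nat.floor_le (Real.logb_nonneg (b := 2) (x := n) (by norm_num) (by linarith))
    have h4 : Real.logb 2 n ≤ 2 * Real.log n := by
      rw [Real.logb, div_le_iff₀ (by linarith)]
      nlinarith
    rw [← hL]
    push_cast
    linarith

theorem floor_logb_le_mul {c L : ℕ} {x : ℝ} (hnL : n ≤ 2 ^ L) (hx : 1 ≤ x) (hxn : x ≤ (n : ℝ) ^ c) :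
    ⌊Real.logb 2 x⌋₊ ≤ c * L := by
  have h1 := (pow_floor_logb (b := 2) (by norm_num) hx).1
  have h2 : (n : ℝ) ^ c ≤ (2 ^ L) ^ c := pow_le_pow_left₀ (by positivity) (by exact_mod_cast hnL) c
  have h3 : (2 : ℝ) ^ ⌊Real.logb 2 x⌋₊ ≤ 2 ^ (c * L) := by
    rw [mul_comm, pow_mul]; linarith
  exact (pow_le_pow_iff_right₀ (by norm_num)).1 h3

/-- The constant in the sampling rate. -/
def rate (c γ : ℕ) : ℕ := 2 * c + γ + 8

theorem tapeLaw_exists_not_covered_le {c γ J E : ℕ} (d : Data n m) (hn : 2 ≤ n)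
    (hnL : n ≤ 2 ^ d.L) (hL : 1 ≤ d.L) (hlam : 0 < d.lam) (hJ : J ≤ c * d.L + 1)
    (hE : E ≤ 2 ^ (c * d.L + 1)) (δ : ℕ → ℕ → ℝ) :
    tapeLaw {ω | ∃ s t, ∃ j < J, ∃ i < 2 * E,
      ¬ (d.sampled ω).Covered ((2 * c + γ + 7) * d.L) s t (δ j i)} ≤
      ENNReal.ofReal (1 / (n : ℝ) ^ γ) := by
  have hsub : {ω | ∃ s t, ∃ j < J, ∃ i < 2 * E,
      ¬ (d.sampled ω).Covered ((2 * c + γ + 7) * d.L) s t (δ j i)} ⊆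
      ⋃ x ∈ (Finset.univ : Finset (Fin n × Fin n)) ×ˢ (Finset.range J ×ˢ Finset.range (2 * E)),
        {ω | ¬ (d.sampled ω).Covered ((2 * c + γ + 7) * d.L) x.1.1 x.1.2 (δ x.2.1 x.2.2)} := by
    rintro ω ⟨s, t, j, hj, i, hi, h⟩
    exact Set.mem_iUnion₂.2 ⟨((s, t), (j, i)), by simp [hj, hi], h⟩
  refine (MeasureTheory.measure_mono hsub).trans
    ((MeasureTheory.measure_biUnion_finset_le _ _).trans
    ((Finset.sum_le_card_nsmul _ _ _ fun x _ =>
      d.tapeLaw_not_covered_le (by omega) hnL hlam _ _ _ _).trans ?_))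
  have hcard : ((Finset.univ : Finset (Fin n × Fin n)) ×ˢ
      (Finset.range J ×ˢ Finset.range (2 * E))).card = n * n * (J * (2 * E)) := by
    simp [Finset.card_product]
  rw [hcard, nsmul_eq_mul, ← ENNReal.ofReal_natCast, ← ENNReal.ofReal_mul (Nat.cast_nonneg _)]
  refine ENNReal.ofReal_le_ofReal ?_
  have hn0 : (0 : ℝ) < n := by exact_mod_cast (by omega : 0 < n)
  rw [← mul_div_assoc, div_le_div_iff₀ (by positivity) (by positivity), one_mul]
  -- In multiples of `L` the exponents are 2 for the pairs, `c` for the scales, `c + 2` for the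
  -- slots, 3 for `8 ^ L` and `γ` for the required probability.
  have hkey : n * n * (J * (2 * E)) * 8 ^ d.L * n ^ γ ≤ 2 ^ ((2 * c + γ + 7) * d.L) := by
    have h1 : J ≤ 2 ^ (c * d.L) := hJ.trans Nat.lt_two_pow_self
    have h2 : 2 * E ≤ 2 ^ (c * d.L + 2 * d.L) := by
      calc 2 * E ≤ 2 * 2 ^ (c * d.L + 1) := Nat.mul_le_mul_left _ hE
        _ = 2 ^ (c * d.L + 2) := by ring
        _ ≤ _ := Nat.pow_le_pow_right (by norm_num) (by omega)
    have h3 : n ^ γ ≤ (2 ^ d.L) ^ γ := Nat.pow_le_pow_left hnL γ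
    calc n * n * (J * (2 * E)) * 8 ^ d.L * n ^ γ
        ≤ 2 ^ d.L * 2 ^ d.L * (2 ^ (c * d.L) * 2 ^ (c * d.L + 2 * d.L)) * 8 ^ d.L * (2 ^ d.L) ^ γ :=
          Nat.mul_le_mul (Nat.mul_le_mul_right _ (Nat.mul_le_mul (Nat.mul_le_mul hnL hnL)
            (Nat.mul_le_mul h1 h2))) h3
      _ = 2 ^ ((2 * c + γ + 7) * d.L) := by
        rw [show (8 : ℕ) = 2 ^ 3 by norm_num]
        simp only [← pow_mul, ← pow_add]
        congr 1
        ring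
  exact_mod_cast hkey

/-- The running time of the preprocessing. -/
def preTime (d : Data n m) (a J : ℕ) : ℕ :=
  d.L * 13 + 30 + (a * 13 + 30 + (20 + (4 + (100 +
      (d.lam * 2 ^ d.L * 40 + 20 + (2 * d.E * (32 * d.E * 29 + 50) + 50 +
      (J * ((d.L + 1) * (100000 * d.unit + 9) + 109) + 9)))))))

theorem preTime_le_nat {d : Data n m} {a J c₀ : ℕ} (hL : 1 ≤ d.L) (hJ : 1 ≤ J) (hE : 1 ≤ d.E)
    (ha : a ≤ d.E) (hlam : d.lam = c₀ * d.L) (hc₀ : 1 ≤ c₀) :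
    preTime d a J ≤ 210000 * (J * d.L * d.unit) + 2000 * d.E ^ 2 := by
  obtain ⟨P, hP⟩ : ∃ P, P = 2 ^ d.L := ⟨_, rfl⟩
  obtain ⟨W, hW⟩ : ∃ W, W = d.lam * P := ⟨_, rfl⟩
  obtain ⟨U, hU⟩ : ∃ U, U = d.unit := ⟨_, rfl⟩
  obtain ⟨V, hV⟩ : ∃ V, V = J * d.L * U := ⟨_, rfl⟩
  have hP1 : 1 ≤ P := hP ▸ Nat.one_le_two_pow
  have hlam1 : d.L ≤ d.lam := hlam ▸ Nat.le_mul_of_pos_left _ hc₀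
  have hW1 : d.lam ≤ W := hW ▸ Nat.le_mul_of_pos_right _ hP1
  have hUW : U = W * d.E * (n + m + W + 1) := by rw [hU, Data.unit, ← hP, hW]; ring
  have hWE : W * d.E ≤ U := hUW ▸ Nat.le_mul_of_pos_right _ (by omega)
  have hUW' : W ≤ U := (Nat.le_mul_of_pos_right _ hE).trans hWE
  have hUE : d.E ≤ U := (Nat.le_mul_of_pos_left _ (by omega)).trans hWE
  have hVU : U ≤ V := hV ▸ Nat.le_mul_of_pos_left _ (Nat.mul_pos hJ hL)
  have hVJ : J ≤ V := by
    rw [hV, mul_assoc]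
    exact Nat.le_mul_of_pos_right _ (Nat.mul_pos hL (by omega))
  have h1 : J * ((d.L + 1) * (100000 * U + 9) + 109) ≤ 200018 * V + 109 * J := by
    have h2 : (d.L + 1) * (100000 * U + 9) ≤ (2 * d.L) * (100009 * U) :=
      Nat.mul_le_mul (by omega) (by omega)
    calc J * ((d.L + 1) * (100000 * U + 9) + 109) ≤ J * ((2 * d.L) * (100009 * U) + 109) :=
          Nat.mul_le_mul_left _ (by omega)
      _ = 200018 * V + 109 * J := by rw [hV]; ring
  have h3 : 2 * d.E * (32 * d.E * 29 + 50) ≤ 1956 * d.E ^ 2 := by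
    have : d.E ≤ d.E ^ 2 := Nat.le_self_pow (by norm_num) _
    calc 2 * d.E * (32 * d.E * 29 + 50) = 1856 * d.E ^ 2 + 100 * d.E := by ring
      _ ≤ _ := by omega
  unfold preTime
  rw [← hP, ← hW, ← hU, ← hV]
  omega

/-- The constant in the bound for the running time. -/
def timeConst (c c₀ : ℕ) : ℝ := 210000 * ((c + 1) * c₀ * 256 + (c + 1) * c₀ ^ 2 * 12288) + 256000

/-- With `J`, `L`, `lam = O(log n)`, `2 ^ L = O(n)` and `E = O(1/ε)`, the tables cost `O(m n log³ n
/ ε + n² log⁴ n / ε)`; the term with `ε ^ 2` also absorbs the quadratic cost of the index table. -/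
theorem preTime_le {d : Data n m} {a J c c₀ : ℕ} {ε : ℝ} (hn : 2 ≤ n) (hL : 1 ≤ d.L) (hJ : 1 ≤ J)
    (hE : 1 ≤ d.E)
    (ha : a ≤ d.E) (hlam : d.lam = c₀ * d.L) (hc₀ : 1 ≤ c₀) (hnL : n ≤ 2 ^ d.L)
    (hLn : 2 ^ d.L ≤ 2 * n) (hLlog : (d.L : ℝ) ≤ 4 * Real.log n) (hJc : J ≤ c * d.L + 1)
    (hε : 0 < ε) (hε1 : ε ≤ 1) (hEε : (d.E : ℝ) ≤ 2 / ε) :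
    (preTime d a J : ℝ) ≤ timeConst c c₀ *
      (m * n * Real.log n ^ 3 / ε + n ^ 2 * Real.log n ^ 5 / ε ^ 2) := by
  obtain ⟨l, hl⟩ : ∃ l, l = Real.log n := ⟨_, rfl⟩
  obtain ⟨P, hP⟩ : ∃ P, P = 2 ^ d.L := ⟨_, rfl⟩
  have hl1 : 1 ≤ 2 * l := by
    have h2 := Real.log_two_gt_d9
    have := Real.log_le_log (by norm_num) (by exact_mod_cast hn : (2 : ℝ) ≤ n)
    rw [hl]; linarith
  rw [← hl] at hLlog ⊢
  have hV : J * d.L * d.unit ≤ (c + 1) * c₀ * d.L ^ 3 * d.E * P * m +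
      3 * ((c + 1) * c₀ ^ 2) * d.L ^ 4 * d.E * P ^ 2 := by
    have h1 : J ≤ (c + 1) * d.L := hJc.trans (by rw [add_mul]; omega)
    have h2 : n + m + d.lam * P + 1 ≤ m + 3 * (d.lam * P) := by
      have hlam1 : 1 ≤ d.lam := hlam ▸ Nat.mul_pos hc₀ hL
      have h3 : P ≤ d.lam * P := Nat.le_mul_of_pos_left _ hlam1
      omega
    calc J * d.L * d.unit ≤ (c + 1) * d.L * d.L * (d.lam * d.E * P * (m + 3 * (d.lam * P))) := by
          refine Nat.mul_le_mul (Nat.mul_le_mul_right _ h1) ?_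
          rw [Data.unit, ← hP]
          exact Nat.mul_le_mul_left _ h2
      _ = _ := by rw [hlam]; ring
  have hnat := (preTime_le_nat hL hJ hE ha hlam hc₀).trans
    (Nat.add_le_add_right (Nat.mul_le_mul_left _ hV) _)
  have hreal : (preTime d a J : ℝ) ≤ 210000 * ((c + 1) * c₀ * d.L ^ 3 * d.E * P * m +
      3 * ((c + 1) * c₀ ^ 2) * d.L ^ 4 * d.E * P ^ 2) + 2000 * d.E ^ 2 := by exact_mod_cast hnat
  have hPn : (P : ℝ) ≤ 2 * n := by rw [hP]; exact_mod_cast hLn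
  have hl0 : 0 ≤ l := by linarith
  have hn1 : (1 : ℝ) ≤ n := by exact_mod_cast (by omega : 1 ≤ n)
  have e1 : ((d.L : ℝ) ^ 3 * d.E * P * m) ≤ (4 * l) ^ 3 * (2 / ε) * (2 * n) * m := by gcongr
  have e2 : ((d.L : ℝ) ^ 4 * d.E * P ^ 2) ≤ (4 * l) ^ 4 * (2 / ε) * (2 * n) ^ 2 := by gcongr
  have e3 : (d.E : ℝ) ^ 2 ≤ (2 / ε) ^ 2 := by gcongr
  have hX : 0 ≤ m * n * l ^ 3 / ε := by positivity
  have hZ : 0 ≤ n ^ 2 * l ^ 5 / ε ^ 2 := by positivity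
  have e1' : (4 * l) ^ 3 * (2 / ε) * (2 * n) * m = 256 * (m * n * l ^ 3 / ε) := by ring
  have e2' : (4 * l) ^ 4 * (2 / ε) * (2 * n) ^ 2 ≤ 4096 * (n ^ 2 * l ^ 5 / ε ^ 2) := by
    have h1 : 1 / ε ≤ 1 / ε ^ 2 := by
      apply one_div_le_one_div_of_le (by positivity)
      nlinarith
    have h2 : l ^ 4 ≤ 2 * l ^ 5 := by
      have : l ^ 4 * 1 ≤ l ^ 4 * (2 * l) := mul_le_mul_of_nonneg_left hl1 (by positivity)
      linarith [show l ^ 4 * (2 * l) = 2 * l ^ 5 by ring]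
    calc (4 * l) ^ 4 * (2 / ε) * (2 * n) ^ 2 = 2048 * (n : ℝ) ^ 2 * (l ^ 4 * (1 / ε)) := by ring
      _ ≤ 2048 * (n : ℝ) ^ 2 * (2 * l ^ 5 * (1 / ε ^ 2)) := by gcongr
      _ = _ := by ring
  have e3' : (2 / ε) ^ 2 ≤ 128 * (n ^ 2 * l ^ 5 / ε ^ 2) := by
    have h1 : 1 ≤ (2 * l) ^ 5 := one_le_pow₀ hl1
    have h2 : (1 : ℝ) ≤ n ^ 2 := one_le_pow₀ hn1
    have h3 : 1 ≤ (n : ℝ) ^ 2 * (2 * l) ^ 5 := by nlinarith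
    calc (2 / ε) ^ 2 = 4 * (1 / ε ^ 2) * 1 := by ring
      _ ≤ 4 * (1 / ε ^ 2) * (n ^ 2 * (2 * l) ^ 5) := mul_le_mul_of_nonneg_left h3 (by positivity)
      _ = _ := by ring
  obtain ⟨X, hXd⟩ : ∃ X, X = m * n * l ^ 3 / ε := ⟨_, rfl⟩
  obtain ⟨Z, hZd⟩ : ∃ Z, Z = n ^ 2 * l ^ 5 / ε ^ 2 := ⟨_, rfl⟩
  rw [← hXd] at e1' hX ⊢
  rw [← hZd] at e2' e3' hZ ⊢
  have c1 : (0 : ℝ) ≤ (c + 1) * c₀ := by positivity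
  have c2 : (0 : ℝ) ≤ (c + 1) * c₀ ^ 2 := by positivity
  have f1 := mul_le_mul_of_nonneg_left (e1.trans_eq e1') c1
  have f2 := mul_le_mul_of_nonneg_left (e2.trans e2') c2
  have f3 := e3.trans e3'
  have g1 := mul_nonneg c1 hZ
  have g2 := mul_nonneg c2 hX
  unfold timeConst
  calc (preTime d a J : ℝ) ≤ 210000 * ((c + 1) * c₀ * (d.L ^ 3 * d.E * P * m) +
      3 * ((c + 1) * c₀ ^ 2 * (d.L ^ 4 * d.E * P ^ 2))) + 2000 * d.E ^ 2 := by
        refine hreal.trans_eq ?_; ring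
    _ ≤ 210000 * ((c + 1) * c₀ * (256 * X) + 3 * ((c + 1) * c₀ ^ 2 * (4096 * Z))) +
        2000 * (128 * Z) := by linarith
    _ ≤ _ := by nlinarith

/-- The exponent in the bound for the sizes of the tables. -/
def capExp (c γ : ℕ) : ℕ := 4 * c + γ + 40

/-- The exponent is generous: `2 ^ L` is at most `(n + m) ^ 2`, and `n + m ≥ 2` absorbs all
constants, since `r ≤ 2 ^ r`. -/
theorem caps {c γ L a J : ℕ} (hn : 2 ≤ n) (hLn : 2 ^ L ≤ 2 * n)
    (ha : a ≤ c * L + 1) (hJ : J ≤ c * L + 1) :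
    32 ≤ (n + m) ^ capExp c γ ∧ n ≤ (n + m) ^ capExp c γ ∧ m ≤ (n + m) ^ capExp c γ ∧
      J ≤ (n + m) ^ capExp c γ ∧ rate c γ ≤ (n + m) ^ capExp c γ ∧
      rate c γ * L * 2 ^ (L + 2) ≤ (n + m) ^ capExp c γ ∧
      32 * 2 ^ a * 2 ^ L + 1 ≤ (n + m) ^ capExp c γ := by
  obtain ⟨B, hB⟩ : ∃ B, B = n + m := ⟨_, rfl⟩
  rw [← hB]
  have hB2 : 2 ≤ B := by omega
  have h2 : ∀ e, 2 ^ e ≤ B ^ e := fun e => Nat.pow_le_pow_left hB2 e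
  have hmono : ∀ {e f}, e ≤ f → B ^ e ≤ B ^ f := fun h => Nat.pow_le_pow_right (by omega) h
  have hPB : 2 ^ L ≤ B ^ 2 := by
    refine hLn.trans ?_
    rw [pow_two]
    exact Nat.mul_le_mul hB2 (by omega)
  have hPc : 2 ^ (c * L) ≤ B ^ (2 * c) := by
    rw [mul_comm, pow_mul, pow_mul]
    exact Nat.pow_le_pow_left hPB c
  have hr : rate c γ ≤ B ^ (2 * c + γ + 8) := Nat.lt_two_pow_self.le.trans (h2 _)
  have hBe : B ≤ B ^ capExp c γ := Nat.le_self_pow (by unfold capExp; omega) _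
  refine ⟨?_, by omega, by omega, ?_, ?_, ?_, ?_⟩
  · exact (h2 5).trans (hmono (by unfold capExp; omega))
  · exact (hJ.trans Nat.lt_two_pow_self).trans (hPc.trans (hmono (by unfold capExp; omega)))
  · exact hr.trans (hmono (by unfold capExp; omega))
  · calc rate c γ * L * 2 ^ (L + 2) ≤ B ^ (2 * c + γ + 8) * B ^ 2 * (B ^ 2 * B ^ 2) := by
          refine Nat.mul_le_mul (Nat.mul_le_mul hr (Nat.lt_two_pow_self.le.trans hPB)) ?_
          rw [pow_add]
          exact Nat.mul_le_mul hPB (h2 2)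
      _ = B ^ (2 * c + γ + 14) := by rw [← pow_add, ← pow_add, ← pow_add]
      _ ≤ _ := hmono (by unfold capExp; omega)
  · have h1 : 2 ^ a ≤ B ^ (2 * c) * B := by
      refine (Nat.pow_le_pow_right (by norm_num) ha).trans ?_
      rw [pow_succ]
      exact Nat.mul_le_mul hPc hB2
    have h3 : 1 ≤ 2 ^ a * 2 ^ L := Nat.mul_pos (by positivity) (by positivity)
    calc 32 * 2 ^ a * 2 ^ L + 1 ≤ 2 ^ 6 * (2 ^ a * 2 ^ L) := by rw [mul_assoc]; omega
      _ ≤ B ^ 6 * (B ^ (2 * c) * B * B ^ 2) := Nat.mul_le_mul (h2 6) (Nat.mul_le_mul h1 hPB)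
      _ = B ^ (2 * c + 9) := by ring
      _ ≤ _ := hmono (by unfold capExp; omega)

end RSP

theorem mainTheorem3 (c γ : ℕ) :
    ∃ (pre query : RSP.Cmd) (κ : ℕ) (C : ℝ) (K : ℕ), 1 ≤ κ ∧
      ∀ (n m : ℕ) (G : RSP.Net n m) (ε Dmin Dmax : ℝ), 2 ≤ n →
        0 < ε → ε ≤ 1 → 1 / ε ≤ (n : ℝ) ^ c →
        0 < Dmin → Dmin ≤ Dmax → Dmax / Dmin ≤ (n : ℝ) ^ c →
        ∃ (ds : RSP.Tape → RSP.Store) (ans : RSP.Tape → Fin n → Fin n → ℝ → Option ℝ),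
          (∀ ω, ∃ T : ℕ,
            RSP.Exec ((n + m) ^ κ) ω pre (RSP.startStore G ε Dmin Dmax) (ds ω) T ∧
            (T : ℝ) ≤ C * (m * n * Real.log n ^ 3 / ε + n ^ 2 * Real.log n ^ 5 / ε ^ 2)) ∧
          (∀ ω (s t : Fin n) (D : ℝ), D ∈ Set.Icc Dmin Dmax → ∀ ω' : RSP.Tape,
            ∃ (τ : RSP.Store) (T : ℕ),
              RSP.Exec ((n + m) ^ κ) ω' query (RSP.queryStore (ds ω) s t D) τ T ∧
              T ≤ K ∧ τ.warr = (ds ω).warr ∧ τ.rarr = (ds ω).rarr ∧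
              τ.answer = ans ω s t D) ∧
          RSP.tapeLaw {ω | ¬ ∀ (s t : Fin n) (D : ℝ), D ∈ Set.Icc Dmin Dmax →
            G.IsAnswer ε s t D (ans ω s t D)} ≤ ENNReal.ofReal (1 / (n : ℝ) ^ γ) := by
  refine ⟨RSP.Prog.pre (RSP.rate c γ), RSP.Prog.query, RSP.capExp c γ * RSP.slack,
    RSP.timeConst c (RSP.rate c γ), 150,
    Nat.mul_pos (by unfold RSP.capExp; omega) (by unfold RSP.slack; norm_num), ?_⟩
  intro n m G ε Dmin Dmax hn hε hε1 hεn hDmin hDD hDn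
  -- Stored words are bounded by `A = (n + m) ^ capExp`, machine words by `A ^ slack`.
  rw [pow_mul]
  obtain ⟨L, hL⟩ : ∃ L, ⌊Real.logb 2 n⌋₊ + 1 = L := ⟨_, rfl⟩
  obtain ⟨a, ha⟩ : ∃ a, ⌊Real.logb 2 (1 / ε)⌋₊ + 1 = a := ⟨_, rfl⟩
  obtain ⟨J, hJ⟩ : ∃ J, ⌊Real.logb 2 (Dmax / Dmin)⌋₊ + 1 = J := ⟨_, rfl⟩
  have hεinv : 1 ≤ 1 / ε := (one_le_div hε).2 hε1
  have hDinv : 1 ≤ Dmax / Dmin := (one_le_div hDmin).2 hDD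
  obtain ⟨hnL, hLn, hLlog⟩ := RSP.le_two_pow_levels hn hL
  have hac : a ≤ c * L + 1 := ha ▸ Nat.succ_le_succ (RSP.floor_logb_le_mul hnL hεinv hεn)
  have hJc : J ≤ c * L + 1 := hJ ▸ Nat.succ_le_succ (RSP.floor_logb_le_mul hnL hDinv hDn)
  obtain ⟨hA32, hnA, hmA, hJA, hrA, hcap, hN⟩ :=
    RSP.caps (m := m) (c := c) (γ := γ) hn hLn hac hJc
  obtain ⟨A, hA⟩ : ∃ A, A = (n + m) ^ RSP.capExp c γ := ⟨_, rfl⟩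
  rw [← hA] at hA32 hnA hmA hJA hrA hcap hN ⊢
  obtain ⟨d, hd⟩ : ∃ d : RSP.Data n m, d = ⟨G, 2 ^ a, L, RSP.rate c γ * L, fun _ => 0⟩ := ⟨_, rfl⟩
  have hr0 : 1 ≤ RSP.rate c γ := by unfold RSP.rate; omega
  have hdL : d.L = L := by rw [hd]
  have hdE : d.E = 2 ^ a := by rw [hd]
  have hdlam : d.lam = RSP.rate c γ * L := by rw [hd]
  have hdG : d.net = G := by rw [hd]
  rw [← hdL] at hL hnL hLn hLlog hac hJc hcap hN hdlam
  rw [← hdlam] at hcap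
  rw [← hdE] at hN
  have hL1 : 1 ≤ d.L := by omega
  have hE1 : 1 ≤ d.E := hdE ▸ Nat.one_le_two_pow
  have hlam0 : 0 < d.lam := hdlam ▸ Nat.mul_pos hr0 hL1
  obtain ⟨hpow1, hpow2⟩ := RSP.pow_floor_logb (b := 2) (by norm_num) hεinv
  have hEε : (d.E : ℝ) ≤ 2 / ε := by
    rw [hdE, ← ha, pow_succ]
    push_cast
    rw [show 2 / ε = 1 / ε * 2 by ring]
    linarith
  have hEε' : 1 / (d.E : ℝ) ≤ ε := by
    rw [one_div_le (by positivity) hε, hdE, ← ha]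
    push_cast
    exact hpow2.le
  have hpre : ∀ ω, RSP.Runs A ω (RSP.Prog.pre (RSP.rate c γ)) (RSP.startStore G ε Dmin Dmax)
      (RSP.preTime d a J) ((d.sampled ω).Ready Dmin J) := fun ω =>
    RSP.Data.runs_pre (d := d.sampled ω) hA32 hn hnA hmA hεinv hDinv hdG hL ha hdE hJ hdlam hr0
      rfl hJA hrA hcap hN
  choose ds T hexec hT hBd hready using hpre
  refine ⟨ds, fun ω s t D => (d.sampled ω).answerOf Dmin s t D, fun ω => ⟨T ω, hexec ω, ?_⟩,
    fun ω s t D hD ω' => ?_, ?_⟩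
  · have h1 := RSP.preTime_le (d := d) (a := a) hn hL1 (by omega : 1 ≤ J) hE1
      (hdE ▸ Nat.lt_two_pow_self.le) hdlam hr0 hnL hLn hLlog hJc hε hε1 hEε
    exact le_trans (by exact_mod_cast hT ω) h1
  · have hscale : RSP.Data.scaleOf Dmin D < J := by
      have : Real.logb 2 (D / Dmin) ≤ Real.logb 2 (Dmax / Dmin) := by
        refine Real.logb_le_logb_of_le (by norm_num) (div_pos (hDmin.trans_le hD.1) hDmin) ?_
        exact div_le_div_of_nonneg_right hD.2 hDmin.le
      have := Nat.floor_mono this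
      unfold RSP.Data.scaleOf
      omega
    obtain ⟨τ, T', hex, hT', -, hw, hr, hans⟩ := RSP.Data.runs_query (ω := ω') hA32 (hBd ω)
      (hready ω) hE1 hlam0 hnA hnL hDmin hJA s t hD.1 hscale
    exact ⟨τ, T', hex, hT', hw, hr, hans⟩
  -- A wrong answer implies that some grid delay `Dmin * 2 ^ j * ratio ^ (i + 1)` is not covered.
  -- The continuum of delays `D` thus leads to finitely many events.
  · refine (MeasureTheory.measure_mono ?_).trans
      (RSP.tapeLaw_exists_not_covered_le (γ := γ) (J := J) (E := d.E) d hn hnL hL1 hlam0 hJc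
        (hdE ▸ Nat.pow_le_pow_right (by norm_num) hac)
        fun j i => Dmin * 2 ^ j * RSP.ratio d.E ^ (i + 1))
    intro ω (hω : ¬ _)
    by_contra hno
    refine hω fun s t D hD => ?_
    have hscale : RSP.Data.scaleOf Dmin D < J := by
      have : Real.logb 2 (D / Dmin) ≤ Real.logb 2 (Dmax / Dmin) := by
        refine Real.logb_le_logb_of_le (by norm_num) (div_pos (hDmin.trans_le hD.1) hDmin) ?_
        exact div_le_div_of_nonneg_right hD.2 hDmin.le
      have := Nat.floor_mono this
      unfold RSP.Data.scaleOf
      omega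
    have hslot := (RSP.Data.slotOf_spec hE1 hDmin hD.1).2.2
    have hcov : (d.sampled ω).Covered ((2 * c + γ + 7) * d.L) s t
        (Dmin * 2 ^ RSP.Data.scaleOf Dmin D *
          RSP.ratio d.E ^ (RSP.Data.slotOf d.E Dmin D + 1)) := by
      by_contra hc
      exact hno ⟨s, t, _, hscale, _, hslot, hc⟩
    have hTl : (2 * c + γ + 7) * d.L + d.L ≤ d.lam := by
      rw [hdlam, RSP.rate]
      exact le_of_eq (by ring)
    have := RSP.Data.isAnswer (d := d.sampled ω) (ε := ε) hE1 hEε' (by omega) hnL hlam0 hTl rfl hDmin hD.1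
      hcov
    rw [← hdG]
    exact this
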